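/- Let $d\ge 1$, $m=d+2$, $\gamma>1$, $s_0\in\mathbb R$, $t_f>0$. For $u=(\rho,\rho V,\rho E)\in\mathbb R^m$ put $p=(\gamma-1)(\rho E-\rho|V|^2/2)$ and $X_u=\{u:\rho>0,\ p>0\}$. Let $F(u)$ be the $m\times d$ inviscid Euler flux with columns $(\rho V_j,\ \rho V_iV_j+\delta_{ij}p,\ V_j(\rho E+p))$, and let $F_n=F\cdot n$. Let $H=-\rho s$ with $s=\log(p/\rho^\gamma)-s_0$, let $v=v(u)=\partial H/\partial u$ be the entropy variables, $X_v=v(X_u)$, and let $u(v)$ be the inverse map; write $F(v)=F(u(v))$. Put $\tilde A_0=\partial u/\partial v$, $A_n=\partial F_n/\partial u$, $\tilde A_n=A_n\tilde A_0$. For $v_1,v_2\in X_v$ let $\tilde v(\theta;v_1,v_2)=v_1+\theta(v_2-v_1)$ (the set $X_v$ is convex) and $$\Sigma(v_1,v_2;n)=\int_0^1(1-\theta)\big(\tilde A_n(\tilde v(\theta;v_1,v_2))-\tilde A_n(\tilde v(\theta;v_2,v_1))\big)\,d\theta .$$ Let $\sigma(v_1,v_2;n)\in\mathbb R^{m\times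 m}$ be an entropy-stable stabilization matrix, that is, $$(v_2-v_1)^t\sigma(v_1,v_2;n)(v_2-v_1)\ \ge\ (v_2-v_1)^t\Sigma(v_1,v_2;n)(v_2-v_1)\qquad\text{for all }v_1,v_2\in X_v,\ |n|=1 .$$ Let $\Omega\subset\mathbb R^d$ be a bounded open period cell of a lattice, with periodic boundary conditions, and let $\mathcal T_h$ be a finite mesh that partitions $\Omega$ into disjoint non-singular elements $K=\psi_K(K_{ref})$, $\psi_K$ polynomial of degree at most $p$, $K_{ref}$ a convex polytope. The element boundaries consist of non-singular faces $F=\phi_F(F_{ref})$, $\phi_F$ polynomial of degree at most $p$; $\mathcal E_h$ is the set of faces. By periodicity every face is shared, up to translation by periods, by two elements. Let $k\ge0$. Let $\mathcal V_h^k$ be the space of $\mathbb R^m$-valued functions $w$ with $w\circ\psi_K$ a polynomial of degree at most $k$ for every $K$. Let $\mathcal M_h^k$ be the space of $\mathbb R^m$-valued functions $\mu$ on the faces with $\mu\circ\phi_F$ a polynomial of degree at most $k$ for every $F$ and with $\mu$ continuous on the union of a given subset $\mathcal E_h^E\subseteq\mathcal E_h$ of the faces (modulo periods). Let $(v_h(t),\hat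 v_h(t))\in\mathcal V_h^k\times\mathcal M_h^k$ solve the entropy-variable hybridized DG semi-discretization $$\sum_K\int_K\frac{\partial u(v_h)}{\partial t}\cdot w-\sum_K\int_K F(v_h):\nabla w+\sum_K\int_{\partial K}\hat f_h\cdot w=0,\qquad \sum_K\int_{\partial K}\hat f_h\cdot\mu=0$$ for all $w\in\mathcal V_h^k$, $\mu\in\mathcal M_h^k$ and $t\in(0,t_f)$, with $\sum_K\int_K(v_h(0)-v(u_0))\cdot w=0$ for all $w\in\mathcal V_h^k$, where $u_0:\Omega\to X_u$ and $$\hat f_h=\tfrac12\big(F(\hat v_h)+F(v_h)\big)\cdot n+\tfrac12\,\sigma(\hat v_h,v_h;n)(v_h-\hat v_h),$$ $n$ being the unit normal pointing outwards from the element. Assume that $v_h$ is continuous in time on $[0,t_f)$ and differentiable on $(0,t_f)$, that $\hat f_h$ is integrable over the faces, and that $v_h$ (on the closed elements) and $\hat v_h$ (on the closed faces) take values in $X_v$. Then $t\mapsto\int_{\mathcal T_h}H(u(v_h(t)))$ is non-increasing on $[0,t_f)$; it is differentiable on $(0,t_f)$ with $$\frac{d}{dt}\int_{\mathcal T_h}H(u(v_h(t)))\le0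 ;$$ and for all $t\in[0,t_f)$, with $v_{h,0}=v_h(0)$, $$\int_{\mathcal T_h}H(u^*(v_{h,0}))\ \le\ \int_{\mathcal T_h}H(u(v_h(t)))\ \le\ \int_{\mathcal T_h}H(u(v_{h,0})),\qquad u^*(v_h)=\frac1{|\Omega|}\int_{\mathcal T_h}u(v_h).$$ -/

import Mathlib

open Set Filter Topology MeasureTheory
open scoped Matrix

noncomputable section

namespace EulerHDG

/-! ### Gas dynamics -/

/-- Points of `ℝ^d`.  Only its topology, its Lebesgue measure and the dot product are used. -/
abbrev Pt (d : ℕ) := Fin d → ℝ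

/-- Index set of the `m = d + 2` components: density, the `d` momenta, energy. -/
abbrev Comp (d : ℕ) := Unit ⊕ Fin d ⊕ Unit

/-- Vectors of `ℝ^m`, `m = d + 2`. -/
abbrev State (d : ℕ) := Comp d → ℝ

/-- `ρ` -/
def density {d : ℕ} (u : State d) : ℝ := u (Sum.inl ())

/-- `ρ V_j` -/
def momentum {d : ℕ} (u : State d) (j : Fin d) : ℝ := u (Sum.inr (Sum.inl j))

/-- `ρ E` -/
def energy {d : ℕ} (u : State d) : ℝ := u (Sum.inr (Sum.inr ()))

/-- `V_j` -/
def velocity {d : ℕ} (u : State d) (j : Fin d) : ℝ := momentum u j / density u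

/-- `p = (γ - 1) (ρ E - ρ |V|² / 2)` -/
def pressure {d : ℕ} (γ : ℝ) (u : State d) : ℝ :=
  (γ - 1) * (energy u - density u * (∑ j, velocity u j ^ 2) / 2)

/-- The set `X_u` of physical states in conservation variables. -/
def physicalU (d : ℕ) (γ : ℝ) : Set (State d) := {u | 0 < density u ∧ 0 < pressure γ u}

/-- The inviscid flux `F(u)`, an `m × d` matrix. -/
def flux {d : ℕ} (γ : ℝ) (u : State d) : Comp d → Fin d → ℝ
  | Sum.inl _, j => density u * velocity u j
  | Sum.inr (Sum.inl i), j =>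
      density u * velocity u i * velocity u j + (if i = j then pressure γ u else 0)
  | Sum.inr (Sum.inr _), j => velocity u j * (energy u + pressure γ u)

/-- `F_n(u) = F(u) · n` -/
def normalFlux {d : ℕ} (γ : ℝ) (n : Pt d) (u : State d) : State d :=
  fun i => ∑ j, flux γ u i j * n j

/-- `s = log (p / ρ^γ) - s₀` -/
def physEntropy {d : ℕ} (γ s₀ : ℝ) (u : State d) : ℝ :=
  Real.log (pressure γ u / density u ^ γ) - s₀

/-- The generalized entropy `H = - ρ s`. -/
def genEntropy {d : ℕ} (γ s₀ : ℝ) (u : State d) : ℝ := -(density u * physEntropy γ s₀ u)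

/-- The entropy variables `v(u) = ∂H/∂u`. -/
def entropyVar {d : ℕ} (γ s₀ : ℝ) (u : State d) : State d
  | Sum.inl _ => (γ - 1) *
      (-physEntropy γ s₀ u / (γ - 1) + (γ + 1) / (γ - 1) - energy u / pressure γ u)
  | Sum.inr (Sum.inl j) => (γ - 1) * (density u * velocity u j / pressure γ u)
  | Sum.inr (Sum.inr _) => (γ - 1) * (-(density u / pressure γ u))

/-- The set `X_v = v(X_u)` of physical states in entropy variables. -/
def physicalV (d : ℕ) (γ s₀ : ℝ) : Set (State d) := entropyVar γ s₀ '' physicalU d γ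

/-- The inverse mapping `u(v)`, from `X_v` to `X_u`. -/
def consVar {d : ℕ} (γ s₀ : ℝ) : State d → State d :=
  Function.invFunOn (entropyVar γ s₀) (physicalU d γ)

/-! ### Stabilization matrices -/

/-- Jacobian matrix `∂f_i/∂x_k`. -/
def jacobian {d : ℕ} (f : State d → State d) (x : State d) : Matrix (Comp d) (Comp d) ℝ :=
  Matrix.of fun i k => fderiv ℝ f x (Pi.single k 1) i

/-- `Ã_n(v) = A_n Ã_0` with `A_n = ∂F_n/∂u` at `u(v)` and `Ã_0 = ∂u/∂v` at `v`. -/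
def tildeA {d : ℕ} (γ s₀ : ℝ) (n : Pt d) (v : State d) : Matrix (Comp d) (Comp d) ℝ :=
  jacobian (normalFlux γ n) (consVar γ s₀ v) * jacobian (consVar γ s₀) v

/-- The segment `θ ↦ v₁ + θ (v₂ - v₁)`; it stays in `X_v`, which is convex. -/
def statePath {d : ℕ} (v₁ v₂ : State d) (θ : ℝ) : State d := v₁ + θ • (v₂ - v₁)

/-- `Σ(v₁, v₂; n)` -/
def bigSigma {d : ℕ} (γ s₀ : ℝ) (v₁ v₂ : State d) (n : Pt d) : Matrix (Comp d) (Comp d) ℝ :=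
  Matrix.of fun i k => ∫ θ in (0 : ℝ)..1, (1 - θ) *
    (tildeA γ s₀ n (statePath v₁ v₂ θ) i k - tildeA γ s₀ n (statePath v₂ v₁ θ) i k)

/-- `σ` is an entropy-stable stabilization matrix: `σ` dominates `Σ` along `v₂ - v₁`. -/
def IsEntropyStable {d : ℕ} (γ s₀ : ℝ)
    (σ : State d → State d → Pt d → Matrix (Comp d) (Comp d) ℝ) : Prop :=
  ∀ v₁ ∈ physicalV d γ s₀, ∀ v₂ ∈ physicalV d γ s₀, ∀ n : Pt d, n ⬝ᵥ n = 1 →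
    (v₂ - v₁) ⬝ᵥ (bigSigma γ s₀ v₁ v₂ n *ᵥ (v₂ - v₁)) ≤
      (v₂ - v₁) ⬝ᵥ (σ v₁ v₂ n *ᵥ (v₂ - v₁))

/-! ### Periodic domains and meshes -/

/-- The polynomial map with components `P i`. -/
def polyMap {a b : ℕ} (P : Fin b → MvPolynomial (Fin a) ℝ) (x : Pt a) : Pt b :=
  fun i => MvPolynomial.eval x (P i)

/-- The Jacobian matrix of a polynomial map. -/
def polyJac {a b : ℕ} (P : Fin b → MvPolynomial (Fin a) ℝ) (x : Pt a) :
    Matrix (Fin b) (Fin a) ℝ :=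
  Matrix.of fun i j => MvPolynomial.eval x (MvPolynomial.pderiv j (P i))

/-- `S` is a nonempty bounded open convex polytope of `ℝ^a` (for `a = 0`: the point). -/
def IsOpenPolytope {a : ℕ} (S : Set (Pt a)) : Prop :=
  S.Nonempty ∧ Bornology.IsBounded S ∧
    ∃ (q : ℕ) (c : Fin q → Pt a) (r : Fin q → ℝ), S = {x | ∀ i, c i ⬝ᵥ x < r i}

/-- `Ω` is a bounded open period cell of the lattice `Λ`: the translates of `Ω` are disjoint
and those of its closure fill the space. -/
structure IsPeriodCell {d : ℕ} (Λ : Submodule ℤ (Pt d)) (Ω : Set (Pt d)) : Prop where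
  isOpen : IsOpen Ω
  isBounded : Bornology.IsBounded Ω
  disjoint : ∀ l ∈ Λ, l ≠ 0 → Disjoint Ω ((fun x => x + l) '' Ω)
  cover : ∀ x, ∃ l ∈ Λ, x + l ∈ closure Ω

/-- A finite mesh of non-singular curved elements of degree `p` on a domain `Ω` of dimension
`d = e + 1` that is periodic with period lattice `Λ`.  Opposite parts of `∂Ω` are identified, so
that every face is interior and is shared by two elements, up to translation by periods.
Hanging nodes are allowed. -/
structure Mesh (e p : ℕ) (Λ : Submodule ℤ (Pt (e + 1))) (Ω : Set (Pt (e + 1))) where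
  /-- the (open) reference element -/
  Kref : Set (Pt (e + 1))
  Kref_polytope : IsOpenPolytope Kref
  /-- the (relatively open) reference face -/
  Fref : Set (Pt e)
  Fref_polytope : IsOpenPolytope Fref
  numElem : ℕ
  /-- the parametric mapping of each element -/
  elemMap : Fin numElem → Fin (e + 1) → MvPolynomial (Fin (e + 1)) ℝ
  elemMap_degree : ∀ K i, (elemMap K i).totalDegree ≤ p
  elemMap_injOn : ∀ K, InjOn (polyMap (elemMap K)) (closure Kref)
  elemMap_nonsingular : ∀ K, ∀ x ∈ closure Kref, (polyJac (elemMap K) x).det ≠ 0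
  -- the open elements are disjoint and partition the domain
  elem_disjoint : ∀ K K', K ≠ K' →
    Disjoint (polyMap (elemMap K) '' Kref) (polyMap (elemMap K') '' Kref)
  elem_subset : ∀ K, polyMap (elemMap K) '' Kref ⊆ Ω
  elem_cover : Ω ⊆ ⋃ K, polyMap (elemMap K) '' closure Kref
  numFace : ℕ
  /-- the parametric mapping of each face -/
  faceMap : Fin numFace → Fin (e + 1) → MvPolynomial (Fin e) ℝ
  faceMap_degree : ∀ F i, (faceMap F i).totalDegree ≤ p
  faceMap_injOn : ∀ F, InjOn (polyMap (faceMap F)) (closure Fref)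
  faceMap_nonsingular : ∀ F, ∀ y ∈ closure Fref,
    ((polyJac (faceMap F) y)ᵀ * polyJac (faceMap F) y).det ≠ 0
  -- distinct faces, and distinct translates of a face, do not overlap
  face_disjoint : ∀ F F', ∀ l ∈ Λ, (F ≠ F' ∨ l ≠ 0) →
    Disjoint (polyMap (faceMap F) '' Fref) ((fun x => x + l) '' (polyMap (faceMap F') '' Fref))
  /-- the two elements adjacent to a face -/
  adj : Fin numFace → Bool → Fin numElem
  /-- the period by which the face is translated to lie on the boundary of that element -/
  shift : Fin numFace → Bool → Pt (e + 1)
  shift_mem : ∀ F s, shift F s ∈ Λ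
  sides_ne : ∀ F, (adj F true, shift F true) ≠ (adj F false, shift F false)
  face_subset : ∀ F s, ∀ y ∈ closure Fref,
    polyMap (faceMap F) y + shift F s ∈ frontier (polyMap (elemMap (adj F s)) '' Kref)
  -- the boundary of each element consists of faces
  boundary_cover : ∀ K, ∀ x ∈ frontier (polyMap (elemMap K) '' Kref),
    ∃ F s, adj F s = K ∧ ∃ y ∈ closure Fref, polyMap (faceMap F) y + shift F s = x
  /-- the unit normal along a face (as a function of the reference point), pointing outwards from
  the element on the given side; the three properties below determine it -/
  normal : Fin numFace → Bool → Pt e → Pt (e + 1)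
  normal_unit : ∀ F s, ∀ y ∈ Fref, normal F s y ⬝ᵥ normal F s y = 1
  normal_orthogonal : ∀ F s, ∀ y ∈ Fref, normal F s y ᵥ* polyJac (faceMap F) y = 0
  normal_outward : ∀ F s, ∀ y ∈ Fref, ∀ᶠ r in 𝓝[>] (0 : ℝ),
    polyMap (faceMap F) y + shift F s - r • normal F s y ∈ polyMap (elemMap (adj F s)) '' Kref

namespace Mesh

variable {e p : ℕ} {Λ : Submodule ℤ (Pt (e + 1))} {Ω : Set (Pt (e + 1))}

/-- The open element `K`. -/
def elem (T : Mesh e p Λ Ω) (K : Fin T.numElem) : Set (Pt (e + 1)) :=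
  polyMap (T.elemMap K) '' T.Kref

/-- The closed element. -/
def closedElem (T : Mesh e p Λ Ω) (K : Fin T.numElem) : Set (Pt (e + 1)) :=
  polyMap (T.elemMap K) '' closure T.Kref

/-- The closed face `F`. -/
def closedFace (T : Mesh e p Λ Ω) (F : Fin T.numFace) : Set (Pt (e + 1)) :=
  polyMap (T.faceMap F) '' closure T.Fref

/-- Integral over the mesh, `∑_K ∫_K g`. -/
def volInt (T : Mesh e p Λ Ω) (g : Fin T.numElem → Pt (e + 1) → ℝ) : ℝ :=
  ∑ K, ∫ x in T.elem K, g K x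

/-- Density of the surface measure of a face with respect to `dy` on the reference face,
`√(det (Dφᵀ Dφ))`. -/
def surfElt (T : Mesh e p Λ Ω) (F : Fin T.numFace) (y : Pt e) : ℝ :=
  √((polyJac (T.faceMap F) y)ᵀ * polyJac (T.faceMap F) y).det

/-- Surface integral over the boundaries of all elements, `∑_K ∫_{∂K} g`: every face occurs
twice, once as a part of the boundary of each of the two adjacent elements.  The integrand is given
as a function of the face, of its side, and of the point of the reference face. -/
def bdryInt (T : Mesh e p Λ Ω) (g : Fin T.numFace → Bool → Pt e → ℝ) : ℝ :=
  ∑ F, ∑ s, ∫ y in T.Fref, g F s y * T.surfElt F y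

/-- The space `V_h^k` of discontinuous piecewise polynomials.  A member is a family of functions
on the closed elements, so that it has a trace on `∂K` from each element `K`. -/
def VSpace (T : Mesh e p Λ Ω) (k : ℕ) : Set (Fin T.numElem → Pt (e + 1) → State (e + 1)) :=
  {w | ∀ K i, ∃ P : MvPolynomial (Fin (e + 1)) ℝ, P.totalDegree ≤ k ∧
    ∀ x ∈ closure T.Kref, w K (polyMap (T.elemMap K) x) i = MvPolynomial.eval x P}

/-- The space `M_h^k` of piecewise polynomials on the periodic skeleton, continuous on the union of
the faces in `EE` and possibly discontinuous across the borders of the other faces.  A member is a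
family of functions on the closed faces. -/
def MSpace (T : Mesh e p Λ Ω) (k : ℕ) (EE : Set (Fin T.numFace)) :
    Set (Fin T.numFace → Pt (e + 1) → State (e + 1)) :=
  {μ | (∀ F i, ∃ P : MvPolynomial (Fin e) ℝ, P.totalDegree ≤ k ∧
      ∀ y ∈ closure T.Fref, μ F (polyMap (T.faceMap F) y) i = MvPolynomial.eval y P) ∧
    ∀ F ∈ EE, ∀ F' ∈ EE, ∀ l ∈ Λ, ∀ x ∈ T.closedFace F, x + l ∈ T.closedFace F' →
      μ F x = μ F' (x + l)}

/-- The inviscid numerical flux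
`f̂ = ½ (F(v̂) + F(v)) · n + ½ σ(v̂, v; n) (v - v̂)`. -/
def numFlux (T : Mesh e p Λ Ω) (γ s₀ : ℝ)
    (σ : State (e + 1) → State (e + 1) → Pt (e + 1) → Matrix (Comp (e + 1)) (Comp (e + 1)) ℝ)
    (v : Fin T.numElem → Pt (e + 1) → State (e + 1))
    (vhat : Fin T.numFace → Pt (e + 1) → State (e + 1))
    (F : Fin T.numFace) (s : Bool) (y : Pt e) : State (e + 1) :=
  let n := T.normal F s y
  let a := vhat F (polyMap (T.faceMap F) y)
  let b := v (T.adj F s) (polyMap (T.faceMap F) y + T.shift F s)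
  (1 / 2 : ℝ) • (normalFlux γ n (consVar γ s₀ a) + normalFlux γ n (consVar γ s₀ b)) +
    (1 / 2 : ℝ) • (σ a b n *ᵥ (b - a))

/-- `(v, v̂)` is a solution on `[0, tf)`, with initial condition `u₀`, of the entropy-variable
hybridized DG semi-discretization of the Euler equations with periodic boundary conditions. -/
structure IsSolution (T : Mesh e p Λ Ω) (k : ℕ) (EE : Set (Fin T.numFace)) (γ s₀ tf : ℝ)
    (σ : State (e + 1) → State (e + 1) → Pt (e + 1) → Matrix (Comp (e + 1)) (Comp (e + 1)) ℝ)
    (u₀ : Pt (e + 1) → State (e + 1))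
    (v : ℝ → Fin T.numElem → Pt (e + 1) → State (e + 1))
    (vhat : ℝ → Fin T.numFace → Pt (e + 1) → State (e + 1)) : Prop where
  mem_V : ∀ t ∈ Ico 0 tf, v t ∈ T.VSpace k
  mem_M : ∀ t ∈ Ioo 0 tf, vhat t ∈ T.MSpace k EE
  continuousOn : ∀ K, ∀ x ∈ T.closedElem K, ContinuousOn (fun t => v t K x) (Ico 0 tf)
  differentiableAt : ∀ t ∈ Ioo 0 tf, ∀ K, ∀ x ∈ T.closedElem K,
    DifferentiableAt ℝ (fun τ => v τ K x) t
  -- the integrals of the numerical flux exist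
  flux_integrable : ∀ t ∈ Ioo 0 tf, ∀ F s i,
    IntegrableOn (fun y => T.numFlux γ s₀ σ (v t) (vhat t) F s y i * T.surfElt F y) T.Fref
  -- the discrete conservation law
  eq_elem : ∀ t ∈ Ioo 0 tf, ∀ w ∈ T.VSpace k,
    T.volInt (fun K x => deriv (fun τ => consVar γ s₀ (v τ K x)) t ⬝ᵥ w K x) -
      T.volInt (fun K x => ∑ i, ∑ j, flux γ (consVar γ s₀ (v t K x)) i j *
        fderiv ℝ (fun z => w K z i) x (Pi.single j 1)) +
      T.bdryInt (fun F s y => T.numFlux γ s₀ σ (v t) (vhat t) F s y ⬝ᵥ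
        w (T.adj F s) (polyMap (T.faceMap F) y + T.shift F s)) = 0
  -- conservation of the flux across faces
  eq_face : ∀ t ∈ Ioo 0 tf, ∀ μ ∈ T.MSpace k EE,
    T.bdryInt (fun F s y => T.numFlux γ s₀ σ (v t) (vhat t) F s y ⬝ᵥ
      μ F (polyMap (T.faceMap F) y)) = 0
  -- the initial condition
  eq_init : ∀ w ∈ T.VSpace k,
    T.volInt (fun K x => (v 0 K x - entropyVar γ s₀ (u₀ x)) ⬝ᵥ w K x) = 0

/-- The numerical solution is physical (positive density and pressure) pointwise. -/
def IsPhysical (T : Mesh e p Λ Ω) (γ s₀ tf : ℝ)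
    (v : ℝ → Fin T.numElem → Pt (e + 1) → State (e + 1))
    (vhat : ℝ → Fin T.numFace → Pt (e + 1) → State (e + 1)) : Prop :=
  (∀ t ∈ Ico 0 tf, ∀ K, ∀ x ∈ T.closedElem K, v t K x ∈ physicalV (e + 1) γ s₀) ∧
  (∀ t ∈ Ioo 0 tf, ∀ F, ∀ x ∈ T.closedFace F, vhat t F x ∈ physicalV (e + 1) γ s₀)

/-- Total generalized entropy `∫_{T_h} H(u(v))`. -/
def totalEntropy (T : Mesh e p Λ Ω) (γ s₀ : ℝ)
    (v : Fin T.numElem → Pt (e + 1) → State (e + 1)) : ℝ :=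
  T.volInt (fun K x => genEntropy γ s₀ (consVar γ s₀ (v K x)))

/-- The minimum total entropy state `u*(v) = (1/|Ω|) ∫_{T_h} u(v)`. -/
def meanState (T : Mesh e p Λ Ω) (γ s₀ : ℝ)
    (v : Fin T.numElem → Pt (e + 1) → State (e + 1)) : State (e + 1) :=
  fun i => (1 / volume.real Ω) * T.volInt (fun K x => consVar γ s₀ (v K x) i)

end Mesh

end EulerHDG

end

open EulerHDG

/-! ### Entropy variables -/

namespace EulerHDG

/-! The entropy variables are the gradient of `H`, so testing the element equation with `w = v_h`
makes its first term the time derivative of the total entropy. The volume term is an exact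
divergence: the `j`-th column of the flux, as a function of `v`, is the gradient of `ψ_j = (γ - 1) ρ
V_j` (`hasDerivAt_fluxPotential`). The divergence theorem turns it into face integrals of `ψ_n(v_h)`
(`volInt_flux`). Now subtract the face equation tested with `μ = v̂_h`, and insert the face
integrals of `ψ_n(v̂_h)`, which cancel because the two normals of a face are opposite
(`normal_true_eq_neg`).

What remains on each side of each face is `ψ_n(v_h) - ψ_n(v̂_h) - f̂ · Δ` with `Δ = v_h - v̂_h`.
Integration by parts in `θ` shows that `Δ · Σ Δ` is twice the jump of `ψ_n` minus the sum of the two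
normal fluxes paired with `Δ` (`bigSigma_quadratic`). The remainder is therefore `½ Δ · (Σ - σ) Δ`,
which entropy stability makes nonpositive.

For the lower bound, constant test functions show that `∫ u` is conserved, so the mean state at time
`t` equals the initial one. Jensen's inequality at time `t` then gives the claim; its convexity
input is the tangent plane inequality `genEntropy_tangent`.

Two analytic facts support this. First, differentiation under the integral: on each element `v_h` is
determined by finitely many nodal values, so pointwise regularity in time suffices
(`integral_elem_time`). Second, the divergence theorem on a curved element whose normal is given
only pointwise (`integral_fderiv_elem`). It is proved locally in collars of single faces by Fubini
and the fundamental theorem of calculus, and glued by a partition of unity away from the face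
borders. These borders are then removed with cutoffs whose directional derivative is small in `L^1`,
because their `e`-dimensional measure is zero. -/

/-- The density as an explicit function of the entropy variables. -/
noncomputable def densityOfEntropyVar {d : ℕ} (γ s₀ : ℝ) (v : State d) : ℝ :=
  Real.exp ((Real.log (γ - 1) - Real.log (-energy v) + density v +
    (∑ j, momentum v j ^ 2) / (2 * -energy v) - γ - s₀) / (γ - 1))

/-- The conservation variables as explicit functions of the entropy variables. -/
noncomputable def consOfEntropyVar {d : ℕ} (γ s₀ : ℝ) (v : State d) : State d
  | Sum.inl _ => densityOfEntropyVar γ s₀ v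
  | Sum.inr (Sum.inl j) => densityOfEntropyVar γ s₀ v * (momentum v j / -energy v)
  | Sum.inr (Sum.inr _) => densityOfEntropyVar γ s₀ v / -energy v +
      densityOfEntropyVar γ s₀ v * (∑ j, (momentum v j / -energy v) ^ 2) / 2

variable {d : ℕ} {γ s₀ : ℝ}

lemma densityOfEntropyVar_pos (v : State d) : 0 < densityOfEntropyVar γ s₀ v := Real.exp_pos _

lemma density_consOfEntropyVar (v : State d) :
    density (consOfEntropyVar γ s₀ v) = densityOfEntropyVar γ s₀ v := rfl

lemma momentum_consOfEntropyVar (v : State d) (j : Fin d) :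
    momentum (consOfEntropyVar γ s₀ v) j =
      densityOfEntropyVar γ s₀ v * (momentum v j / -energy v) := rfl

lemma energy_consOfEntropyVar (v : State d) :
    energy (consOfEntropyVar γ s₀ v) = densityOfEntropyVar γ s₀ v / -energy v +
      densityOfEntropyVar γ s₀ v * (∑ j, (momentum v j / -energy v) ^ 2) / 2 := rfl

lemma velocity_consOfEntropyVar (v : State d) (j : Fin d) :
    velocity (consOfEntropyVar γ s₀ v) j = momentum v j / -energy v := by
  rw [velocity, momentum_consOfEntropyVar, density_consOfEntropyVar,
    mul_div_cancel_left₀ _ (densityOfEntropyVar_pos v).ne']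

lemma pressure_consOfEntropyVar (v : State d) :
    pressure γ (consOfEntropyVar γ s₀ v) =
      (γ - 1) * (densityOfEntropyVar γ s₀ v / -energy v) := by
  simp only [pressure, velocity_consOfEntropyVar, energy_consOfEntropyVar,
    density_consOfEntropyVar]
  ring

lemma consOfEntropyVar_mem (hγ : 1 < γ) {v : State d} (hv : energy v < 0) :
    consOfEntropyVar γ s₀ v ∈ physicalU d γ := by
  refine ⟨densityOfEntropyVar_pos v, ?_⟩
  rw [pressure_consOfEntropyVar]
  have := densityOfEntropyVar_pos (γ := γ) (s₀ := s₀) v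
  have : 0 < γ - 1 := by linarith
  have : 0 < -energy v := by linarith
  positivity

lemma physEntropy_eq {u : State d} (hu : u ∈ physicalU d γ) :
    physEntropy γ s₀ u = Real.log (pressure γ u) - γ * Real.log (density u) - s₀ := by
  rw [physEntropy, Real.log_div hu.2.ne' (Real.rpow_pos_of_pos hu.1 _).ne',
    Real.log_rpow hu.1]

lemma energy_eq {u : State d} (hγ : 1 < γ) :
    energy u = pressure γ u / (γ - 1) + density u * (∑ j, velocity u j ^ 2) / 2 := by
  have : γ - 1 ≠ 0 := by linarith
  rw [pressure]; field_simp; ring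

lemma entropyVar_density (hγ : 1 < γ) {u : State d} (hu : u ∈ physicalU d γ) :
    density (entropyVar γ s₀ u) = -physEntropy γ s₀ u + γ -
      (γ - 1) * density u / pressure γ u * (∑ j, velocity u j ^ 2) / 2 := by
  change (γ - 1) * _ = _
  have h1 : γ - 1 ≠ 0 := by linarith
  have h2 := hu.2.ne'
  rw [energy_eq (u := u) hγ]
  field_simp
  ring

lemma entropyVar_momentum (u : State d) (j : Fin d) :
    momentum (entropyVar γ s₀ u) j = (γ - 1) * (density u * velocity u j / pressure γ u) := rfl

lemma entropyVar_energy (u : State d) :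
    energy (entropyVar γ s₀ u) = (γ - 1) * (-(density u / pressure γ u)) := rfl

lemma entropyVar_energy_neg (hγ : 1 < γ) {u : State d} (hu : u ∈ physicalU d γ) :
    energy (entropyVar γ s₀ u) < 0 := by
  rw [entropyVar_energy]
  have : 0 < γ - 1 := by linarith
  have := div_pos hu.1 hu.2
  nlinarith [mul_pos ‹0 < γ - 1› this]

/-- With `b = -energy v = (γ - 1) ρ / p`, the first entropy variable is `-s + γ - b |V|² / 2`.
Eliminating `p` from `s` leaves an equation linear in `log ρ`, and this is its solution. -/
lemma log_densityOfEntropyVar (hγ : 1 < γ) (v : State d) :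
    (γ - 1) * Real.log (densityOfEntropyVar γ s₀ v) =
      Real.log (γ - 1) - Real.log (-energy v) + density v +
    (∑ j, momentum v j ^ 2) / (2 * -energy v) - γ - s₀ := by
  have h1 : γ - 1 ≠ 0 := by linarith
  rw [densityOfEntropyVar, Real.log_exp]
  field_simp

lemma state_ext {u w : State d} (h1 : density u = density w)
    (h2 : ∀ j, momentum u j = momentum w j) (h3 : energy u = energy w) : u = w := by
  funext i
  rcases i with ⟨⟩ | j | ⟨⟩
  exacts [h1, h2 j, h3]

lemma dotProduct_state (u w : State d) : u ⬝ᵥ w =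
    density u * density w + (∑ j, momentum u j * momentum w j + energy u * energy w) := by
  simp only [dotProduct, Fintype.sum_sum_type, Finset.univ_unique, Finset.sum_singleton]
  rfl

lemma entropyVar_consOfEntropyVar (hγ : 1 < γ) {v : State d} (hv : energy v < 0) :
    entropyVar γ s₀ (consOfEntropyVar γ s₀ v) = v := by
  have hm := consOfEntropyVar_mem (s₀ := s₀) hγ hv
  have hρ := densityOfEntropyVar_pos (γ := γ) (s₀ := s₀) v
  have h1 : 0 < γ - 1 := by linarith
  have hb : 0 < -energy v := by linarith
  have hb' : energy v ≠ 0 := hv.ne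
  refine state_ext ?_ (fun j => ?_) ?_
  · rw [entropyVar_density hγ hm, physEntropy_eq hm]
    simp only [pressure_consOfEntropyVar, density_consOfEntropyVar, velocity_consOfEntropyVar]
    rw [Real.log_mul h1.ne' (div_pos hρ hb).ne', Real.log_div hρ.ne' hb.ne']
    have := log_densityOfEntropyVar (s₀ := s₀) hγ v
    have h2 : (γ - 1) * densityOfEntropyVar γ s₀ v /
        ((γ - 1) * (densityOfEntropyVar γ s₀ v / -energy v)) *
        (∑ j, (momentum v j / -energy v) ^ 2) / 2 = (∑ j, momentum v j ^ 2) / (2 * -energy v) := by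
      simp only [div_pow, ← Finset.sum_div]
      field_simp
    rw [h2]
    linarith
  · rw [entropyVar_momentum, velocity_consOfEntropyVar, pressure_consOfEntropyVar,
      density_consOfEntropyVar]
    field_simp
  · rw [entropyVar_energy, pressure_consOfEntropyVar,
      density_consOfEntropyVar]
    field_simp

lemma consOfEntropyVar_entropyVar (hγ : 1 < γ) {u : State d} (hu : u ∈ physicalU d γ) :
    consOfEntropyVar γ s₀ (entropyVar γ s₀ u) = u := by
  have h1 : 0 < γ - 1 := by linarith
  obtain ⟨hρ, hp⟩ := hu
  have hv := entropyVar_energy_neg (s₀ := s₀) hγ ⟨hρ, hp⟩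
  have hvel : ∀ j, momentum (entropyVar γ s₀ u) j / -energy (entropyVar γ s₀ u) =
      velocity u j := by
    intro j
    rw [entropyVar_momentum, entropyVar_energy]
    field_simp
  have hd : densityOfEntropyVar γ s₀ (entropyVar γ s₀ u) = density u := by
    -- Both densities are positive, so it suffices to compare logarithms, for which the first
    -- component gives a linear equation.
    refine Real.log_injOn_pos (densityOfEntropyVar_pos _) hρ ?_
    have h2 := log_densityOfEntropyVar (s₀ := s₀) hγ (entropyVar γ s₀ u)
    have h3 : (∑ j, momentum (entropyVar γ s₀ u) j ^ 2) / (2 * -energy (entropyVar γ s₀ u)) =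
        (γ - 1) * density u / pressure γ u * (∑ j, velocity u j ^ 2) / 2 := by
      have : ∀ j, momentum (entropyVar γ s₀ u) j =
          velocity u j * -energy (entropyVar γ s₀ u) := by
        intro j
        rw [← hvel j, div_mul_cancel₀ _ (by linarith)]
      simp only [this, mul_pow, ← Finset.sum_mul, entropyVar_energy]
      field_simp
    rw [h3, entropyVar_density hγ ⟨hρ, hp⟩, physEntropy_eq ⟨hρ, hp⟩] at h2
    have h4 : Real.log (-energy (entropyVar γ s₀ u)) =
        Real.log (γ - 1) + Real.log (density u) - Real.log (pressure γ u) := by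
      rw [entropyVar_energy, mul_neg, neg_neg, Real.log_mul h1.ne' (div_pos hρ hp).ne',
        Real.log_div hρ.ne' hp.ne']
      ring
    rw [h4] at h2
    apply mul_left_cancel₀ h1.ne'
    linarith
  refine state_ext ?_ (fun j => ?_) ?_
  · rw [density_consOfEntropyVar, hd]
  · rw [momentum_consOfEntropyVar, hd, hvel, velocity]
    field_simp
  · rw [energy_consOfEntropyVar, hd]
    simp only [hvel]
    rw [energy_eq (u := u) hγ, entropyVar_energy]
    field_simp

/-- The explicit inverse only needs `-energy v > 0`. That `X_v` is an open half-space gives its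
openness and convexity. -/
lemma physicalV_eq (hγ : 1 < γ) : physicalV d γ s₀ = {v | energy v < 0} := by
  ext v
  constructor
  · rintro ⟨u, hu, rfl⟩
    exact entropyVar_energy_neg hγ hu
  · intro hv
    exact ⟨_, consOfEntropyVar_mem hγ hv, entropyVar_consOfEntropyVar hγ hv⟩

lemma consVar_mem {v : State d} (hv : v ∈ physicalV d γ s₀) :
    consVar γ s₀ v ∈ physicalU d γ := Function.invFunOn_mem hv

lemma entropyVar_consVar {v : State d} (hv : v ∈ physicalV d γ s₀) :
    entropyVar γ s₀ (consVar γ s₀ v) = v := Function.invFunOn_eq hv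

/-- Replaces the inverse obtained by choice with a formula; smoothness of `u(v)` is read off from
it. -/
lemma consVar_eq (hγ : 1 < γ) {v : State d} (hv : v ∈ physicalV d γ s₀) :
    consVar γ s₀ v = consOfEntropyVar γ s₀ v := by
  conv_rhs => rw [← entropyVar_consVar hv]
  rw [consOfEntropyVar_entropyVar hγ (consVar_mem hv)]

lemma isOpen_physicalV (hγ : 1 < γ) : IsOpen (physicalV d γ s₀) := by
  rw [physicalV_eq hγ]
  exact isOpen_lt (continuous_apply _) continuous_const

lemma convex_physicalV (hγ : 1 < γ) : Convex ℝ (physicalV d γ s₀) := by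
  rw [physicalV_eq hγ]
  exact convex_halfSpace_lt (f := fun v : State d => energy v)
    ⟨fun _ _ => rfl, fun _ _ => rfl⟩ 0

lemma contDiffOn_densityOfEntropyVar :
    ContDiffOn ℝ ⊤ (densityOfEntropyVar (d := d) γ s₀) {v | energy v < 0} := by
  have hE : ContDiff ℝ ⊤ (fun v : State d => energy v) := contDiff_apply ℝ ℝ _
  have hD : ContDiff ℝ ⊤ (fun v : State d => density v) := contDiff_apply ℝ ℝ _
  have hM : ∀ j, ContDiff ℝ ⊤ (fun v : State d => momentum v j) := fun j => contDiff_apply ℝ ℝ _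
  unfold densityOfEntropyVar
  refine ContDiffOn.exp (ContDiffOn.div_const ?_ _)
  refine ContDiffOn.sub (ContDiffOn.sub (ContDiffOn.add (ContDiffOn.add (ContDiffOn.sub
    contDiffOn_const (ContDiffOn.log hE.neg.contDiffOn ?_)) hD.contDiffOn)
      (ContDiffOn.div (ContDiff.sum fun j _ => (hM j).pow 2).contDiffOn
        (contDiff_const.mul hE.neg).contDiffOn ?_)) contDiffOn_const) contDiffOn_const
  · intro v hv
    have : energy v < 0 := hv
    linarith
  · intro v hv
    have : energy v < 0 := hv
    linarith

lemma contDiffOn_consOfEntropyVar :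
    ContDiffOn ℝ ⊤ (consOfEntropyVar (d := d) γ s₀) {v | energy v < 0} := by
  have hE : ContDiff ℝ ⊤ (fun v : State d => energy v) := contDiff_apply ℝ ℝ _
  have hM : ∀ j, ContDiff ℝ ⊤ (fun v : State d => momentum v j) := fun j => contDiff_apply ℝ ℝ _
  have hne : ∀ v ∈ {v : State d | energy v < 0}, -energy v ≠ 0 := by
    intro v hv
    have : energy v < 0 := hv
    linarith
  have hρ := contDiffOn_densityOfEntropyVar (d := d) (γ := γ) (s₀ := s₀)
  have hV : ∀ j, ContDiffOn ℝ ⊤ (fun v : State d => momentum v j / -energy v)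
      {v | energy v < 0} := fun j => (hM j).contDiffOn.div hE.neg.contDiffOn hne
  rw [contDiffOn_pi]
  rintro (⟨⟩ | j | ⟨⟩)
  · exact hρ
  · exact hρ.mul (hV j)
  · exact (hρ.div hE.neg.contDiffOn hne).add
      ((hρ.mul (ContDiffOn.sum fun j _ => (hV j).pow 2)).div_const 2)

lemma contDiffOn_consVar (hγ : 1 < γ) :
    ContDiffOn ℝ ⊤ (consVar (d := d) γ s₀) (physicalV d γ s₀) := by
  have := contDiffOn_consOfEntropyVar (d := d) (γ := γ) (s₀ := s₀)
  rw [← physicalV_eq (s₀ := s₀) hγ] at this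
  exact this.congr fun v hv => consVar_eq hγ hv

lemma contDiffOn_flux (i : Comp d) (j : Fin d) :
    ContDiffOn ℝ ⊤ (fun u : State d => flux γ u i j) {u | 0 < density u} := by
  have hE : ContDiff ℝ ⊤ (fun v : State d => energy v) := contDiff_apply ℝ ℝ _
  have hD : ContDiff ℝ ⊤ (fun v : State d => density v) := contDiff_apply ℝ ℝ _
  have hM : ∀ j, ContDiff ℝ ⊤ (fun v : State d => momentum v j) := fun j => contDiff_apply ℝ ℝ _
  have hV : ∀ j, ContDiffOn ℝ ⊤ (fun v : State d => velocity v j)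
      {u | 0 < density u} :=
    fun j => (hM j).contDiffOn.div hD.contDiffOn fun v hv => ne_of_gt hv
  have hP : ContDiffOn ℝ ⊤ (fun v : State d => pressure γ v) {u | 0 < density u} :=
    contDiffOn_const.mul (hE.contDiffOn.sub
      ((hD.contDiffOn.mul (ContDiffOn.sum fun j _ => (hV j).pow 2)).div_const 2))
  rcases i with ⟨⟩ | i | ⟨⟩
  · exact hD.contDiffOn.mul (hV j)
  · refine ((hD.contDiffOn.mul (hV i)).mul (hV j)).add ?_
    by_cases h : i = j
    · simpa only [h, if_true] using hP
    · simpa only [h, if_false] using contDiffOn_const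
  · exact (hV j).mul (hE.contDiffOn.add hP)

lemma isOpen_density_pos : IsOpen {u : State d | 0 < density u} :=
  isOpen_lt continuous_const (continuous_apply _)

lemma contDiffOn_normalFlux (n : Pt d) :
    ContDiffOn ℝ ⊤ (normalFlux γ n) {u : State d | 0 < density u} := by
  rw [contDiffOn_pi]
  intro i
  exact ContDiffOn.sum fun j _ => (contDiffOn_flux i j).mul contDiffOn_const

/-- The gradient of the Legendre transform `(γ - 1) ρ` of the entropy is `u(v)`. -/
lemma hasDerivAt_potential (hγ : 1 < γ) {c : ℝ → State d} {c' : State d} {t : ℝ}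
    (hc : HasDerivAt c c' t) (ht : c t ∈ physicalV d γ s₀) :
    HasDerivAt (fun τ => (γ - 1) * densityOfEntropyVar γ s₀ (c τ)) (consVar γ s₀ (c t) ⬝ᵥ c') t := by
  have hneg : energy (c t) < 0 := by rw [physicalV_eq hγ] at ht; exact ht
  have h1 : γ - 1 ≠ 0 := by linarith
  have hi := fun i => (hasDerivAt_pi.1 hc i)
  have hE : HasDerivAt (fun τ => energy (c τ)) (energy c') t := hi _
  have hD : HasDerivAt (fun τ => density (c τ)) (density c') t := hi _
  have hM : ∀ j, HasDerivAt (fun τ => momentum (c τ) j) (momentum c' j) t := fun j => hi _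
  have hS : HasDerivAt (fun τ => ∑ j, momentum (c τ) j ^ 2)
      (∑ j, 2 * momentum (c t) j * momentum c' j) t := by
    refine HasDerivAt.fun_sum fun j _ => ?_
    simpa using (hM j).fun_pow 2
  -- Differentiates the exponent that defines the density. Its division by `γ - 1` cancels the outer
  -- factor of the potential.
  have key := ((((((hasDerivAt_const t (Real.log (γ - 1))).sub
    (hE.neg.log (by simp only [Pi.neg_apply]; linarith))).add hD).add
    (hS.div (hE.neg.const_mul 2) (by simp only [Pi.neg_apply]; linarith))).sub_const γ).sub_const
      s₀).div_const (γ - 1)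
  have key2 := (key.exp.const_mul (γ - 1))
  rw [consVar_eq hγ ht]
  refine key2.congr_deriv (Eq.symm ?_)
  rw [dotProduct_state]
  have e : ∀ (x : State d), Real.exp (((((Real.log (γ - 1) - Real.log (-energy x) + density x +
    (∑ j, momentum x j ^ 2) / (2 * -energy x)) - γ - s₀))) / (γ - 1)) =
      densityOfEntropyVar γ s₀ x := fun x => rfl
  simp only [Pi.neg_apply, Pi.add_apply, Pi.sub_apply, Pi.div_apply]
  rw [e]
  have hb : energy (c t) ≠ 0 := hneg.ne
  change densityOfEntropyVar γ s₀ (c t) * density c' +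
    (∑ j, densityOfEntropyVar γ s₀ (c t) * (momentum (c t) j / -energy (c t)) * momentum c' j +
    (densityOfEntropyVar γ s₀ (c t) / -energy (c t) + densityOfEntropyVar γ s₀ (c t) *
      (∑ j, (momentum (c t) j / -energy (c t)) ^ 2) / 2) * energy c') = _
  have s1 : ∑ j, densityOfEntropyVar γ s₀ (c t) * (momentum (c t) j / -energy (c t)) *
      momentum c' j = densityOfEntropyVar γ s₀ (c t) *
        (∑ j, momentum (c t) j * momentum c' j) / -energy (c t) := by
    rw [Finset.mul_sum, Finset.sum_div]
    exact Finset.sum_congr rfl fun j _ => by ring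
  have s2 : ∑ j, 2 * momentum (c t) j * momentum c' j =
      2 * ∑ j, momentum (c t) j * momentum c' j := by
    rw [Finset.mul_sum]
    exact Finset.sum_congr rfl fun j _ => by ring
  rw [s1, s2]
  simp only [div_pow, ← Finset.sum_div]
  field_simp
  ring

end EulerHDG

/-! ### Entropy flux potentials and the quadratic form of `Σ` -/

namespace EulerHDG

variable {d : ℕ} {γ s₀ : ℝ}

/-- The entropy flux potential `ψ_n(v) = (γ - 1) ρ V · n`. -/
noncomputable def normalPotential (γ s₀ : ℝ) (n : Pt d) (v : State d) : ℝ :=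
  ∑ j, (γ - 1) * momentum (consVar γ s₀ v) j * n j

lemma eventually_mem_physicalV (hγ : 1 < γ) {c : ℝ → State d} {t : ℝ}
    (hc : ContinuousAt c t) (ht : c t ∈ physicalV d γ s₀) :
    ∀ᶠ τ in 𝓝 t, c τ ∈ physicalV d γ s₀ :=
  hc.eventually ((isOpen_physicalV hγ).mem_nhds ht)

/-- The gradient of the `j`-th entropy flux potential is the `j`-th column of the flux. -/
lemma hasDerivAt_fluxPotential (hγ : 1 < γ) {c : ℝ → State d} {c' : State d} {t : ℝ}
    (hc : HasDerivAt c c' t) (ht : c t ∈ physicalV d γ s₀) (j : Fin d) :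
    HasDerivAt (fun τ => (γ - 1) * momentum (consVar γ s₀ (c τ)) j)
      (∑ i, flux γ (consVar γ s₀ (c t)) i j * c' i) t := by
  have hneg : energy (c t) < 0 := by rw [physicalV_eq hγ] at ht; exact ht
  have hb : energy (c t) ≠ 0 := hneg.ne
  have hE : HasDerivAt (fun τ => energy (c τ)) (energy c') t := hasDerivAt_pi.1 hc _
  have hM : HasDerivAt (fun τ => momentum (c τ) j) (momentum c' j) t := hasDerivAt_pi.1 hc _
  -- The flux potential is the product of `(γ - 1) ρ`, whose gradient is `u`, and `V_j = momentum v
  -- j / -energy v`.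
  have key := (hasDerivAt_potential hγ hc ht).mul
    (hM.div hE.neg (by simp only [Pi.neg_apply]; linarith))
  have key2 := key.congr_of_eventuallyEq
      (f₁ := fun τ => (γ - 1) * momentum (consVar γ s₀ (c τ)) j) <| by
    filter_upwards [eventually_mem_physicalV hγ hc.continuousAt ht] with τ hτ
    rw [consVar_eq hγ hτ, momentum_consOfEntropyVar]
    simp only [Pi.mul_apply, Pi.div_apply, Pi.neg_apply]
    ring
  refine key2.congr_deriv ?_
  -- The flux column is `V_j u`, plus `p` in the `j`-th momentum slot and `p V_j` in the energy
  -- slot. The pressure terms are the derivative of `V_j`, since `(γ - 1) ρ / -energy v = p`.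
  have e1 : ∑ i, flux γ (consVar γ s₀ (c t)) i j * c' i =
      velocity (consVar γ s₀ (c t)) j * (consVar γ s₀ (c t) ⬝ᵥ c') +
        pressure γ (consVar γ s₀ (c t)) * momentum c' j +
        velocity (consVar γ s₀ (c t)) j * pressure γ (consVar γ s₀ (c t)) * energy c' := by
    have hρ := (consVar_mem ht).1
    have hm : ∀ i, momentum (consVar γ s₀ (c t)) i =
        density (consVar γ s₀ (c t)) * velocity (consVar γ s₀ (c t)) i := by
      intro i; rw [velocity, mul_div_cancel₀ _ hρ.ne']
    rw [dotProduct_state]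
    simp only [Fintype.sum_sum_type, Finset.univ_unique, Finset.sum_singleton, flux, hm]
    simp only [add_mul, ite_mul, zero_mul, Finset.sum_add_distrib, Finset.sum_ite_eq',
      Finset.mem_univ, if_true]
    have e2 : ∑ i, density (consVar γ s₀ (c t)) * velocity (consVar γ s₀ (c t)) i *
        velocity (consVar γ s₀ (c t)) j * c' (Sum.inr (Sum.inl i)) =
        velocity (consVar γ s₀ (c t)) j * ∑ i, density (consVar γ s₀ (c t)) *
          velocity (consVar γ s₀ (c t)) i * momentum c' i := by
      rw [Finset.mul_sum]
      exact Finset.sum_congr rfl fun i _ => by rw [momentum]; ring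
    rw [e2]
    simp only [density, momentum, energy, PUnit.default_eq_unit]
    ring
  rw [e1]
  simp only [Pi.neg_apply]
  rw [consVar_eq hγ ht, velocity_consOfEntropyVar, pressure_consOfEntropyVar]
  simp only [Pi.div_apply, Pi.neg_apply]
  field_simp
  ring

lemma hasDerivAt_normalPotential (hγ : 1 < γ) {c : ℝ → State d} {c' : State d} {t : ℝ}
    (hc : HasDerivAt c c' t) (ht : c t ∈ physicalV d γ s₀) (n : Pt d) :
    HasDerivAt (fun τ => normalPotential γ s₀ n (c τ))
      (normalFlux γ n (consVar γ s₀ (c t)) ⬝ᵥ c') t := by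
  have := HasDerivAt.fun_sum (u := Finset.univ) fun j _ =>
    (hasDerivAt_fluxPotential (s₀ := s₀) hγ hc ht j).mul_const (n j)
  refine this.congr_deriv ?_
  simp only [dotProduct, normalFlux, Finset.sum_mul]
  rw [Finset.sum_comm]
  exact Finset.sum_congr rfl fun i _ => Finset.sum_congr rfl fun j _ => by ring

lemma contDiffAt_consVar (hγ : 1 < γ) {v : State d} (hv : v ∈ physicalV d γ s₀) :
    ContDiffAt ℝ ⊤ (consVar γ s₀) v :=
  (contDiffOn_consVar hγ).contDiffAt ((isOpen_physicalV hγ).mem_nhds hv)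

lemma contDiffAt_normalFlux (n : Pt d) {u : State d} (hu : 0 < density u) :
    ContDiffAt ℝ ⊤ (normalFlux γ n) u :=
  (contDiffOn_normalFlux n).contDiffAt (isOpen_density_pos.mem_nhds hu)

lemma contDiffOn_normalFlux_consVar (hγ : 1 < γ) (n : Pt d) :
    ContDiffOn ℝ ⊤ (fun v => normalFlux γ n (consVar γ s₀ v)) (physicalV d γ s₀) :=
  (contDiffOn_normalFlux n).comp (contDiffOn_consVar hγ) fun _ hv => (consVar_mem hv).1

/-- The chain rule: `Σ` thus involves only the derivative of the single map `v ↦ F_n(u(v))`. -/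
lemma tildeA_eq (hγ : 1 < γ) (n : Pt d) {v : State d} (hv : v ∈ physicalV d γ s₀) :
    tildeA γ s₀ n v = jacobian (fun w => normalFlux γ n (consVar γ s₀ w)) v := by
  have h1 : DifferentiableAt ℝ (consVar γ s₀) v :=
    (contDiffAt_consVar hγ hv).differentiableAt (by simp)
  have h2 : DifferentiableAt ℝ (normalFlux γ n) (consVar γ s₀ v) :=
    (contDiffAt_normalFlux n (consVar_mem hv).1).differentiableAt (by simp)
  ext i k
  simp only [tildeA, jacobian, Matrix.mul_apply, Matrix.of_apply]
  have h3 : fderiv ℝ (fun w => normalFlux γ n (consVar γ s₀ w)) v =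
      (fderiv ℝ (normalFlux γ n) (consVar γ s₀ v)).comp (fderiv ℝ (consVar γ s₀) v) :=
    fderiv_comp v h2 h1
  rw [h3, ContinuousLinearMap.comp_apply]
  conv_rhs => rw [pi_eq_sum_univ' (fderiv ℝ (consVar γ s₀) v (Pi.single k 1))]
  simp only [map_sum, map_smul, Finset.sum_apply, Pi.smul_apply, smul_eq_mul]
  exact Finset.sum_congr rfl fun l _ => mul_comm _ _

lemma jacobian_mulVec (f : State d → State d) (x w : State d) :
    jacobian f x *ᵥ w = fderiv ℝ f x w := by
  ext i
  conv_rhs => rw [pi_eq_sum_univ' w]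
  simp only [map_sum, map_smul, Finset.sum_apply, Pi.smul_apply, smul_eq_mul, Matrix.mulVec,
    dotProduct, jacobian, Matrix.of_apply]
  exact Finset.sum_congr rfl fun l _ => mul_comm _ _

lemma statePath_mem (hγ : 1 < γ) {a b : State d} (ha : a ∈ physicalV d γ s₀)
    (hb : b ∈ physicalV d γ s₀) {θ : ℝ} (hθ : θ ∈ Icc (0 : ℝ) 1) :
    statePath a b θ ∈ physicalV d γ s₀ :=
  (convex_physicalV hγ).add_smul_sub_mem ha hb hθ

lemma continuous_statePath (a b : State d) : Continuous (statePath a b) := by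
  unfold statePath; fun_prop

lemma hasDerivAt_statePath (a b : State d) (θ : ℝ) :
    HasDerivAt (statePath a b) (b - a) θ := by
  unfold statePath
  simpa using ((hasDerivAt_id θ).smul_const (b - a)).const_add a

/-- The quadratic form of `Σ` measures the defect of the trapezoidal rule for the entropy flux
potential. -/
lemma bigSigma_quadratic (hγ : 1 < γ) (n : Pt d) {a b : State d} (ha : a ∈ physicalV d γ s₀)
    (hb : b ∈ physicalV d γ s₀) :
    (b - a) ⬝ᵥ (bigSigma γ s₀ a b n *ᵥ (b - a)) =
      2 * (normalPotential γ s₀ n b - normalPotential γ s₀ n a) -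
      (normalFlux γ n (consVar γ s₀ a) + normalFlux γ n (consVar γ s₀ b)) ⬝ᵥ (b - a) := by
  set G : State d → State d := fun w => normalFlux γ n (consVar γ s₀ w) with hG
  set Δ := b - a with hΔ
  have hsm := contDiffOn_normalFlux_consVar (s₀ := s₀) hγ n
  have hGd : ∀ v ∈ physicalV d γ s₀, HasFDerivAt G (fderiv ℝ G v) v := fun v hv =>
    ((hsm.contDiffAt ((isOpen_physicalV hγ).mem_nhds hv)).differentiableAt (by simp)).hasFDerivAt
  have hfc : ContinuousOn (fderiv ℝ G) (physicalV d γ s₀) :=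
    hsm.continuousOn_fderiv_of_isOpen (isOpen_physicalV hγ) (by simp)
  have hp1 : ∀ θ ∈ Icc (0 : ℝ) 1, statePath a b θ ∈ physicalV d γ s₀ :=
    fun θ hθ => statePath_mem hγ ha hb hθ
  have hp2 : ∀ θ ∈ Icc (0 : ℝ) 1, statePath b a θ ∈ physicalV d γ s₀ :=
    fun θ hθ => statePath_mem hγ hb ha hθ
  have hc1 : ContinuousOn (fun θ => fderiv ℝ G (statePath a b θ)) (Icc 0 1) :=
    hfc.comp (continuous_statePath a b).continuousOn hp1
  have hc2 : ContinuousOn (fun θ => fderiv ℝ G (statePath b a θ)) (Icc 0 1) :=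
    hfc.comp (continuous_statePath b a).continuousOn hp2
  have hentry : ∀ i k, bigSigma γ s₀ a b n i k = ∫ θ in (0 : ℝ)..1, (1 - θ) *
      (fderiv ℝ G (statePath a b θ) (Pi.single k 1) i -
        fderiv ℝ G (statePath b a θ) (Pi.single k 1) i) := by
    intro i k
    refine intervalIntegral.integral_congr fun θ hθ => ?_
    rw [uIcc_of_le zero_le_one] at hθ
    simp only [tildeA_eq hγ n (hp1 θ hθ), tildeA_eq hγ n (hp2 θ hθ)]
    rfl
  have hcont : ∀ i (w : State d), ContinuousOn (fun θ => (1 - θ) *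
      (fderiv ℝ G (statePath a b θ) w i - fderiv ℝ G (statePath b a θ) w i)) (Icc 0 1) := by
    intro i w
    refine (continuousOn_const.sub continuousOn_id).mul (ContinuousOn.sub ?_ ?_)
    · exact (continuous_apply i).comp_continuousOn (hc1.clm_apply continuousOn_const)
    · exact (continuous_apply i).comp_continuousOn (hc2.clm_apply continuousOn_const)
  have hint : ∀ i (w : State d), IntervalIntegrable (fun θ => (1 - θ) *
      (fderiv ℝ G (statePath a b θ) w i - fderiv ℝ G (statePath b a θ) w i)) volume 0 1 :=
    fun i w => ContinuousOn.intervalIntegrable_of_Icc zero_le_one (hcont i w)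
  -- `Σ` is defined entry by entry, so the quadratic form is moved under the integral by finite
  -- linearity.
  have hquad : Δ ⬝ᵥ (bigSigma γ s₀ a b n *ᵥ Δ) = ∫ θ in (0 : ℝ)..1, ∑ i, Δ i * ((1 - θ) *
      (fderiv ℝ G (statePath a b θ) Δ i - fderiv ℝ G (statePath b a θ) Δ i)) := by
    rw [intervalIntegral.integral_finsetSum fun i _ => (hint i Δ).const_mul _]
    simp only [dotProduct, Matrix.mulVec, intervalIntegral.integral_const_mul]
    refine Finset.sum_congr rfl fun i _ => ?_
    congr 1
    simp only [hentry]
    simp_rw [← intervalIntegral.integral_mul_const]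
    rw [← intervalIntegral.integral_finsetSum fun k _ => (hint i _).mul_const _]
    refine intervalIntegral.integral_congr fun θ _ => ?_
    simp only [← jacobian_mulVec, Matrix.mulVec, dotProduct]
    rw [← Finset.sum_sub_distrib, Finset.mul_sum]
    refine Finset.sum_congr rfl fun k _ => ?_
    have : ∀ x, ∑ l, jacobian G x i l * (Pi.single k 1 : State d) l = jacobian G x i k := by
      intro x
      simp [Pi.single_apply]
    simp only [this]
    ring
  rw [hquad]
  -- An explicit antiderivative. On the path from `a` to `b`, differentiating the weight `1 - θ`
  -- produces `-G · Δ`, which the derivative of the potential cancels. The reverse path has velocity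
  -- `-Δ`, hence the opposite sign of its potential.
  have hder : ∀ θ ∈ Icc (0 : ℝ) 1, HasDerivAt
      (fun θ => (1 - θ) * (G (statePath a b θ) ⬝ᵥ Δ) + normalPotential γ s₀ n (statePath a b θ) +
        (1 - θ) * (G (statePath b a θ) ⬝ᵥ Δ) - normalPotential γ s₀ n (statePath b a θ))
      (∑ i, Δ i * ((1 - θ) *
        (fderiv ℝ G (statePath a b θ) Δ i - fderiv ℝ G (statePath b a θ) Δ i))) θ := by
    intro θ hθ
    have d1 : HasDerivAt (fun θ => G (statePath a b θ) ⬝ᵥ Δ)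
        (fderiv ℝ G (statePath a b θ) Δ ⬝ᵥ Δ) θ := by
      have := (hGd _ (hp1 θ hθ)).comp_hasDerivAt θ (hasDerivAt_statePath a b θ)
      exact HasDerivAt.fun_sum fun i _ => (hasDerivAt_pi.1 this i).mul_const _
    have d2 : HasDerivAt (fun θ => G (statePath b a θ) ⬝ᵥ Δ)
        (fderiv ℝ G (statePath b a θ) (a - b) ⬝ᵥ Δ) θ := by
      have := (hGd _ (hp2 θ hθ)).comp_hasDerivAt θ (hasDerivAt_statePath b a θ)
      exact HasDerivAt.fun_sum fun i _ => (hasDerivAt_pi.1 this i).mul_const _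
    have d3 := hasDerivAt_normalPotential (s₀ := s₀) hγ (hasDerivAt_statePath a b θ)
      (hp1 θ hθ) n
    have d4 := hasDerivAt_normalPotential (s₀ := s₀) hγ (hasDerivAt_statePath b a θ)
      (hp2 θ hθ) n
    have d0 : HasDerivAt (fun θ : ℝ => 1 - θ) (-1) θ := by
      simpa using (hasDerivAt_id θ).const_sub 1
    refine ((((d0.mul d1).add d3).add (d0.mul d2)).sub d4).congr_deriv ?_
    have hab : a - b = -Δ := by rw [hΔ, neg_sub]
    rw [hab, map_neg, neg_dotProduct, dotProduct_neg]
    have : ∑ i, Δ i * ((1 - θ) *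
        (fderiv ℝ G (statePath a b θ) Δ i - fderiv ℝ G (statePath b a θ) Δ i)) =
        (1 - θ) * (fderiv ℝ G (statePath a b θ) Δ ⬝ᵥ Δ) -
          (1 - θ) * (fderiv ℝ G (statePath b a θ) Δ ⬝ᵥ Δ) := by
      simp only [dotProduct, Finset.mul_sum, ← Finset.sum_sub_distrib]
      exact Finset.sum_congr rfl fun i _ => by ring
    rw [this]
    simp only [hG]
    ring
  rw [intervalIntegral.integral_eq_sub_of_hasDerivAt (fun θ hθ => hder θ
    (by rwa [uIcc_of_le zero_le_one] at hθ))
    (ContinuousOn.intervalIntegrable_of_Icc zero_le_one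
      (continuousOn_finsetSum _ fun i _ => (hcont i Δ).const_smul (Δ i)))]
  have s0 : ∀ x y : State d, statePath x y 0 = x := fun x y => by simp [statePath]
  have s1 : ∀ x y : State d, statePath x y 1 = y := fun x y => by simp [statePath]
  simp only [s0, s1, add_dotProduct, hG]
  ring

/-- An entropy-stable numerical flux dissipates entropy across an interface. -/
lemma IsEntropyStable.potential_jump_le (hγ : 1 < γ)
    {σ : State d → State d → Pt d → Matrix (Comp d) (Comp d) ℝ} (hσ : IsEntropyStable γ s₀ σ)
    {n : Pt d} (hn : n ⬝ᵥ n = 1) {a b : State d} (ha : a ∈ physicalV d γ s₀)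
    (hb : b ∈ physicalV d γ s₀) :
    normalPotential γ s₀ n b - normalPotential γ s₀ n a ≤
      ((1 / 2 : ℝ) • (normalFlux γ n (consVar γ s₀ a) + normalFlux γ n (consVar γ s₀ b)) +
        (1 / 2 : ℝ) • (σ a b n *ᵥ (b - a))) ⬝ᵥ (b - a) := by
  have h1 := hσ a ha b hb n hn
  rw [bigSigma_quadratic hγ n ha hb, dotProduct_comm (b - a) (σ a b n *ᵥ (b - a))] at h1
  rw [add_dotProduct, smul_dotProduct, smul_dotProduct, smul_eq_mul, smul_eq_mul]
  linarith

/-! ### Legendre duality, chain rule and convexity of the entropy -/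

/-- Legendre duality: `(γ - 1) ρ` is the conjugate potential `u · v - H`. The kinetic terms cancel
between the momentum pairing and the other two. -/
lemma dotProduct_entropyVar (hγ : 1 < γ) {u : State d} (hu : u ∈ physicalU d γ) :
    u ⬝ᵥ entropyVar γ s₀ u = genEntropy γ s₀ u + (γ - 1) * density u := by
  have h1 : 0 < γ - 1 := by linarith
  have hρ := hu.1
  have hp := hu.2
  rw [dotProduct_state, entropyVar_density hγ hu, genEntropy]
  simp only [entropyVar_momentum, entropyVar_energy]
  have : ∑ j, momentum u j * ((γ - 1) * (density u * velocity u j / pressure γ u)) =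
      (γ - 1) * density u ^ 2 / pressure γ u * ∑ j, velocity u j ^ 2 := by
    rw [Finset.mul_sum]
    refine Finset.sum_congr rfl fun j _ => ?_
    rw [velocity]
    field_simp
  rw [this, energy_eq (u := u) hγ]
  field_simp
  ring

lemma genEntropy_consVar (hγ : 1 < γ) {v : State d} (hv : v ∈ physicalV d γ s₀) :
    genEntropy γ s₀ (consVar γ s₀ v) =
      consVar γ s₀ v ⬝ᵥ v - (γ - 1) * densityOfEntropyVar γ s₀ v := by
  have := dotProduct_entropyVar (s₀ := s₀) hγ (consVar_mem hv)
  rw [entropyVar_consVar hv] at this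
  rw [this, consVar_eq hγ hv, density_consOfEntropyVar]
  ring

/-- The chain rule `∂H/∂t = v · ∂u/∂t`. -/
lemma hasDerivAt_genEntropy (hγ : 1 < γ) {c : ℝ → State d} {c' : State d} {t : ℝ}
    (hc : HasDerivAt c c' t) (ht : c t ∈ physicalV d γ s₀) :
    HasDerivAt (fun τ => genEntropy γ s₀ (consVar γ s₀ (c τ)))
      (deriv (fun τ => consVar γ s₀ (c τ)) t ⬝ᵥ c t) t := by
  have h1 : DifferentiableAt ℝ (consVar γ s₀) (c t) :=
    (contDiffAt_consVar hγ ht).differentiableAt (by simp)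
  have h2 : HasDerivAt (fun τ => consVar γ s₀ (c τ))
      (deriv (fun τ => consVar γ s₀ (c τ)) t) t :=
    (h1.comp t hc.differentiableAt).hasDerivAt
  have h3 : HasDerivAt (fun τ => consVar γ s₀ (c τ) ⬝ᵥ c τ)
      (deriv (fun τ => consVar γ s₀ (c τ)) t ⬝ᵥ c t + consVar γ s₀ (c t) ⬝ᵥ c') t := by
    have := HasDerivAt.fun_sum (u := Finset.univ) fun i _ =>
      (hasDerivAt_pi.1 h2 i).mul (hasDerivAt_pi.1 hc i)
    refine this.congr_deriv ?_
    simp only [dotProduct, Finset.sum_add_distrib]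
  -- The term `u · c'` of the product rule cancels the derivative of the potential, leaving only
  -- `∂u/∂t · v`.
  have h4 := h3.sub (hasDerivAt_potential (s₀ := s₀) hγ hc ht)
  refine (h4.congr_of_eventuallyEq ?_).congr_deriv (by ring)
  filter_upwards [eventually_mem_physicalV hγ hc.continuousAt ht] with τ hτ
  exact genEntropy_consVar hγ hτ

/-- Completing the square: the left side, linear in `u` for fixed `a`, is the energy seen in a frame
moving with velocity `a`, that is, internal energy plus relative kinetic energy. -/
lemma energy_sub_eq {u : State d} (hu : 0 < density u) (a : Fin d → ℝ) :
    energy u - ∑ j, a j * momentum u j + (∑ j, a j ^ 2) / 2 * density u =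
      energy u - density u * (∑ j, velocity u j ^ 2) / 2 +
        density u * (∑ j, (velocity u j - a j) ^ 2) / 2 := by
  have hm : ∀ i, momentum u i = density u * velocity u i := by
    intro i; rw [velocity, mul_div_cancel₀ _ hu.ne']
  have : ∑ j, (velocity u j - a j) ^ 2 =
      ∑ j, velocity u j ^ 2 - 2 * ∑ j, a j * velocity u j + ∑ j, a j ^ 2 := by
    rw [Finset.mul_sum, ← Finset.sum_sub_distrib, ← Finset.sum_add_distrib]
    exact Finset.sum_congr rfl fun j _ => by ring
  rw [this]
  have : ∑ j, a j * momentum u j = density u * ∑ j, a j * velocity u j := by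
    rw [Finset.mul_sum]
    exact Finset.sum_congr rfl fun j _ => by rw [hm]; ring
  rw [this]; ring

/-- Convexity of the entropy, as the tangent plane inequality. -/
lemma genEntropy_tangent (hγ : 1 < γ) {u w : State d} (hu : u ∈ physicalU d γ)
    (hw : w ∈ physicalU d γ) :
    genEntropy γ s₀ w + (u - w) ⬝ᵥ entropyVar γ s₀ w ≤ genEntropy γ s₀ u := by
  have h1 : 0 < γ - 1 := by linarith
  rw [sub_dotProduct, dotProduct_entropyVar hγ hw]
  have hρ := hu.1
  have hp := hu.2
  have hρ' := hw.1
  have hp' := hw.2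
  have e1 : u ⬝ᵥ entropyVar γ s₀ w = density u * (-physEntropy γ s₀ w + γ) -
      (γ - 1) * density w / pressure γ w *
        (energy u - ∑ j, velocity w j * momentum u j +
          (∑ j, velocity w j ^ 2) / 2 * density u) := by
    rw [dotProduct_state, entropyVar_density hγ hw]
    simp only [entropyVar_momentum, entropyVar_energy]
    have : ∑ j, momentum u j * ((γ - 1) * (density w * velocity w j / pressure γ w)) =
        (γ - 1) * density w / pressure γ w * ∑ j, velocity w j * momentum u j := by
      rw [Finset.mul_sum]
      exact Finset.sum_congr rfl fun j _ => by ring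
    rw [this]
    ring
  -- In the frame of `w`, dropping the relative kinetic energy leaves the internal energy of `u`.
  have e2 : pressure γ u / (γ - 1) ≤ energy u - ∑ j, velocity w j * momentum u j +
          (∑ j, velocity w j ^ 2) / 2 * density u := by
    rw [energy_sub_eq hρ, pressure, mul_div_cancel_left₀ _ h1.ne']
    have : 0 ≤ ∑ j, (velocity u j - velocity w j) ^ 2 :=
      Finset.sum_nonneg fun j _ => sq_nonneg _
    nlinarith [mul_nonneg hρ.le this]
  have e3 : (γ - 1) * density w / pressure γ w * (pressure γ u / (γ - 1)) ≤
      (γ - 1) * density w / pressure γ w *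
        (energy u - ∑ j, velocity w j * momentum u j +
          (∑ j, velocity w j ^ 2) / 2 * density u) :=
    mul_le_mul_of_nonneg_left e2 (by positivity)
  have e4 : (γ - 1) * density w / pressure γ w * (pressure γ u / (γ - 1)) =
      density u * ((pressure γ u / pressure γ w) * (density w / density u)) := by
    field_simp
  rw [e4] at e3
  rw [e1, genEntropy, genEntropy, physEntropy_eq hu, physEntropy_eq hw]
  have hA : 0 < pressure γ u / pressure γ w := div_pos hp hp'
  have hB : 0 < density w / density u := div_pos hρ' hρ
  -- With `A = p_u / p_w` and `B = ρ_w / ρ_u`, the entropy difference is `log (A B) + (γ - 1) log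
  -- B`. Two uses of `log x ≤ x - 1` bound it by exactly the terms left over.
  have l1 := Real.log_le_sub_one_of_pos (mul_pos hA hB)
  have l2 := Real.log_le_sub_one_of_pos hB
  rw [Real.log_mul hA.ne' hB.ne', Real.log_div hp.ne' hp'.ne'] at l1
  rw [Real.log_div hρ'.ne' hρ.ne'] at l1 l2
  have l3 := mul_le_mul_of_nonneg_left l2 h1.le
  have l4 := mul_le_mul_of_nonneg_left (add_le_add l1 l3) hρ.le
  have l5 : density u * (density w / density u) = density w := by field_simp
  set AB := pressure γ u / pressure γ w * (density w / density u)
  nlinarith [l4, e3, l5]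

end EulerHDG

/-! ### Polynomial maps and curved elements -/

namespace EulerHDG

lemma contDiff_eval {a : ℕ} (P : MvPolynomial (Fin a) ℝ) {n : WithTop ℕ∞} :
    ContDiff ℝ n (fun x : Pt a => MvPolynomial.eval x P) := by
  induction P using MvPolynomial.induction_on with
  | C r => simpa using contDiff_const
  | add p q hp hq => simpa using hp.add hq
  | mul_X p i hp => simpa using hp.mul (contDiff_apply ℝ ℝ i)

lemma hasFDerivAt_eval {a : ℕ} (P : MvPolynomial (Fin a) ℝ) (x : Pt a) :
    HasFDerivAt (fun x : Pt a => MvPolynomial.eval x P)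
      (∑ j, MvPolynomial.eval x (MvPolynomial.pderiv j P) •
        (ContinuousLinearMap.proj j : Pt a →L[ℝ] ℝ)) x := by
  induction P using MvPolynomial.induction_on with
  | C r =>
    simp only [MvPolynomial.eval_C, MvPolynomial.pderiv_C, map_zero, zero_smul,
      Finset.sum_const_zero]
    exact hasFDerivAt_const r x
  | add p q hp hq =>
    simp only [map_add, add_smul, Finset.sum_add_distrib]
    exact hp.add hq
  | mul_X p i hp =>
    have hX : HasFDerivAt (fun x : Pt a => x i) (ContinuousLinearMap.proj i : Pt a →L[ℝ] ℝ) x :=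
      hasFDerivAt_apply i x
    have := hp.fun_mul hX
    simp only [map_mul, MvPolynomial.eval_X]
    refine this.congr_fderiv ?_
    ext w
    simp [MvPolynomial.pderiv_X, Pi.single_apply, add_mul, Finset.sum_add_distrib,
      Finset.mul_sum, mul_assoc,
      apply_ite (MvPolynomial.eval x), ite_mul]

lemma contDiff_polyMap {a b : ℕ} (P : Fin b → MvPolynomial (Fin a) ℝ) {n : WithTop ℕ∞} :
    ContDiff ℝ n (polyMap P) :=
  contDiff_pi.2 fun i => contDiff_eval (P i)

lemma continuous_polyMap {a b : ℕ} (P : Fin b → MvPolynomial (Fin a) ℝ) :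
    Continuous (polyMap P) := (contDiff_polyMap P (n := 0)).continuous

lemma hasFDerivAt_polyMap {a b : ℕ} (P : Fin b → MvPolynomial (Fin a) ℝ) (x : Pt a) :
    HasFDerivAt (polyMap P) (polyJac P x).mulVecLin.toContinuousLinearMap x := by
  rw [hasFDerivAt_pi']
  intro i
  refine (hasFDerivAt_eval (P i) x).congr_fderiv ?_
  ext w
  simp [polyJac, Matrix.mulVec, dotProduct]

lemma continuous_polyJac {a b : ℕ} (P : Fin b → MvPolynomial (Fin a) ℝ) :
    Continuous (polyJac P) :=
  continuous_pi fun i => continuous_pi fun j =>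
    (contDiff_eval (n := 0) (MvPolynomial.pderiv j (P i))).continuous

lemma det_mulVecLin {a : ℕ} (M : Matrix (Fin a) (Fin a) ℝ) :
    (M.mulVecLin.toContinuousLinearMap).det = M.det := by
  rw [ContinuousLinearMap.det, LinearMap.coe_toContinuousLinearMap, ← Matrix.toLin'_apply',
    LinearMap.det_toLin']

lemma det_fderiv_polyMap {a : ℕ} (P : Fin a → MvPolynomial (Fin a) ℝ) (x : Pt a) :
    (fderiv ℝ (polyMap P) x).det = (polyJac P x).det := by
  rw [(hasFDerivAt_polyMap P x).fderiv, det_mulVecLin]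

/-- A `C^1` map that is injective and nonsingular on a compact set is a diffeomorphism of open
neighbourhoods. -/
lemma exists_openPartialHomeomorph {E : Type*} [NormedAddCommGroup E] [NormedSpace ℝ E]
    [FiniteDimensional ℝ E] {f : E → E} (hf : ContDiff ℝ 1 f) {C : Set E} (hC : IsCompact C)
    (hinj : InjOn f C) (hdet : ∀ x ∈ C, (fderiv ℝ f x).det ≠ 0) :
    ∃ Ψ : OpenPartialHomeomorph E E, (⇑Ψ = f) ∧ C ⊆ Ψ.source ∧
      (∀ x ∈ Ψ.source, (fderiv ℝ f x).det ≠ 0) ∧ ContDiffOn ℝ 1 Ψ.symm Ψ.target := by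
  have : CompleteSpace E := FiniteDimensional.complete ℝ E
  have hequiv : ∀ x, (fderiv ℝ f x).det ≠ 0 → ∃ e : E ≃L[ℝ] E, HasFDerivAt f (e : E →L[ℝ] E) x := by
    intro x hx
    refine ⟨(fderiv ℝ f x).toContinuousLinearEquivOfDetNeZero hx, ?_⟩
    rw [ContinuousLinearMap.coe_toContinuousLinearEquivOfDetNeZero]
    exact (hf.differentiable (by simp) x).hasFDerivAt
  have hloc : ∀ x ∈ C, ∃ u ∈ 𝓝 x, InjOn f u := by
    intro x hx
    obtain ⟨e, he⟩ := hequiv x (hdet x hx)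
    let φ := (hf.contDiffAt (x := x)).toOpenPartialHomeomorph f he (by simp)
    refine ⟨φ.source, φ.open_source.mem_nhds
      ((hf.contDiffAt (x := x)).mem_toOpenPartialHomeomorph_source he (by simp)), φ.injOn⟩
  -- Injectivity on the compact set and local injectivity from the inverse function theorem combine
  -- to injectivity on a neighbourhood.
  obtain ⟨t, ht, hCt, htinj⟩ := hinj.exists_isOpen_superset hC
    (fun x _ => hf.continuous.continuousAt) hloc
  have hV : IsOpen {x | (fderiv ℝ f x).det ≠ 0} :=
    isOpen_ne_fun ((ContinuousLinearMap.continuous_det).comp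
      (hf.continuous_fderiv (by simp))) continuous_const
  set U := t ∩ {x | (fderiv ℝ f x).det ≠ 0} with hU
  have hUo : IsOpen U := ht.inter hV
  have hUinj : InjOn f U := htinj.mono inter_subset_left
  have hnhds : ∀ x ∈ U, map f (𝓝 x) = 𝓝 (f x) := by
    intro x hx
    obtain ⟨e, he⟩ := hequiv x hx.2
    exact ((hf.contDiffAt (x := x)).hasStrictFDerivAt' he (by simp)).map_nhds_eq_of_equiv
  have himg : ∀ s ⊆ U, IsOpen s → IsOpen (f '' s) := by
    intro s hs hso
    rw [isOpen_iff_mem_nhds]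
    rintro _ ⟨x, hx, rfl⟩
    rw [← hnhds x (hs hx)]
    exact image_mem_map (hso.mem_nhds hx)
  -- Built so that its forward map is definitionally `f`; the inverse function theorem at each point
  -- makes it open.
  let Ψ : OpenPartialHomeomorph E E := OpenPartialHomeomorph.ofContinuousOpenRestrict
    (hUinj.toPartialEquiv f U) hf.continuous.continuousOn
    (by
      intro s hs
      have : U.domRestrict f '' s = f '' (Subtype.val '' s) := by
        rw [image_image]; rfl
      change IsOpen (U.domRestrict f '' s)
      rw [this]
      exact himg _ (by rintro _ ⟨x, -, rfl⟩; exact x.2) (hUo.isOpenMap_subtype_val s hs)) hUo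
  refine ⟨Ψ, rfl, subset_inter hCt hdet, fun x hx => hx.2, ?_⟩
  intro y hy
  refine ContDiffAt.contDiffWithinAt ?_
  have hx : Ψ.symm y ∈ U := Ψ.map_target hy
  obtain ⟨e, he⟩ := hequiv _ hx.2
  exact Ψ.contDiffAt_symm hy he hf.contDiffAt

lemma IsOpenPolytope.isOpen {a : ℕ} {S : Set (Pt a)} (h : IsOpenPolytope S) : IsOpen S := by
  obtain ⟨-, -, q, c, r, rfl⟩ := h
  simp only [ofPred_forall]
  exact isOpen_iInter_of_finite fun i => isOpen_lt (by unfold dotProduct; fun_prop) continuous_const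

lemma IsOpenPolytope.convex {a : ℕ} {S : Set (Pt a)} (h : IsOpenPolytope S) : Convex ℝ S := by
  obtain ⟨-, -, q, c, r, rfl⟩ := h
  simp only [ofPred_forall]
  exact convex_iInter fun i => convex_halfSpace_lt
    ⟨fun x y => dotProduct_add _ _ _, fun b x => dotProduct_smul _ _ _⟩ _

lemma IsOpenPolytope.isCompact_closure {a : ℕ} {S : Set (Pt a)} (h : IsOpenPolytope S) :
    IsCompact (closure S) := h.2.1.isCompact_closure

lemma IsOpenPolytope.interior_closure {a : ℕ} {S : Set (Pt a)} (h : IsOpenPolytope S) :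
    interior (closure S) = S := by
  rw [h.convex.interior_closure_eq_interior_of_nonempty_interior
    (by rw [h.isOpen.interior_eq]; exact h.1), h.isOpen.interior_eq]

namespace Mesh

variable {e p : ℕ} {Λ : Submodule ℤ (Pt (e + 1))} {Ω : Set (Pt (e + 1))} (T : Mesh e p Λ Ω)

lemma exists_elemHomeomorph (K : Fin T.numElem) :
    ∃ Ψ : OpenPartialHomeomorph (Pt (e + 1)) (Pt (e + 1)), (⇑Ψ = polyMap (T.elemMap K)) ∧
      closure T.Kref ⊆ Ψ.source ∧ ContDiffOn ℝ 1 Ψ.symm Ψ.target := by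
  obtain ⟨Ψ, h1, h2, -, h4⟩ := exists_openPartialHomeomorph (contDiff_polyMap (T.elemMap K))
    T.Kref_polytope.isCompact_closure (T.elemMap_injOn K)
    (fun x hx => by rw [det_fderiv_polyMap]; exact T.elemMap_nonsingular K x hx)
  exact ⟨Ψ, h1, h2, h4⟩

lemma isOpen_elem (K : Fin T.numElem) : IsOpen (T.elem K) := by
  obtain ⟨Ψ, h1, h2, -⟩ := T.exists_elemHomeomorph K
  rw [elem, ← h1]
  exact Ψ.isOpen_image_of_subset_source T.Kref_polytope.isOpen (subset_closure.trans h2)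

lemma isCompact_closedElem (K : Fin T.numElem) : IsCompact (T.closedElem K) :=
  T.Kref_polytope.isCompact_closure.image (continuous_polyMap _)

lemma closure_elem (K : Fin T.numElem) : closure (T.elem K) = T.closedElem K :=
  (image_closure_of_isCompact T.Kref_polytope.isCompact_closure
    (continuous_polyMap _).continuousOn).symm

lemma elem_subset_closedElem (K : Fin T.numElem) : T.elem K ⊆ T.closedElem K :=
  image_mono subset_closure

lemma frontier_subset_closedElem (K : Fin T.numElem) : frontier (T.elem K) ⊆ T.closedElem K := by
  rw [← T.closure_elem K]; exact frontier_subset_closure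

/-- The mapping is a homeomorphism near the closed reference polytope, and a nonempty open convex
set is the interior of its closure. -/
lemma interior_closedElem (K : Fin T.numElem) : interior (T.closedElem K) = T.elem K := by
  obtain ⟨Ψ, h1, h2, -⟩ := T.exists_elemHomeomorph K
  refine Subset.antisymm ?_ (interior_maximal (T.elem_subset_closedElem K) (T.isOpen_elem K))
  intro x hx
  obtain ⟨ξ, hξ, rfl⟩ := interior_subset hx
  refine ⟨ξ, ?_, rfl⟩
  rw [← T.Kref_polytope.interior_closure]
  have hN : IsOpen (Ψ.source ∩ Ψ ⁻¹' interior (T.closedElem K)) :=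
    Ψ.isOpen_inter_preimage isOpen_interior
  refine mem_interior.2 ⟨_, ?_, hN, h2 hξ, by rw [h1]; exact hx⟩
  rintro z ⟨hz, hz'⟩
  obtain ⟨z', hz1, hz2⟩ := interior_subset hz'
  rw [← h1] at hz2
  rwa [← Ψ.injOn (h2 hz1) hz hz2]

/-- Excludes slits, that is, boundary pieces with the element on both sides, where the divergence
theorem with one normal would fail. -/
lemma frontier_elem_subset_closure_compl (K : Fin T.numElem) :
    frontier (T.elem K) ⊆ closure (T.closedElem K)ᶜ := by
  intro x hx
  rw [closure_compl, T.interior_closedElem K]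
  rw [(T.isOpen_elem K).frontier_eq] at hx
  exact hx.2

lemma volume_closedElem_diff (K : Fin T.numElem) :
    volume (T.closedElem K \ T.elem K) = 0 := by
  refine measure_mono_null (t := polyMap (T.elemMap K) '' frontier T.Kref) ?_ ?_
  · rintro _ ⟨⟨ξ, hξ, rfl⟩, h⟩
    refine ⟨ξ, ?_, rfl⟩
    rw [T.Kref_polytope.isOpen.frontier_eq]
    exact ⟨hξ, fun h' => h ⟨ξ, h', rfl⟩⟩
  · exact addHaar_image_eq_zero_of_differentiableOn_of_addHaar_eq_zero _
      ((contDiff_polyMap (n := 1) _).differentiable (by simp)).differentiableOn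
      (T.Kref_polytope.convex.addHaar_frontier _)

end Mesh

end EulerHDG

/-! ### Collars of a parametrized hypersurface -/

namespace EulerHDG

variable {e : ℕ}

/-- The square matrix with first column `c` and remaining columns `J`. -/
def consCol (c : Pt (e + 1)) (J : Matrix (Fin (e + 1)) (Fin e) ℝ) :
    Matrix (Fin (e + 1)) (Fin (e + 1)) ℝ :=
  Matrix.of fun i => Fin.cons (c i) (J i)

lemma consCol_zero (c : Pt (e + 1)) (J : Matrix (Fin (e + 1)) (Fin e) ℝ) (i : Fin (e + 1)) :
    consCol c J i 0 = c i := rfl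

lemma consCol_succ (c : Pt (e + 1)) (J : Matrix (Fin (e + 1)) (Fin e) ℝ) (i : Fin (e + 1))
    (j : Fin e) : consCol c J i j.succ = J i j := rfl

/-- The product of the transpose of `(n | J)` with `(c | J)` has first row `(n · c, 0, …, 0)`,
because `n` annihilates `J`; expand along that row. -/
lemma det_consCol_mul (n c : Pt (e + 1)) (J : Matrix (Fin (e + 1)) (Fin e) ℝ)
    (hJ : n ᵥ* J = 0) :
    (consCol n J).det * (consCol c J).det = (n ⬝ᵥ c) * (Jᵀ * J).det := by
  rw [← Matrix.det_transpose (consCol n J), ← Matrix.det_mul, Matrix.det_succ_row_zero,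
    Fin.sum_univ_succ]
  have h0 : ∀ j : Fin e, ((consCol n J)ᵀ * consCol c J) 0 j.succ = 0 := by
    intro j
    have := congrFun hJ j
    simpa [Matrix.mul_apply, Matrix.vecMul, dotProduct, consCol_zero, consCol_succ] using this
  simp only [h0, mul_zero, zero_mul, Finset.sum_const_zero, add_zero, Fin.val_zero, pow_zero,
    one_mul, Fin.succAbove_zero]
  congr 1

/-- Divide `det_consCol_mul` by its own case `c = n`. The Jacobian of a collar in direction `c` is
thereby the surface density times `|n · c|`. -/
lemma abs_det_consCol {n : Pt (e + 1)} (c : Pt (e + 1)) {J : Matrix (Fin (e + 1)) (Fin e) ℝ}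
    (hn : n ⬝ᵥ n = 1) (hJ : n ᵥ* J = 0) (hdet : (Jᵀ * J).det ≠ 0) :
    |(consCol c J).det| = |n ⬝ᵥ c| * √(Jᵀ * J).det := by
  have h1 := det_consCol_mul n n J hJ
  have h2 := det_consCol_mul n c J hJ
  rw [hn, one_mul] at h1
  have h3 : |(consCol n J).det| = √(Jᵀ * J).det := by
    rw [← h1, Real.sqrt_mul_self_eq_abs]
  have h4 : 0 < √(Jᵀ * J).det := by
    rw [← h3, abs_pos]
    rintro h
    rw [h, zero_mul] at h1
    exact hdet h1.symm
  have h5 := congrArg abs h2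
  have h6 : |(Jᵀ * J).det| = √(Jᵀ * J).det * √(Jᵀ * J).det := by rw [← h3, ← abs_mul, h1]
  rw [abs_mul, abs_mul, h3, h6] at h5
  apply mul_left_cancel₀ h4.ne'
  rw [h5]; ring

/-- The map `(r, y) ↦ φ(y) + l + r c`. -/
noncomputable def collar (Q : Fin (e + 1) → MvPolynomial (Fin e) ℝ) (l c z : Pt (e + 1)) : Pt (e + 1) :=
  polyMap Q (Fin.tail z) + l + z 0 • c

lemma contDiff_tail {n : WithTop ℕ∞} : ContDiff ℝ n (fun z : Pt (e + 1) => (Fin.tail z : Pt e)) :=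
  contDiff_pi.2 fun j => contDiff_apply ℝ ℝ j.succ

lemma contDiff_collar (Q : Fin (e + 1) → MvPolynomial (Fin e) ℝ) (l c : Pt (e + 1))
    {n : WithTop ℕ∞} : ContDiff ℝ n (collar Q l c) :=
  (((contDiff_polyMap Q).comp contDiff_tail).add contDiff_const).add
    ((contDiff_apply ℝ ℝ (0 : Fin (e + 1))).smul contDiff_const)

lemma hasFDerivAt_collar (Q : Fin (e + 1) → MvPolynomial (Fin e) ℝ) (l c z : Pt (e + 1)) :
    HasFDerivAt (collar Q l c)
      (consCol c (polyJac Q (Fin.tail z))).mulVecLin.toContinuousLinearMap z := by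
  let tl : Pt (e + 1) →L[ℝ] Pt e :=
    ContinuousLinearMap.pi fun j => ContinuousLinearMap.proj j.succ
  have h1 : HasFDerivAt (fun z : Pt (e + 1) => polyMap Q (Fin.tail z)) _ z :=
    (hasFDerivAt_polyMap Q (Fin.tail z)).comp z tl.hasFDerivAt
  have h2 : HasFDerivAt (fun z : Pt (e + 1) => z 0 • c) _ z :=
    (hasFDerivAt_apply (𝕜 := ℝ) (0 : Fin (e + 1)) z).smul_const c
  refine ((h1.add_const l).add h2).congr_fderiv ?_
  ext w i
  simp [Matrix.mulVec, dotProduct, Fin.sum_univ_succ, consCol_zero, consCol_succ, tl, mul_comm,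
    add_comm]

lemma det_fderiv_collar (Q : Fin (e + 1) → MvPolynomial (Fin e) ℝ) (l c z : Pt (e + 1)) :
    (fderiv ℝ (collar Q l c) z).det = (consCol c (polyJac Q (Fin.tail z))).det := by
  rw [(hasFDerivAt_collar Q l c z).fderiv, det_mulVecLin]

lemma collar_cons (Q : Fin (e + 1) → MvPolynomial (Fin e) ℝ) (l c : Pt (e + 1)) (r : ℝ)
    (y : Pt e) : collar Q l c (Fin.cons r y : Pt (e + 1)) = polyMap Q y + l + r • c := by
  simp [collar]

/-- In the sup norm a ball is a box, so Fubini applies directly to a collar over a ball. -/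
lemma mem_ball_cons {y₀ : Pt e} {h : ℝ} (hh : 0 < h) (z : Pt (e + 1)) :
    z ∈ Metric.ball (Fin.cons 0 y₀ : Pt (e + 1)) h ↔
      z 0 ∈ Ioo (-h) h ∧ (Fin.tail z : Pt e) ∈ Metric.ball y₀ h := by
  rw [Metric.mem_ball, dist_pi_lt_iff hh, Fin.forall_fin_succ, Metric.mem_ball, dist_pi_lt_iff hh]
  simp only [Fin.cons_zero, Fin.cons_succ, Real.dist_eq, sub_zero, abs_lt, mem_Ioo]
  rfl

lemma mem_closedBall_cons {y₀ : Pt e} {h : ℝ} (hh : 0 ≤ h) (z : Pt (e + 1)) :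
    z ∈ Metric.closedBall (Fin.cons 0 y₀ : Pt (e + 1)) h ↔
      z 0 ∈ Icc (-h) h ∧ (Fin.tail z : Pt e) ∈ Metric.closedBall y₀ h := by
  rw [Metric.mem_closedBall, dist_pi_le_iff hh, Fin.forall_fin_succ, Metric.mem_closedBall,
    dist_pi_le_iff hh]
  simp only [Fin.cons_zero, Fin.cons_succ, Real.dist_eq, sub_zero, abs_le, mem_Icc]
  rfl

/-- A collar map is a local diffeomorphism at the points of the hypersurface where `c` is
transversal. -/
lemma exists_collarHomeomorph (Q : Fin (e + 1) → MvPolynomial (Fin e) ℝ) (l : Pt (e + 1))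
    {c : Pt (e + 1)} {y₀ : Pt e} (hdet : (consCol c (polyJac Q y₀)).det ≠ 0) :
    ∃ Ψ : OpenPartialHomeomorph (Pt (e + 1)) (Pt (e + 1)), (⇑Ψ = collar Q l c) ∧
      (Fin.cons 0 y₀ : Pt (e + 1)) ∈ Ψ.source ∧
      (∀ z ∈ Ψ.source, (consCol c (polyJac Q (Fin.tail z))).det ≠ 0) ∧
      ContDiffOn ℝ 1 Ψ.symm Ψ.target := by
  obtain ⟨Ψ, h1, h2, h3, h4⟩ := exists_openPartialHomeomorph (contDiff_collar Q l c)
    (isCompact_singleton (x := (Fin.cons 0 y₀ : Pt (e + 1)))) (injOn_singleton _ _)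
    (by simpa [det_fderiv_collar] using hdet)
  exact ⟨Ψ, h1, h2 rfl, fun z hz => by simpa [det_fderiv_collar] using h3 z hz, h4⟩

/-- Just inside a domain with outward normal `n`, the collar coordinate has the sign of `-n · c`. -/
lemma exists_collar_mem_of_outward {Q : Fin (e + 1) → MvPolynomial (Fin e) ℝ} {l c n : Pt (e + 1)}
    {y : Pt e} {Ψ : OpenPartialHomeomorph (Pt (e + 1)) (Pt (e + 1))}
    (hΨ : ⇑Ψ = collar Q l c) (hΨs : ContDiffOn ℝ 1 Ψ.symm Ψ.target)
    {U : Set (Pt (e + 1))} (hU : U ∈ 𝓝 (Fin.cons 0 y : Pt (e + 1))) (hUs : U ⊆ Ψ.source)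
    (hn : n ⬝ᵥ n = 1) (hJ : n ᵥ* polyJac Q y = 0) {K : Set (Pt (e + 1))}
    (hout : ∀ᶠ r in 𝓝[>] (0 : ℝ), polyMap Q y + l - r • n ∈ K) :
    ∃ z ∈ U, collar Q l c z ∈ K ∧ z 0 * (n ⬝ᵥ c) < 0 := by
  set z₀ : Pt (e + 1) := Fin.cons 0 y with hz₀
  have hz₀s : z₀ ∈ Ψ.source := hUs (mem_of_mem_nhds hU)
  have hx₀ : Ψ z₀ = polyMap Q y + l := by rw [hΨ, hz₀, collar_cons]; simp
  set γ : ℝ → Pt (e + 1) := fun r => polyMap Q y + l - r • n with hγ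
  have hγ0 : γ 0 = Ψ z₀ := by simp [hγ, hx₀]
  have hγc : Continuous γ := by fun_prop
  have hγd : HasDerivAt γ (-n) 0 := by
    simpa using ((hasDerivAt_id (0 : ℝ)).smul_const n).const_sub (polyMap Q y + l)
  have htgt : γ 0 ∈ Ψ.target := hγ0 ▸ Ψ.map_source hz₀s
  have hsd : DifferentiableAt ℝ Ψ.symm (γ 0) :=
    ((hΨs _ htgt).contDiffAt (Ψ.open_target.mem_nhds htgt)).differentiableAt (by simp)
  -- The inward normal ray in collar coordinates; its initial velocity `A` solves `(c | J) A = -n`.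
  set ζ : ℝ → Pt (e + 1) := fun r => Ψ.symm (γ r) with hζ
  have hζ0 : ζ 0 = z₀ := by rw [hζ]; simp only [hγ0]; exact Ψ.left_inv hz₀s
  obtain ⟨A, hA⟩ : ∃ A, HasDerivAt ζ A 0 := ⟨_, hsd.hasFDerivAt.comp_hasDerivAt 0 hγd⟩
  have hev : ∀ᶠ r in 𝓝 (0 : ℝ), γ r ∈ Ψ.target :=
    hγc.continuousAt.eventually (Ψ.open_target.mem_nhds htgt)
  have hA1 : consCol c (polyJac Q y) *ᵥ A = -n := by
    have h1 := (hasFDerivAt_collar Q l c (ζ 0)).comp_hasDerivAt 0 hA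
    have h2 : HasDerivAt γ (consCol c (polyJac Q (Fin.tail (ζ 0))) *ᵥ A) 0 := by
      refine HasDerivAt.congr_of_eventuallyEq h1 ?_
      filter_upwards [hev] with r hr
      rw [Function.comp_apply, ← hΨ, hζ]
      exact (Ψ.right_inv hr).symm
    rw [hζ0, hz₀, Fin.tail_cons] at h2
    exact h2.unique hγd
  -- Pairing with `n` removes the tangential columns and leaves only the collar coordinate.
  have hA0 : (n ⬝ᵥ c) * A 0 = -1 := by
    have h1 : n ⬝ᵥ (consCol c (polyJac Q y) *ᵥ A) = -1 := by rw [hA1, dotProduct_neg, hn]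
    rw [Matrix.dotProduct_mulVec, dotProduct, Fin.sum_univ_succ] at h1
    have h2 : ∀ j : Fin e, (n ᵥ* consCol c (polyJac Q y)) j.succ = 0 := fun j => congrFun hJ j
    simp only [h2, zero_mul, Finset.sum_const_zero, add_zero] at h1
    exact h1
  have hd0 : HasDerivAt (fun r => ζ r 0 * (n ⬝ᵥ c)) (-1) 0 := by
    have := (hasDerivAt_pi.1 hA 0).mul_const (n ⬝ᵥ c)
    rwa [mul_comm (A 0), hA0] at this
  have hneg : ∀ᶠ r in 𝓝[>] (0 : ℝ), ζ r 0 * (n ⬝ᵥ c) < 0 := by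
    have h1 := (hasDerivAt_iff_tendsto_slope.1 hd0).eventually
      (gt_mem_nhds (show (-1 : ℝ) < 0 by norm_num))
    have hsub : Ioi (0 : ℝ) ⊆ {0}ᶜ := fun r hr => ne_of_gt hr
    have h2 : ∀ᶠ r in 𝓝[>] (0 : ℝ), slope (fun r => ζ r 0 * (n ⬝ᵥ c)) 0 r < 0 :=
      h1.filter_mono (nhdsWithin_mono 0 hsub)
    filter_upwards [h2, self_mem_nhdsWithin] with r hr hr0
    have hr0' : (0 : ℝ) < r := hr0
    have h3 : ζ 0 0 = 0 := by rw [hζ0, hz₀, Fin.cons_zero]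
    rw [slope_def_field, h3] at hr
    simp only [zero_mul, sub_zero] at hr
    by_contra hcon
    exact absurd (div_nonneg (not_lt.1 hcon) hr0'.le) (not_le.2 hr)
  have hζU : ∀ᶠ r in 𝓝[>] (0 : ℝ), ζ r ∈ U := by
    have : ContinuousAt ζ 0 := hA.continuousAt
    rw [ContinuousAt, hζ0] at this
    exact (this.eventually hU).filter_mono nhdsWithin_le_nhds
  obtain ⟨r, h1, h2, h3, h4⟩ :=
    (hneg.and (hζU.and (hout.and (hev.filter_mono nhdsWithin_le_nhds)))).exists
  refine ⟨ζ r, h2, ?_, h1⟩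
  rw [← hΨ, hζ]
  simpa only [Ψ.right_inv h4] using h3

end EulerHDG

/-! ### Boundary patches: the domain lies on one side -/

namespace EulerHDG

variable {e : ℕ}

/-- `S` parametrizes, by `y ↦ φ(y) + l`, a part of the boundary of the domain `K`, and `n` is the
unit normal of `K` there, pointing outwards. -/
structure IsBoundaryPatch (Q : Fin (e + 1) → MvPolynomial (Fin e) ℝ) (l : Pt (e + 1))
    (S : Set (Pt e)) (n : Pt e → Pt (e + 1)) (K : Set (Pt (e + 1))) : Prop where
  isOpen : IsOpen S
  isOpen_domain : IsOpen K
  regular : frontier K ⊆ closure (closure K)ᶜ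
  nonsingular : ∀ y ∈ S, ((polyJac Q y)ᵀ * polyJac Q y).det ≠ 0
  mem_frontier : ∀ y ∈ S, polyMap Q y + l ∈ frontier K
  unit : ∀ y ∈ S, n y ⬝ᵥ n y = 1
  orthogonal : ∀ y ∈ S, n y ᵥ* polyJac Q y = 0
  outward : ∀ y ∈ S, ∀ᶠ r in 𝓝[>] (0 : ℝ), polyMap Q y + l - r • n y ∈ K

/-- Near the point with parameter `y₀`, the patch exhausts the boundary of `K`. -/
def ExhaustsFrontier (Q : Fin (e + 1) → MvPolynomial (Fin e) ℝ) (l : Pt (e + 1))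
    (S : Set (Pt e)) (K : Set (Pt (e + 1))) (y₀ : Pt e) : Prop :=
  ∀ V ∈ 𝓝 y₀, ∀ᶠ x in 𝓝 (polyMap Q y₀ + l), x ∈ frontier K → ∃ y ∈ V, y ∈ S ∧ polyMap Q y + l = x

variable {Q : Fin (e + 1) → MvPolynomial (Fin e) ℝ} {l : Pt (e + 1)} {S : Set (Pt e)}
  {n : Pt e → Pt (e + 1)} {K : Set (Pt (e + 1))}

lemma continuous_cons_zero : Continuous (fun y : Pt e => (Fin.cons 0 y : Pt (e + 1))) := by
  refine continuous_pi fun i => ?_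
  refine Fin.cases ?_ (fun j => ?_) i
  · simpa using continuous_const
  · simpa using continuous_apply j

lemma continuous_tail : Continuous (fun z : Pt (e + 1) => (Fin.tail z : Pt e)) :=
  (contDiff_tail (n := 0)).continuous

/-- In a collar the domain is exactly the part below the hypersurface. -/
lemma IsBoundaryPatch.exists_collar_box (hP : IsBoundaryPatch Q l S n K) {c : Pt (e + 1)}
    {y₀ : Pt e} (hy₀ : y₀ ∈ S) (hc : 0 < n y₀ ⬝ᵥ c) (hloc : ExhaustsFrontier Q l S K y₀)
    {N : Set (Pt (e + 1))} (hN : N ∈ 𝓝 (polyMap Q y₀ + l)) :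
    ∃ h > 0, InjOn (collar Q l c) (Metric.closedBall (Fin.cons 0 y₀ : Pt (e + 1)) h) ∧
      IsOpen (collar Q l c '' Metric.ball (Fin.cons 0 y₀ : Pt (e + 1)) h) ∧
      collar Q l c '' Metric.ball (Fin.cons 0 y₀ : Pt (e + 1)) h ⊆ N ∧
      Metric.ball y₀ h ⊆ S ∧ (∀ y ∈ Metric.ball y₀ h, 0 < n y ⬝ᵥ c) ∧
      ∀ z ∈ Metric.ball (Fin.cons 0 y₀ : Pt (e + 1)) h, collar Q l c z ∈ K ↔ z 0 < 0 := by
  have hdetne : ∀ y ∈ S, (consCol c (polyJac Q y)).det ≠ 0 ↔ n y ⬝ᵥ c ≠ 0 := by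
    intro y hy
    have h1 := abs_det_consCol c (hP.unit y hy) (hP.orthogonal y hy) (hP.nonsingular y hy)
    have h2 : √((polyJac Q y)ᵀ * polyJac Q y).det ≠ 0 := by
      intro h0
      have h3 := det_consCol_mul (n y) (n y) _ (hP.orthogonal y hy)
      rw [hP.unit y hy, one_mul] at h3
      rw [← h3, Real.sqrt_mul_self_eq_abs, abs_eq_zero] at h0
      rw [h0, zero_mul] at h3
      exact hP.nonsingular y hy h3.symm
    rw [← abs_ne_zero, h1, mul_ne_zero_iff, abs_ne_zero]
    exact and_iff_left h2
  set z₀ : Pt (e + 1) := Fin.cons 0 y₀ with hz₀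
  obtain ⟨Ψ, hΨ, hz₀s, hΨdet, hΨs⟩ := exists_collarHomeomorph Q l
    ((hdetne y₀ hy₀).2 hc.ne')
  have hcol0 : ∀ y, collar Q l c (Fin.cons 0 y : Pt (e + 1)) = polyMap Q y + l := by
    intro y; rw [collar_cons]; simp
  have hcolc : Continuous (collar Q l c) := (contDiff_collar Q l c (n := 0)).continuous
  have hV : {y : Pt e | (Fin.cons 0 y : Pt (e + 1)) ∈ Ψ.source} ∈ 𝓝 y₀ :=
    (Ψ.open_source.preimage continuous_cons_zero).mem_nhds hz₀s
  -- Frontier points in this neighbourhood have parameters whose slice point lies in `Ψ.source`;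
  -- injectivity there will force their collar coordinate to be zero.
  have hW : Ψ.source ∩ (fun z : Pt (e + 1) => (Fin.tail z : Pt e)) ⁻¹' S ∩
      collar Q l c ⁻¹' (N ∩ {x | x ∈ frontier K → ∃ y ∈ {y : Pt e |
        (Fin.cons 0 y : Pt (e + 1)) ∈ Ψ.source}, y ∈ S ∧ polyMap Q y + l = x}) ∈ 𝓝 z₀ := by
    refine inter_mem (inter_mem (Ψ.open_source.mem_nhds hz₀s) ?_) ?_
    · refine (hP.isOpen.preimage continuous_tail).mem_nhds ?_
      simpa [hz₀] using hy₀
    · refine hcolc.continuousAt.preimage_mem_nhds ?_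
      rw [hz₀, hcol0]
      exact inter_mem hN (hloc _ hV)
  -- A closed box is needed: later, injectivity on it makes functions supported in the open collar
  -- vanish at the bottom `-h`.
  obtain ⟨h, hh, hbox⟩ := Metric.nhds_basis_closedBall.mem_iff.1 hW
  have hbox' := Metric.ball_subset_closedBall.trans hbox
  have hsrc : Metric.ball z₀ h ⊆ Ψ.source := fun z hz => (hbox' hz).1.1
  have hcons : ∀ y ∈ Metric.ball y₀ h, (Fin.cons 0 y : Pt (e + 1)) ∈ Metric.ball z₀ h := by
    intro y hy
    rw [mem_ball_cons hh, Fin.cons_zero, Fin.tail_cons]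
    exact ⟨⟨by linarith, hh⟩, hy⟩
  have hballS : Metric.ball y₀ h ⊆ S := fun y hy => by
    have := (hbox' (hcons y hy)).1.2
    rwa [mem_preimage, Fin.tail_cons] at this
  have hnc : ∀ y ∈ Metric.ball y₀ h, n y ⬝ᵥ c ≠ 0 := by
    intro y hy
    have := hΨdet _ (hsrc (hcons y hy))
    rw [Fin.tail_cons] at this
    exact (hdetne y (hballS hy)).1 this
  have hopen : IsOpen (collar Q l c '' Metric.ball z₀ h) := by
    rw [← hΨ]
    exact Ψ.isOpen_image_of_subset_source Metric.isOpen_ball hsrc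
  have hfr : ∀ z ∈ Metric.ball z₀ h, collar Q l c z ∈ frontier K ↔ z 0 = 0 := by
    intro z hz
    constructor
    · intro hzf
      obtain ⟨y, hy1, hy2, hy3⟩ := (hbox' hz).2.2 hzf
      rw [← hcol0 y, ← hΨ] at hy3
      rw [← Ψ.injOn hy1 (hsrc hz) hy3, Fin.cons_zero]
    · intro hz0
      have : z = (Fin.cons 0 (Fin.tail z : Pt e) : Pt (e + 1)) := by
        rw [← hz0]; exact (Fin.cons_self_tail z).symm
      rw [this, hcol0]
      exact hP.mem_frontier _ (hballS ((mem_ball_cons hh z).1 hz).2)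
  -- A half box is connected and its image avoids the frontier, so one point in `K` puts all of it
  -- in `K`.
  have hhalf : ∀ H : Set (Pt (e + 1)), Convex ℝ H → (∀ z ∈ H, z 0 ≠ 0) →
      (∃ z ∈ Metric.ball z₀ h ∩ H, collar Q l c z ∈ K) →
      ∀ z ∈ Metric.ball z₀ h ∩ H, collar Q l c z ∈ K := by
    intro H hH hH0 ⟨z, hz, hzK⟩ z' hz'
    by_contra hcon
    have hpre : IsPreconnected (collar Q l c '' (Metric.ball z₀ h ∩ H)) :=
      ((convex_ball z₀ h).inter hH).isPreconnected.image _ hcolc.continuousOn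
    have key : collar Q l c '' (Metric.ball z₀ h ∩ H) ⊆ K ∪ (closure K)ᶜ →
        collar Q l c z' ∈ K := fun hu =>
      hpre.subset_left_of_subset_union hP.isOpen_domain isClosed_closure.isOpen_compl
        (disjoint_compl_right.mono_left subset_closure) hu ⟨_, ⟨z, hz, rfl⟩, hzK⟩
        (mem_image_of_mem _ hz')
    refine hcon (key ?_)
    rintro _ ⟨w, hw, rfl⟩
    by_contra hcon2
    rw [mem_union, not_or, notMem_compl_iff] at hcon2
    refine hH0 w hw.2 ((hfr w hw.1).1 ?_)
    rw [hP.isOpen_domain.frontier_eq]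
    exact ⟨hcon2.2, hcon2.1⟩
  have hconvneg : Convex ℝ {z : Pt (e + 1) | z 0 < 0} :=
    convex_halfSpace_lt ⟨fun _ _ => rfl, fun _ _ => rfl⟩ 0
  have hconvpos : Convex ℝ {z : Pt (e + 1) | 0 < z 0} :=
    convex_halfSpace_gt ⟨fun _ _ => rfl, fun _ _ => rfl⟩ 0
  have hside : ∀ y ∈ Metric.ball y₀ h, ∃ z ∈ Metric.ball z₀ h,
      collar Q l c z ∈ K ∧ z 0 * (n y ⬝ᵥ c) < 0 := fun y hy =>
    exists_collar_mem_of_outward hΨ hΨs (Metric.isOpen_ball.mem_nhds (hcons y hy)) hsrc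
      (hP.unit y (hballS hy)) (hP.orthogonal y (hballS hy))
      (hP.outward y (hballS hy))
  have hy₀b : y₀ ∈ Metric.ball y₀ h := Metric.mem_ball_self hh
  have hneg : ∀ z ∈ Metric.ball z₀ h, z 0 < 0 → collar Q l c z ∈ K := by
    obtain ⟨z, hz, hzK, hz0⟩ := hside y₀ hy₀b
    have hz0' : z 0 < 0 := by
      by_contra hcon
      exact absurd (mul_nonneg (not_lt.1 hcon) hc.le) (not_le.2 hz0)
    intro z' hz' hz'0
    exact hhalf _ hconvneg (fun w hw => ne_of_lt hw) ⟨z, ⟨hz, hz0'⟩, hzK⟩ z' ⟨hz', hz'0⟩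
  -- If the upper half also met `K`, the whole collar would lie in the closure of `K`, contradicting
  -- `regular`.
  have hpos : ∀ z ∈ Metric.ball z₀ h, 0 < z 0 → collar Q l c z ∉ K := by
    intro z hz hz0 hzK
    have hall := hhalf _ hconvpos (fun w hw => ne_of_gt hw) ⟨z, ⟨hz, hz0⟩, hzK⟩
    have hx₀ : collar Q l c z₀ ∈ closure (closure K)ᶜ :=
      hP.regular ((hfr z₀ (Metric.mem_ball_self hh)).2 (by rw [hz₀, Fin.cons_zero]))
    obtain ⟨_, ⟨w, hw, rfl⟩, hwK⟩ := mem_closure_iff.1 hx₀ _ hopen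
      ⟨z₀, Metric.mem_ball_self hh, rfl⟩
    rcases lt_trichotomy (w 0) 0 with hw0 | hw0 | hw0
    · exact hwK (subset_closure (hneg w hw hw0))
    · exact hwK (frontier_subset_closure ((hfr w hw).2 hw0))
    · exact hwK (subset_closure (hall w ⟨hw, hw0⟩))
  refine ⟨h, hh, ?_, hopen, ?_, hballS, ?_, ?_⟩
  · rw [← hΨ]
    exact Ψ.injOn.mono fun z hz => (hbox hz).1.1
  · rintro _ ⟨z, hz, rfl⟩
    exact (hbox' hz).2.1
  · intro y hy
    -- No continuity of `n` is assumed. A negative `n · c` would put a point of `K` in the upper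
    -- half.
    refine lt_of_le_of_ne ?_ (hnc y hy).symm
    by_contra hcon
    obtain ⟨z, hz, hzK, hz0⟩ := hside y hy
    refine hpos z hz ?_ hzK
    by_contra hcon2
    exact absurd (mul_nonneg_of_nonpos_of_nonpos (not_lt.1 hcon2) (not_le.1 hcon).le)
      (not_le.2 hz0)
  · intro z hz
    refine ⟨fun hzK => ?_, hneg z hz⟩
    rcases lt_trichotomy (z 0) 0 with hz0 | hz0 | hz0
    · exact hz0
    · have := (hfr z hz).2 hz0
      rw [hP.isOpen_domain.frontier_eq] at this
      exact absurd hzK this.2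
    · exact absurd hzK (hpos z hz hz0)

end EulerHDG

/-! ### Integration in a collar -/

namespace EulerHDG

variable {e : ℕ} {Q : Fin (e + 1) → MvPolynomial (Fin e) ℝ} {l : Pt (e + 1)} {S : Set (Pt e)}
  {n : Pt e → Pt (e + 1)} {K : Set (Pt (e + 1))}

lemma continuous_det_consCol (Q : Fin (e + 1) → MvPolynomial (Fin e) ℝ) (c : Pt (e + 1)) :
    Continuous fun y : Pt e => (consCol c (polyJac Q y)).det := by
  refine Continuous.matrix_det (continuous_pi fun i => continuous_pi fun j => ?_)
  refine Fin.cases ?_ (fun j => ?_) j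
  · exact continuous_const
  · exact (continuous_apply j).comp ((continuous_apply i).comp (continuous_polyJac Q))

/-- The fundamental theorem of calculus in a collar. -/
lemma IsBoundaryPatch.integral_fderiv_collar (hP : IsBoundaryPatch Q l S n K) {c : Pt (e + 1)}
    {y₀ : Pt e} {h : ℝ} (hh : 0 < h)
    (hinj : InjOn (collar Q l c) (Metric.closedBall (Fin.cons 0 y₀ : Pt (e + 1)) h))
    (hS : Metric.ball y₀ h ⊆ S) (hpos : ∀ y ∈ Metric.ball y₀ h, 0 < n y ⬝ᵥ c)
    (hside : ∀ z ∈ Metric.ball (Fin.cons 0 y₀ : Pt (e + 1)) h, collar Q l c z ∈ K ↔ z 0 < 0)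
    {g : Pt (e + 1) → ℝ} (hg : ContDiff ℝ 1 g)
    (hsupp : tsupport g ⊆ collar Q l c '' Metric.ball (Fin.cons 0 y₀ : Pt (e + 1)) h) :
    ∫ x in K, fderiv ℝ g x c = ∫ y in Metric.ball y₀ h, g (polyMap Q y + l) *
      ((n y ⬝ᵥ c) * √((polyJac Q y)ᵀ * polyJac Q y).det) := by
  set z₀ : Pt (e + 1) := Fin.cons 0 y₀ with hz₀
  set Φ := collar Q l c with hΦ
  set D : Pt e → ℝ := fun y => (consCol c (polyJac Q y)).det with hD
  have hDc : Continuous D := continuous_det_consCol Q c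
  have hΦc : Continuous Φ := (contDiff_collar Q l c (n := 0)).continuous
  set B : Set (Pt (e + 1)) := Metric.ball z₀ h ∩ {z | z 0 < 0} with hB
  have hBm : MeasurableSet B :=
    measurableSet_ball.inter (measurableSet_lt (measurable_pi_apply 0) measurable_const)
  have hsub : Φ '' B ⊆ K := by
    rintro _ ⟨z, hz, rfl⟩
    exact (hside z hz.1).2 hz.2
  -- Within the support of `g`, the domain is the lower half of the collar.
  have h1 : ∫ x in K, fderiv ℝ g x c = ∫ x in Φ '' B, fderiv ℝ g x c := by
    refine setIntegral_eq_of_subset_of_forall_sdiff_eq_zero hP.isOpen_domain.measurableSet hsub ?_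
    rintro x ⟨hxK, hxB⟩
    have : x ∉ tsupport g := by
      intro hx
      obtain ⟨z, hz, rfl⟩ := hsupp hx
      exact hxB ⟨z, ⟨hz, (hside z hz).1 hxK⟩, rfl⟩
    have h0 : fderiv ℝ g x = 0 := by
      by_contra hne
      exact this (support_fderiv_subset ℝ hne)
    rw [h0, zero_apply]
  have h2 : ∫ x in Φ '' B, fderiv ℝ g x c =
      ∫ z in B, |D (Fin.tail z)| * fderiv ℝ g (Φ z) c := by
    rw [integral_image_eq_integral_abs_det_fderiv_smul volume hBm
      (fun z _ => (hasFDerivAt_collar Q l c z).hasFDerivWithinAt)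
      (hinj.mono (inter_subset_left.trans Metric.ball_subset_closedBall))]
    simp only [det_mulVecLin, smul_eq_mul, hD, hΦ]
  have hfc : Continuous (fun z => |D (Fin.tail z)| * fderiv ℝ g (Φ z) c) :=
    ((hDc.comp continuous_tail).abs).mul
      (((hg.continuous_fderiv (by simp)).comp hΦc).clm_apply continuous_const)
  -- Splits off the collar coordinate. The Jacobian depends only on `y`, so the inner integral is a
  -- plain derivative along `c`.
  let τ : Pt (e + 1) ≃ᵐ ℝ × Pt e := MeasurableEquiv.piFinSuccAbove (fun _ => ℝ) 0
  have hτ : MeasurePreserving τ := volume_preserving_piFinSuccAbove (fun _ => ℝ) 0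
  have hτs : ∀ q : ℝ × Pt e, τ.symm q = (Fin.cons q.1 q.2 : Pt (e + 1)) := by
    intro q
    exact Fin.insertNth_zero' (β := ℝ) q.1 q.2
  have hpre : τ.symm ⁻¹' B = Ioo (-h) 0 ×ˢ Metric.ball y₀ h := by
    ext q
    rw [mem_preimage, hτs, hB, mem_inter_iff, hz₀, mem_ball_cons hh]
    simp only [Fin.cons_zero, Fin.tail_cons, mem_ofPred_eq, mem_prod, mem_Ioo]
    constructor
    · rintro ⟨⟨⟨a, b⟩, c⟩, d⟩
      exact ⟨⟨a, d⟩, c⟩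
    · rintro ⟨⟨a, d⟩, c⟩
      exact ⟨⟨⟨a, by linarith⟩, c⟩, d⟩
  have h3 : ∫ z in B, |D (Fin.tail z)| * fderiv ℝ g (Φ z) c =
      ∫ q in Ioo (-h) 0 ×ˢ Metric.ball y₀ h,
        |D q.2| * fderiv ℝ g (polyMap Q q.2 + l + q.1 • c) c := by
    rw [← hpre, ← (hτ.symm τ).setIntegral_preimage_emb τ.symm.measurableEmbedding]
    refine integral_congr_ae (Eventually.of_forall fun q => ?_)
    simp only [hτs, Fin.tail_cons, hΦ, collar_cons]
  have hqc : Continuous (fun q : Pt e × ℝ =>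
      |D q.1| * fderiv ℝ g (polyMap Q q.1 + l + q.2 • c) c) := by
    refine ((hDc.comp continuous_fst).abs).mul
      (((hg.continuous_fderiv (by simp)).comp ?_).clm_apply continuous_const)
    have := continuous_polyMap Q
    fun_prop
  have h4 : ∫ q in Ioo (-h) 0 ×ˢ Metric.ball y₀ h,
        |D q.2| * fderiv ℝ g (polyMap Q q.2 + l + q.1 • c) c =
      ∫ y in Metric.ball y₀ h, ∫ r in Ioo (-h) 0,
        |D y| * fderiv ℝ g (polyMap Q y + l + r • c) c := by
    rw [Measure.volume_eq_prod, ← setIntegral_prod_swap, setIntegral_prod]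
    · rfl
    · refine IntegrableOn.mono_set (t := Metric.closedBall y₀ h ×ˢ Icc (-h) 0) ?_
        (prod_mono Metric.ball_subset_closedBall Ioo_subset_Icc_self)
      exact hqc.continuousOn.integrableOn_compact
        ((isCompact_closedBall y₀ h).prod isCompact_Icc)
  rw [h1, h2, h3, h4]
  refine setIntegral_congr_fun measurableSet_ball fun y hy => ?_
  have hder : ∀ r : ℝ, HasDerivAt (fun r : ℝ => g (polyMap Q y + l + r • c))
      (fderiv ℝ g (polyMap Q y + l + r • c) c) r := by
    intro r
    have hl : HasDerivAt (fun r : ℝ => polyMap Q y + l + r • c) c r := by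
      simpa using ((hasDerivAt_id r).smul_const c).const_add (polyMap Q y + l)
    exact ((hg.differentiable (by simp) _).hasFDerivAt).comp_hasDerivAt r hl
  have hftc : ∫ r in Ioo (-h) 0, fderiv ℝ g (polyMap Q y + l + r • c) c =
      g (polyMap Q y + l) - g (polyMap Q y + l + (-h) • c) := by
    rw [← integral_Ioc_eq_integral_Ioo, ← intervalIntegral.integral_of_le (by linarith),
      intervalIntegral.integral_eq_sub_of_hasDerivAt (fun r _ => hder r)]
    · simp
    · refine Continuous.intervalIntegrable ?_ _ _
      exact ((hg.continuous_fderiv (by simp)).comp (by fun_prop)).clm_apply continuous_const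
  -- The bottom point lies in the closed box but not in the open one, hence by injectivity outside
  -- the support.
  have hz : g (polyMap Q y + l + (-h) • c) = 0 := by
    by_contra hne
    obtain ⟨z, hz, hze⟩ := hsupp (subset_tsupport g hne)
    rw [← collar_cons] at hze
    have hmem : (Fin.cons (-h) y : Pt (e + 1)) ∈ Metric.closedBall z₀ h := by
      rw [hz₀, mem_closedBall_cons hh.le, Fin.cons_zero, Fin.tail_cons]
      exact ⟨⟨le_rfl, by linarith⟩, Metric.ball_subset_closedBall hy⟩
    rw [hinj (Metric.ball_subset_closedBall hz) hmem hze, hz₀, mem_ball_cons hh] at hz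
    simp at hz
  have habs := abs_det_consCol c (hP.unit y (hS hy)) (hP.orthogonal y (hS hy))
    (hP.nonsingular y (hS hy))
  rw [abs_of_pos (hpos y hy)] at habs
  rw [integral_const_mul, hftc, hz, sub_zero, ← habs, mul_comm]

end EulerHDG

/-! ### Faces of an element -/

namespace EulerHDG
namespace Mesh

variable {e p : ℕ} {Λ : Submodule ℤ (Pt (e + 1))} {Ω : Set (Pt (e + 1))} (T : Mesh e p Λ Ω)

/-- The parametrization of a face as a part of the boundary of the element on side `s`. -/
noncomputable def sideMap (F : Fin T.numFace) (s : Bool) (y : Pt e) : Pt (e + 1) :=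
  polyMap (T.faceMap F) y + T.shift F s

/-- The union of the relative boundaries of the faces of an element. -/
def edgeSet (K : Fin T.numElem) : Set (Pt (e + 1)) :=
  ⋃ (F : Fin T.numFace) (s : Bool) (_ : T.adj F s = K), T.sideMap F s '' frontier T.Fref

lemma contDiff_sideMap (F : Fin T.numFace) (s : Bool) {n : WithTop ℕ∞} :
    ContDiff ℝ n (T.sideMap F s) := (contDiff_polyMap _).add contDiff_const

lemma continuous_sideMap (F : Fin T.numFace) (s : Bool) : Continuous (T.sideMap F s) :=
  (T.contDiff_sideMap F s (n := 0)).continuous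

lemma isCompact_frontier_Fref : IsCompact (frontier T.Fref) :=
  T.Fref_polytope.isCompact_closure.of_isClosed_subset isClosed_frontier frontier_subset_closure

lemma isCompact_edgeSet (K : Fin T.numElem) : IsCompact (T.edgeSet K) :=
  isCompact_iUnion fun F => isCompact_iUnion fun s => isCompact_iUnion fun _ =>
    T.isCompact_frontier_Fref.image (T.continuous_sideMap F s)

lemma mem_edgeSet {K : Fin T.numElem} {x : Pt (e + 1)} : x ∈ T.edgeSet K ↔
    ∃ F s, T.adj F s = K ∧ ∃ y ∈ frontier T.Fref, T.sideMap F s y = x := by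
  simp only [edgeSet, mem_iUnion, mem_image, exists_prop]

lemma sideMap_mem_frontier {F : Fin T.numFace} {s : Bool} {y : Pt e} (hy : y ∈ closure T.Fref) :
    T.sideMap F s y ∈ frontier (T.elem (T.adj F s)) := T.face_subset F s y hy

lemma sideMap_mem_closedElem {F : Fin T.numFace} {s : Bool} {y : Pt e}
    (hy : y ∈ closure T.Fref) : T.sideMap F s y ∈ T.closedElem (T.adj F s) :=
  T.frontier_subset_closedElem _ (T.sideMap_mem_frontier hy)

lemma edgeSet_subset_frontier (K : Fin T.numElem) : T.edgeSet K ⊆ frontier (T.elem K) := by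
  intro x hx
  obtain ⟨F, s, rfl, y, hy, rfl⟩ := T.mem_edgeSet.1 hx
  exact T.sideMap_mem_frontier (frontier_subset_closure hy)

lemma isBoundaryPatch (F : Fin T.numFace) (s : Bool) :
    IsBoundaryPatch (T.faceMap F) (T.shift F s) T.Fref (T.normal F s)
      (T.elem (T.adj F s)) where
  isOpen := T.Fref_polytope.isOpen
  isOpen_domain := T.isOpen_elem _
  regular := by
    rw [T.closure_elem]
    exact T.frontier_elem_subset_closure_compl _
  nonsingular y hy := T.faceMap_nonsingular F y (subset_closure hy)
  mem_frontier y hy := T.face_subset F s y (subset_closure hy)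
  unit := T.normal_unit F s
  orthogonal := T.normal_orthogonal F s
  outward := T.normal_outward F s

lemma mem_Fref_of_notMem_edgeSet {F : Fin T.numFace} {s : Bool} {y : Pt e}
    (hy : y ∈ closure T.Fref) (hx : T.sideMap F s y ∉ T.edgeSet (T.adj F s)) : y ∈ T.Fref := by
  by_contra hcon
  refine hx (T.mem_edgeSet.2 ⟨F, s, rfl, y, ?_, rfl⟩)
  rw [T.Fref_polytope.isOpen.frontier_eq]
  exact ⟨hy, hcon⟩

/-- Away from the edges, a boundary point lies on only one face of the element. -/
lemma face_eq_of_sideMap_eq {F F' : Fin T.numFace} {s s' : Bool} (hadj : T.adj F' s' = T.adj F s)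
    {y y' : Pt e} (hy : y ∈ T.Fref) (hy' : y' ∈ closure T.Fref)
    (hx : T.sideMap F s y ∉ T.edgeSet (T.adj F s)) (heq : T.sideMap F' s' y' = T.sideMap F s y) :
    F' = F ∧ s' = s := by
  have hy'F : y' ∈ T.Fref := T.mem_Fref_of_notMem_edgeSet hy' (by rw [heq, hadj]; exact hx)
  by_contra hne
  -- The two sides of one face may belong to the same element, but then `sides_ne` makes the shifts
  -- differ.
  have hcond : F ≠ F' ∨ T.shift F' s' - T.shift F s ≠ 0 := by
    by_cases hF : F = F'
    · right
      subst hF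
      intro h0
      have hs : s' ≠ s := fun h => hne ⟨rfl, h⟩
      have hpair : (T.adj F s', T.shift F s') = (T.adj F s, T.shift F s) :=
        Prod.ext hadj (sub_eq_zero.1 h0)
      have := T.sides_ne F
      cases s <;> cases s' <;> simp_all
    · exact Or.inl hF
  have hdis := T.face_disjoint F F' (T.shift F' s' - T.shift F s)
    (Λ.sub_mem (T.shift_mem F' s') (T.shift_mem F s)) hcond
  refine disjoint_left.1 hdis ⟨y, hy, rfl⟩ ⟨_, ⟨y', hy'F, rfl⟩, ?_⟩
  simp only [sideMap] at heq
  simp only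
  rw [← add_sub_assoc, heq, add_sub_cancel_right]

/-- The other closed face has compact image missing this non-edge point, so it misses a
neighbourhood. -/
lemma eventually_notMem_otherFace {F F' : Fin T.numFace} {s s' : Bool}
    (hadj : T.adj F' s' = T.adj F s) (hne : ¬(F' = F ∧ s' = s)) {y : Pt e} (hy : y ∈ T.Fref)
    (hx : T.sideMap F s y ∉ T.edgeSet (T.adj F s)) :
    ∀ᶠ x in 𝓝 (T.sideMap F s y), ∀ y' ∈ closure T.Fref, T.sideMap F' s' y' ≠ x := by
  have hc : IsClosed (T.sideMap F' s' '' closure T.Fref) :=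
    (T.Fref_polytope.isCompact_closure.image (T.continuous_sideMap F' s')).isClosed
  have hnot : T.sideMap F s y ∉ T.sideMap F' s' '' closure T.Fref := by
    rintro ⟨y', hy', heq⟩
    exact hne (T.face_eq_of_sideMap_eq hadj hy hy' hx heq)
  filter_upwards [hc.isOpen_compl.mem_nhds hnot] with x hx' y' hy' heq
  exact hx' ⟨y', hy', heq⟩

/-- Continuity of the inverse parametrization, from injectivity on a compact set. -/
lemma eventually_param_mem (F : Fin T.numFace) (s : Bool) {y : Pt e} (hy : y ∈ closure T.Fref)
    {V : Set (Pt e)} (hV : V ∈ 𝓝 y) :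
    ∀ᶠ x in 𝓝 (T.sideMap F s y), ∀ y' ∈ closure T.Fref, T.sideMap F s y' = x → y' ∈ V := by
  have hc : IsClosed (T.sideMap F s '' (closure T.Fref \ interior V)) :=
    ((T.Fref_polytope.isCompact_closure.diff isOpen_interior).image
      (T.continuous_sideMap F s)).isClosed
  have hnot : T.sideMap F s y ∉ T.sideMap F s '' (closure T.Fref \ interior V) := by
    rintro ⟨y', ⟨hy', hyV⟩, heq⟩
    rw [T.faceMap_injOn F hy' hy (add_right_cancel heq)] at hyV
    exact hyV (mem_interior_iff_mem_nhds.2 hV)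
  filter_upwards [hc.isOpen_compl.mem_nhds hnot] with x hx' y' hy' heq
  by_contra hcon
  exact hx' ⟨y', ⟨hy', fun h => hcon (interior_subset h)⟩, heq⟩

/-- Finitely many closed faces cover the element boundary. Away from the edges all others keep their
distance, and points of this face have nearby parameters. -/
lemma exhaustsFrontier {F : Fin T.numFace} {s : Bool} {y : Pt e} (hy : y ∈ T.Fref)
    (hx : T.sideMap F s y ∉ T.edgeSet (T.adj F s)) :
    ExhaustsFrontier (T.faceMap F) (T.shift F s) T.Fref (T.elem (T.adj F s)) y := by
  intro V hV
  have h1 : ∀ᶠ x in 𝓝 (T.sideMap F s y), ∀ F' s', T.adj F' s' = T.adj F s →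
      ¬(F' = F ∧ s' = s) → ∀ y' ∈ closure T.Fref, T.sideMap F' s' y' ≠ x := by
    rw [eventually_all]; intro F'
    rw [eventually_all]; intro s'
    rw [eventually_imp_distrib_left]; intro hadj
    rw [eventually_imp_distrib_left]; intro hne
    exact T.eventually_notMem_otherFace hadj hne hy hx
  have h2 := T.eventually_param_mem F s (subset_closure hy)
    (inter_mem hV (T.Fref_polytope.isOpen.mem_nhds hy))
  change ∀ᶠ x in 𝓝 (T.sideMap F s y), _
  filter_upwards [h1, h2] with x hx1 hx2 hxf
  obtain ⟨F', s', hadj, y', hy', heq⟩ := T.boundary_cover _ x hxf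
  by_cases hne : F' = F ∧ s' = s
  · obtain ⟨rfl, rfl⟩ := hne
    obtain ⟨h3, h4⟩ := hx2 y' hy' heq
    exact ⟨y', h3, h4, heq⟩
  · exact absurd heq (hx1 F' s' hadj hne y' hy')

/-- Almost no point of a face is an edge point of the element. -/
lemma volume_edge_preimage (F : Fin T.numFace) (s : Bool) :
    volume (T.Fref ∩ T.sideMap F s ⁻¹' T.edgeSet (T.adj F s)) = 0 := by
  refine measure_null_of_locally_null _ fun y₀ hy₀ => ?_
  have hP := T.isBoundaryPatch F s
  have hdet : (consCol (T.normal F s y₀) (polyJac (T.faceMap F) y₀)).det ≠ 0 := by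
    have h1 := det_consCol_mul (T.normal F s y₀) (T.normal F s y₀) _ (hP.orthogonal y₀ hy₀.1)
    rw [hP.unit y₀ hy₀.1, one_mul] at h1
    intro h0
    rw [h0, zero_mul] at h1
    exact hP.nonsingular y₀ hy₀.1 h1.symm
  obtain ⟨Ψ, hΨ, hz₀, -, hΨs⟩ := exists_collarHomeomorph (T.faceMap F) (T.shift F s) hdet
  refine ⟨T.Fref ∩ T.sideMap F s ⁻¹' T.edgeSet (T.adj F s) ∩
    {y | (Fin.cons 0 y : Pt (e + 1)) ∈ Ψ.source}, inter_mem self_mem_nhdsWithin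
    (mem_nhdsWithin_of_mem_nhds ((Ψ.open_source.preimage continuous_cons_zero).mem_nhds hz₀)), ?_⟩
  -- The inverse of a normal collar followed by `Fin.tail` is a `C^1` retraction onto the parameter
  -- space. Edge parameters are thus `C^1` images, between spaces of equal dimension, of the null
  -- set `frontier T.Fref`.
  refine measure_mono_null (t := ⋃ (F' : Fin T.numFace) (s' : Bool),
    (fun y' => (Fin.tail (Ψ.symm (T.sideMap F' s' y')) : Pt e)) ''
      (frontier T.Fref ∩ T.sideMap F' s' ⁻¹' Ψ.target)) ?_ ?_
  · rintro y ⟨⟨-, hyE⟩, hys⟩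
    obtain ⟨F', s', -, y', hy', heq⟩ := T.mem_edgeSet.1 hyE
    have hcol : Ψ (Fin.cons 0 y : Pt (e + 1)) = T.sideMap F s y := by
      rw [hΨ, collar_cons, zero_smul, add_zero, sideMap]
    refine mem_iUnion₂.2 ⟨F', s', y', ⟨hy', ?_⟩, ?_⟩
    · rw [mem_preimage, heq, ← hcol]
      exact Ψ.map_source hys
    · simp only
      rw [heq, ← hcol, Ψ.left_inv hys, Fin.tail_cons]
  · refine measure_iUnion_null fun F' => measure_iUnion_null fun s' => ?_
    refine addHaar_image_eq_zero_of_differentiableOn_of_addHaar_eq_zero _ ?_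
      (measure_mono_null inter_subset_left (T.Fref_polytope.convex.addHaar_frontier _))
    have h1 : DifferentiableOn ℝ (Ψ.symm ∘ T.sideMap F' s')
        (frontier T.Fref ∩ T.sideMap F' s' ⁻¹' Ψ.target) :=
      (hΨs.differentiableOn (by simp)).comp
        ((T.contDiff_sideMap F' s' (n := 1)).differentiable (by simp)).differentiableOn
        fun y hy => hy.2
    exact ((contDiff_tail (n := 1)).differentiable (by simp)).comp_differentiableOn h1

/-- The normal is given pointwise only, but where `n · c > 0` this product is `|det (c | J)|`, which
is continuous. The general case follows by linearity in `c`. -/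
lemma continuousAt_normal_mul_surfElt {F : Fin T.numFace} {s : Bool} {y₀ : Pt e}
    (hy₀ : y₀ ∈ T.Fref) (hx : T.sideMap F s y₀ ∉ T.edgeSet (T.adj F s)) (c : Pt (e + 1)) :
    ContinuousAt (fun y => (T.normal F s y ⬝ᵥ c) * T.surfElt F y) y₀ := by
  have hP := T.isBoundaryPatch F s
  have hpos : ∀ c, 0 < T.normal F s y₀ ⬝ᵥ c →
      ContinuousAt (fun y => (T.normal F s y ⬝ᵥ c) * T.surfElt F y) y₀ := by
    intro c hc
    obtain ⟨h, hh, -, -, -, hS, hb, -⟩ := hP.exists_collar_box hy₀ hc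
      (T.exhaustsFrontier hy₀ hx) univ_mem
    refine ((continuous_det_consCol (T.faceMap F) c).abs.continuousAt).congr ?_
    filter_upwards [Metric.ball_mem_nhds y₀ hh] with y hy
    rw [abs_det_consCol c (hP.unit y (hS hy)) (hP.orthogonal y (hS hy))
      (hP.nonsingular y (hS hy)), abs_of_pos (hb y hy), surfElt]
  set n₀ := T.normal F s y₀
  have hn₀ : n₀ ⬝ᵥ n₀ = 1 := hP.unit y₀ hy₀
  -- Chosen so that `c + a n₀` is strictly outward at `y₀`.
  set a : ℝ := |n₀ ⬝ᵥ c| + 1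
  have h1 := hpos (c + a • n₀) (by
    rw [dotProduct_add, dotProduct_smul, hn₀, smul_eq_mul, mul_one]
    have := neg_abs_le (n₀ ⬝ᵥ c)
    simp only [a]; linarith)
  have h2 := hpos n₀ (by rw [hn₀]; exact one_pos)
  refine (h1.sub (h2.const_mul a)).congr (Eventually.of_forall fun y => ?_)
  simp only [Pi.sub_apply, dotProduct_add, dotProduct_smul, smul_eq_mul]
  ring

/-- Measurability comes from continuity off the null set of edge parameters, the bound from
`abs_det_consCol`. -/
lemma integrableOn_normal_mul_surfElt (F : Fin T.numFace) (s : Bool) (c : Pt (e + 1)) :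
    IntegrableOn (fun y => (T.normal F s y ⬝ᵥ c) * T.surfElt F y) T.Fref := by
  have hP := T.isBoundaryPatch F s
  have hbound : IntegrableOn (fun y => |(consCol c (polyJac (T.faceMap F) y)).det|) T.Fref :=
    ((continuous_det_consCol (T.faceMap F) c).abs.continuousOn.integrableOn_compact
      T.Fref_polytope.isCompact_closure).mono_set subset_closure
  have hFm : MeasurableSet T.Fref := T.Fref_polytope.isOpen.measurableSet
  refine hbound.mono' ?_ ?_
  · have hE : IsClosed (T.sideMap F s ⁻¹' T.edgeSet (T.adj F s)) :=
      (T.isCompact_edgeSet _).isClosed.preimage (T.continuous_sideMap F s)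
    have h1 : AEStronglyMeasurable (fun y => (T.normal F s y ⬝ᵥ c) * T.surfElt F y)
        (volume.restrict (T.Fref \ T.sideMap F s ⁻¹' T.edgeSet (T.adj F s))) := by
      refine ContinuousOn.aestronglyMeasurable (fun y hy => ?_) (hFm.diff hE.measurableSet)
      exact (T.continuousAt_normal_mul_surfElt hy.1 hy.2 c).continuousWithinAt
    have h2 : (T.Fref \ T.sideMap F s ⁻¹' T.edgeSet (T.adj F s) : Set (Pt e)) =ᵐ[volume]
        T.Fref := by
      rw [← sdiff_self_inter]
      exact sdiff_null_ae_eq_self (T.volume_edge_preimage F s)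
    rwa [Measure.restrict_congr_set h2] at h1
  · filter_upwards [ae_restrict_mem hFm] with y hy
    rw [abs_det_consCol c (hP.unit y hy) (hP.orthogonal y hy) (hP.nonsingular y hy),
      Real.norm_eq_abs, abs_mul, surfElt, abs_of_nonneg (Real.sqrt_nonneg _)]

end Mesh
end EulerHDG

/-! ### The divergence theorem away from the edges -/

open scoped Manifold ContDiff

namespace EulerHDG
namespace Mesh

variable {e p : ℕ} {Λ : Submodule ℤ (Pt (e + 1))} {Ω : Set (Pt (e + 1))} (T : Mesh e p Λ Ω)

/-- The flux of `g c` through the boundary of an element. -/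
noncomputable def bdryFlux (K : Fin T.numElem) (c : Pt (e + 1)) (g : Pt (e + 1) → ℝ) : ℝ :=
  ∑ F, ∑ s, if T.adj F s = K then
    ∫ y in T.Fref, g (T.sideMap F s y) * ((T.normal F s y ⬝ᵥ c) * T.surfElt F y) else 0

/-- The defect in the divergence theorem for the vector field `g c` on an element. -/
noncomputable def divDefect (K : Fin T.numElem) (c : Pt (e + 1)) (g : Pt (e + 1) → ℝ) : ℝ :=
  (∫ x in T.elem K, fderiv ℝ g x c) - T.bdryFlux K c g

lemma integrableOn_elem {f : Pt (e + 1) → ℝ} (K : Fin T.numElem)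
    (hf : ContinuousOn f (T.closedElem K)) : IntegrableOn f (T.elem K) :=
  (hf.integrableOn_compact (T.isCompact_closedElem K)).mono_set (T.elem_subset_closedElem K)

lemma integrableOn_mul_of_continuousOn {f w : Pt e → ℝ} (hf : ContinuousOn f (closure T.Fref))
    (hw : IntegrableOn w T.Fref) : IntegrableOn (fun y => f y * w y) T.Fref := by
  have hFm : MeasurableSet T.Fref := T.Fref_polytope.isOpen.measurableSet
  obtain ⟨C, hC⟩ := T.Fref_polytope.isCompact_closure.exists_bound_of_continuousOn hf
  refine Integrable.bdd_mul (c := C) hw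
    ((hf.mono subset_closure).aestronglyMeasurable hFm) ?_
  filter_upwards [ae_restrict_mem hFm] with y hy
  exact hC y (subset_closure hy)

lemma integrableOn_bdryFlux {g : Pt (e + 1) → ℝ} (hg : Continuous g) (F : Fin T.numFace)
    (s : Bool) (c : Pt (e + 1)) :
    IntegrableOn (fun y => g (T.sideMap F s y) * ((T.normal F s y ⬝ᵥ c) * T.surfElt F y))
      T.Fref :=
  T.integrableOn_mul_of_continuousOn (hg.comp (T.continuous_sideMap F s)).continuousOn
    (T.integrableOn_normal_mul_surfElt F s c)

lemma integrableOn_fderiv {g : Pt (e + 1) → ℝ} (hg : ContDiff ℝ 1 g) (K : Fin T.numElem)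
    (c : Pt (e + 1)) : IntegrableOn (fun x => fderiv ℝ g x c) (T.elem K) :=
  T.integrableOn_elem K ((hg.continuous_fderiv (by simp)).clm_apply continuous_const).continuousOn

lemma bdryFlux_add (K : Fin T.numElem) (c : Pt (e + 1)) {g g' : Pt (e + 1) → ℝ}
    (hg : Continuous g) (hg' : Continuous g') :
    T.bdryFlux K c (fun x => g x + g' x) = T.bdryFlux K c g + T.bdryFlux K c g' := by
  simp only [bdryFlux, ← Finset.sum_add_distrib]
  refine Finset.sum_congr rfl fun F _ => Finset.sum_congr rfl fun s _ => ?_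
  split_ifs
  · rw [← integral_add (T.integrableOn_bdryFlux hg F s c) (T.integrableOn_bdryFlux hg' F s c)]
    simp only [add_mul]
  · rw [add_zero]

lemma divDefect_add (K : Fin T.numElem) (c : Pt (e + 1)) {g g' : Pt (e + 1) → ℝ}
    (hg : ContDiff ℝ 1 g) (hg' : ContDiff ℝ 1 g') :
    T.divDefect K c (fun x => g x + g' x) = T.divDefect K c g + T.divDefect K c g' := by
  rw [divDefect, T.bdryFlux_add K c hg.continuous hg'.continuous, divDefect, divDefect]
  have : ∀ x, fderiv ℝ (fun x => g x + g' x) x c = fderiv ℝ g x c + fderiv ℝ g' x c := by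
    intro x
    rw [fderiv_fun_add (hg.differentiable (by simp) x) (hg'.differentiable (by simp) x),
      add_apply]
  simp only [this]
  rw [integral_add (T.integrableOn_fderiv hg K c) (T.integrableOn_fderiv hg' K c)]
  ring

lemma divDefect_zero (K : Fin T.numElem) (c : Pt (e + 1)) :
    T.divDefect K c (fun _ => 0) = 0 := by
  simp [divDefect, bdryFlux]

lemma divDefect_sum {ι : Type*} (K : Fin T.numElem) (c : Pt (e + 1)) (t : Finset ι)
    {g : ι → Pt (e + 1) → ℝ} (hg : ∀ i, ContDiff ℝ 1 (g i)) :
    T.divDefect K c (fun x => ∑ i ∈ t, g i x) = ∑ i ∈ t, T.divDefect K c (g i) := by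
  classical
  induction t using Finset.induction_on with
  | empty => simpa using T.divDefect_zero K c
  | insert i t hi ih =>
    simp only [Finset.sum_insert hi]
    rw [T.divDefect_add K c (hg i) (ContDiff.sum fun j _ => hg j), ih]

lemma divDefect_add_smul (K : Fin T.numElem) (c c' : Pt (e + 1)) (a : ℝ) {g : Pt (e + 1) → ℝ}
    (hg : ContDiff ℝ 1 g) :
    T.divDefect K (c + a • c') g = T.divDefect K c g + a * T.divDefect K c' g := by
  have h1 : ∫ x in T.elem K, fderiv ℝ g x (c + a • c') =
      (∫ x in T.elem K, fderiv ℝ g x c) + a * ∫ x in T.elem K, fderiv ℝ g x c' := by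
    simp only [map_add, map_smul, smul_eq_mul]
    rw [integral_add (T.integrableOn_fderiv hg K c) ((T.integrableOn_fderiv hg K c').const_mul a),
      integral_const_mul]
  have h2 : T.bdryFlux K (c + a • c') g = T.bdryFlux K c g + a * T.bdryFlux K c' g := by
    simp only [bdryFlux, Finset.mul_sum, ← Finset.sum_add_distrib]
    refine Finset.sum_congr rfl fun F _ => Finset.sum_congr rfl fun s _ => ?_
    split_ifs
    · rw [← integral_const_mul, ← integral_add (T.integrableOn_bdryFlux hg.continuous F s c)
        ((T.integrableOn_bdryFlux hg.continuous F s c').const_mul a)]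
      refine integral_congr_ae (Eventually.of_forall fun y => ?_)
      simp only [dotProduct_add, dotProduct_smul, smul_eq_mul]
      ring
    · rw [mul_zero, add_zero]
  rw [divDefect, h1, h2, divDefect, divDefect]
  ring

/-- For small supports only one face contributes, and only through parameters in one ball, so the
collar computation is the whole boundary flux. -/
lemma divDefect_eq_zero_of_face {F : Fin T.numFace} {s : Bool} {y₀ : Pt e}
    (hy₀ : y₀ ∈ T.Fref) (hx : T.sideMap F s y₀ ∉ T.edgeSet (T.adj F s)) {c : Pt (e + 1)}
    (hc : 0 < T.normal F s y₀ ⬝ᵥ c) :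
    ∃ N ∈ 𝓝 (T.sideMap F s y₀), ∀ g : Pt (e + 1) → ℝ, ContDiff ℝ 1 g → tsupport g ⊆ N →
      T.divDefect (T.adj F s) c g = 0 := by
  have hP := T.isBoundaryPatch F s
  obtain ⟨h, hh, hinj, hopen, -, hS, hpos, hside⟩ := hP.exists_collar_box hy₀ hc
    (T.exhaustsFrontier hy₀ hx) univ_mem
  set box := collar (T.faceMap F) (T.shift F s) c ''
    Metric.ball (Fin.cons 0 y₀ : Pt (e + 1)) h with hbox
  have hbox_mem : box ∈ 𝓝 (T.sideMap F s y₀) := by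
    refine hopen.mem_nhds ⟨_, Metric.mem_ball_self hh, ?_⟩
    rw [collar_cons, zero_smul, add_zero, sideMap]
  have hother : ∀ᶠ x in 𝓝 (T.sideMap F s y₀), ∀ F' s', T.adj F' s' = T.adj F s →
      ¬(F' = F ∧ s' = s) → ∀ y' ∈ closure T.Fref, T.sideMap F' s' y' ≠ x := by
    rw [eventually_all]; intro F'
    rw [eventually_all]; intro s'
    rw [eventually_imp_distrib_left]; intro hadj
    rw [eventually_imp_distrib_left]; intro hne
    exact T.eventually_notMem_otherFace hadj hne hy₀ hx
  have hown := T.eventually_param_mem F s (subset_closure hy₀) (Metric.ball_mem_nhds y₀ hh)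
  refine ⟨_, inter_mem hbox_mem (hother.and hown), fun g hg hsupp => ?_⟩
  have hvol := hP.integral_fderiv_collar hh hinj hS hpos hside hg
    (hsupp.trans inter_subset_left)
  have hN : ∀ x, g x ≠ 0 → _ := fun x hx => (hsupp (subset_tsupport g hx)).2
  have hflux : T.bdryFlux (T.adj F s) c g =
      ∫ y in T.Fref, g (T.sideMap F s y) * ((T.normal F s y ⬝ᵥ c) * T.surfElt F y) := by
    rw [bdryFlux, Finset.sum_eq_single F, Finset.sum_eq_single s, if_pos rfl]
    · intro s' _ hs'
      split_ifs with hadj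
      · refine setIntegral_eq_zero_of_forall_eq_zero fun y hy => ?_
        have : g (T.sideMap F s' y) = 0 := by
          by_contra hne
          exact (hN _ hne).1 F s' hadj (fun h => hs' h.2) y (subset_closure hy) rfl
        rw [this, zero_mul]
      · rfl
    · simp
    · intro F' _ hF'
      refine Finset.sum_eq_zero fun s' _ => ?_
      split_ifs with hadj
      · refine setIntegral_eq_zero_of_forall_eq_zero fun y hy => ?_
        have : g (T.sideMap F' s' y) = 0 := by
          by_contra hne
          exact (hN _ hne).1 F' s' hadj (fun h => hF' h.1) y (subset_closure hy) rfl
        rw [this, zero_mul]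
      · rfl
    · simp
  have hrestr : ∫ y in T.Fref, g (T.sideMap F s y) *
      ((T.normal F s y ⬝ᵥ c) * T.surfElt F y) =
      ∫ y in Metric.ball y₀ h, g (T.sideMap F s y) *
        ((T.normal F s y ⬝ᵥ c) * T.surfElt F y) := by
    refine setIntegral_eq_of_subset_of_forall_sdiff_eq_zero
      T.Fref_polytope.isOpen.measurableSet hS ?_
    rintro y ⟨hy, hyb⟩
    have : g (T.sideMap F s y) = 0 := by
      by_contra hne
      exact hyb ((hN _ hne).2 y (subset_closure hy) rfl)
    rw [this, zero_mul]
  rw [divDefect, hflux, hrestr]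
  exact sub_eq_zero.2 hvol

/-- The divergence theorem holds locally away from the edges. -/
lemma divDefect_eq_zero_locally {K : Fin T.numElem} {x : Pt (e + 1)} (hx : x ∉ T.edgeSet K)
    (c : Pt (e + 1)) :
    ∃ N ∈ 𝓝 x, ∀ g : Pt (e + 1) → ℝ, ContDiff ℝ 1 g → tsupport g ⊆ N →
      T.divDefect K c g = 0 := by
  by_cases hcl : x ∈ T.closedElem K
  · by_cases hK : x ∈ T.elem K
    · refine ⟨T.elem K, (T.isOpen_elem K).mem_nhds hK, fun g hg hsupp => ?_⟩
      have hcs : HasCompactSupport g :=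
        (T.isCompact_closedElem K).of_isClosed_subset (isClosed_tsupport g)
          (hsupp.trans (T.elem_subset_closedElem K))
      have h1 : ∫ x in T.elem K, fderiv ℝ g x c = 0 := by
        rw [setIntegral_eq_integral_of_forall_compl_eq_zero]
        · have hgi : Integrable g := hg.continuous.integrable_of_hasCompactSupport hcs
          have hdi : Integrable (fun x => fderiv ℝ g x c) :=
            ((hg.continuous_fderiv (by simp)).clm_apply
              continuous_const).integrable_of_hasCompactSupport
              (hcs.fderiv_apply (𝕜 := ℝ) c)
          -- Integration by parts against the constant `1`.
          have := integral_mul_fderiv_eq_neg_fderiv_mul_of_integrable (μ := volume)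
            (f := fun _ : Pt (e + 1) => (1 : ℝ)) (g := g) (v := c) (by simp)
            (by simpa using hdi) (by simpa using hgi) (fun _ _ => by fun_prop)
            (fun x _ => hg.differentiable (by simp) x)
          simpa using this
        · intro y hy
          have : fderiv ℝ g y = 0 := by
            by_contra hne
            exact hy (hsupp (support_fderiv_subset ℝ hne))
          rw [this, zero_apply]
      have h2 : T.bdryFlux K c g = 0 := by
        refine Finset.sum_eq_zero fun F _ => Finset.sum_eq_zero fun s _ => ?_
        split_ifs with hadj
        · refine setIntegral_eq_zero_of_forall_eq_zero fun y hy => ?_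
          have : g (T.sideMap F s y) = 0 := by
            by_contra hne
            have h3 := T.sideMap_mem_frontier (F := F) (s := s) (subset_closure hy)
            rw [hadj, (T.isOpen_elem K).frontier_eq] at h3
            exact h3.2 (hsupp (subset_tsupport g hne))
          rw [this, zero_mul]
        · rfl
      rw [divDefect, h1, h2, sub_zero]
    · have hfr : x ∈ frontier (T.elem K) := by
        rw [(T.isOpen_elem K).frontier_eq, T.closure_elem]
        exact ⟨hcl, hK⟩
      obtain ⟨F, s, rfl, y₀, hy₀', rfl⟩ := T.boundary_cover K x hfr
      change T.sideMap F s y₀ ∉ _ at hx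
      have hy₀ := T.mem_Fref_of_notMem_edgeSet hy₀' hx
      set n₀ := T.normal F s y₀
      have hn₀ : n₀ ⬝ᵥ n₀ = 1 := T.normal_unit F s y₀ hy₀
      -- Both `c + a n₀` and `n₀` are outward, and the defect is linear in the direction.
      set a : ℝ := |n₀ ⬝ᵥ c| + 1
      obtain ⟨N₁, hN₁, h1⟩ := T.divDefect_eq_zero_of_face hy₀ hx (c := c + a • n₀) (by
        change 0 < n₀ ⬝ᵥ (c + a • n₀)
        rw [dotProduct_add, dotProduct_smul, hn₀, smul_eq_mul, mul_one]
        have := neg_abs_le (n₀ ⬝ᵥ c)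
        simp only [a]; linarith)
      obtain ⟨N₂, hN₂, h2⟩ := T.divDefect_eq_zero_of_face hy₀ hx (c := n₀)
        (by change 0 < n₀ ⬝ᵥ n₀; rw [hn₀]; exact one_pos)
      refine ⟨N₁ ∩ N₂, inter_mem hN₁ hN₂, fun g hg hsupp => ?_⟩
      have h3 := h1 g hg (hsupp.trans inter_subset_left)
      rw [T.divDefect_add_smul _ _ _ _ hg, h2 g hg (hsupp.trans inter_subset_right), mul_zero,
        add_zero] at h3
      exact h3
  · refine ⟨(T.closedElem K)ᶜ, (T.isCompact_closedElem K).isClosed.isOpen_compl.mem_nhds hcl,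
      fun g hg hsupp => ?_⟩
    have hzero : ∀ x ∈ T.closedElem K, x ∉ tsupport g := fun x hx h => hsupp h hx
    have h1 : ∫ x in T.elem K, fderiv ℝ g x c = 0 := by
      refine setIntegral_eq_zero_of_forall_eq_zero fun y hy => ?_
      have : fderiv ℝ g y = 0 := by
        by_contra hne
        exact hzero y (T.elem_subset_closedElem K hy) (support_fderiv_subset ℝ hne)
      rw [this, zero_apply]
    have h2 : T.bdryFlux K c g = 0 := by
      refine Finset.sum_eq_zero fun F _ => Finset.sum_eq_zero fun s _ => ?_
      split_ifs with hadj
      · refine setIntegral_eq_zero_of_forall_eq_zero fun y hy => ?_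
        have : g (T.sideMap F s y) = 0 := by
          by_contra hne
          have h3 := T.sideMap_mem_closedElem (F := F) (s := s) (subset_closure hy)
          rw [hadj] at h3
          exact hzero _ h3 (subset_tsupport g hne)
        rw [this, zero_mul]
      · rfl
    rw [divDefect, h1, h2, sub_zero]

/-- The divergence theorem for functions supported away from the edges. -/
lemma divDefect_eq_zero_of_disjoint {K : Fin T.numElem} (c : Pt (e + 1)) {g : Pt (e + 1) → ℝ}
    (hg : ContDiff ℝ 1 g) (hcs : HasCompactSupport g)
    (hsupp : Disjoint (tsupport g) (T.edgeSet K)) : T.divDefect K c g = 0 := by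
  have hloc : ∀ x ∈ tsupport g, ∃ N, IsOpen N ∧ x ∈ N ∧ ∀ g : Pt (e + 1) → ℝ,
      ContDiff ℝ 1 g → tsupport g ⊆ N → T.divDefect K c g = 0 := by
    intro x hx
    obtain ⟨N, hN, h⟩ := T.divDefect_eq_zero_locally (disjoint_left.1 hsupp hx) c
    obtain ⟨N', hN', ho, hxN⟩ := mem_nhds_iff.1 hN
    exact ⟨N', ho, hxN, fun g hg hs => h g hg (hs.trans hN')⟩
  choose! N hNo hxN hN using hloc
  obtain ⟨t, ht, hcov⟩ := hcs.isCompact.elim_nhds_subcover N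
    fun x hx => (hNo x hx).mem_nhds (hxN x hx)
  -- The defect is additive in `g`, so it vanishes once it does on each localized piece.
  obtain ⟨f, hf⟩ := SmoothPartitionOfUnity.exists_isSubordinate 𝓘(ℝ, Pt (e + 1))
    (isClosed_tsupport g) (fun i : t => N i) (fun i => hNo i (ht i i.2))
    (by simpa [iUnion_subtype] using hcov)
  have hfc : ∀ i, ContDiff ℝ 1 (f i) := fun i => (f i).contMDiff.contDiff.of_le (by simp)
  have hsum : g = fun x => ∑ i ∈ (Finset.univ : Finset t), f i x * g x := by
    funext x
    rw [← Finset.sum_mul]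
    by_cases hx : x ∈ tsupport g
    · have := f.sum_eq_one hx
      rw [finsum_eq_sum_of_fintype] at this
      rw [this, one_mul]
    · rw [image_eq_zero_of_notMem_tsupport hx, mul_zero]
  rw [hsum, T.divDefect_sum K c _ fun i => (hfc i).mul hg]
  refine Finset.sum_eq_zero fun i _ => hN i (ht i i.2) _ ((hfc i).mul hg) ?_
  exact (closure_mono (Function.support_mul_subset_left _ _)).trans (hf i)

end Mesh
end EulerHDG

/-! ### Cutoff functions and the divergence theorem -/

namespace EulerHDG

variable {e : ℕ}

/-- The `e`-dimensional measure of the set vanishes, in the form that it has finite covers by small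
balls with arbitrarily small total `e`-dimensional size. -/
def HasSmallCovers (e : ℕ) (E : Set (Pt (e + 1))) : Prop :=
  ∀ ε > 0, ∃ t : Finset (Pt (e + 1) × ℝ), (∀ q ∈ t, q.1 ∈ E ∧ 0 < q.2 ∧ q.2 < ε) ∧
    (E ⊆ ⋃ q ∈ t, Metric.ball q.1 q.2) ∧ ∑ q ∈ t, q.2 ^ e < ε

lemma HasSmallCovers.union {E E' : Set (Pt (e + 1))} (hE : HasSmallCovers e E)
    (hE' : HasSmallCovers e E') : HasSmallCovers e (E ∪ E') := by
  classical
  intro ε hε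
  obtain ⟨t, h1, h2, h3⟩ := hE (ε / 2) (by linarith)
  obtain ⟨t', h1', h2', h3'⟩ := hE' (ε / 2) (by linarith)
  refine ⟨t ∪ t', fun q hq => ?_, ?_, ?_⟩
  · rcases Finset.mem_union.1 hq with hq | hq
    · obtain ⟨a, b, c⟩ := h1 q hq
      exact ⟨Or.inl a, b, by linarith⟩
    · obtain ⟨a, b, c⟩ := h1' q hq
      exact ⟨Or.inr a, b, by linarith⟩
  · refine union_subset (h2.trans ?_) (h2'.trans ?_)
    · exact biUnion_subset_biUnion_left fun q hq => Finset.mem_union_left _ hq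
    · exact biUnion_subset_biUnion_left fun q hq => Finset.mem_union_right _ hq
  · have h4 : ∑ q ∈ t ∪ t', q.2 ^ e + ∑ q ∈ t ∩ t', q.2 ^ e =
        ∑ q ∈ t, q.2 ^ e + ∑ q ∈ t', q.2 ^ e := Finset.sum_union_inter
    have h5 : 0 ≤ ∑ q ∈ t ∩ t', q.2 ^ e := Finset.sum_nonneg fun q hq =>
      pow_nonneg (h1 q (Finset.mem_inter.1 hq).1).2.1.le _
    linarith

lemma HasSmallCovers.empty : HasSmallCovers e ∅ :=
  fun ε hε => ⟨∅, by simp, by simp, by simpa using hε⟩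

lemma HasSmallCovers.iUnion {ι : Type*} [Finite ι] {E : ι → Set (Pt (e + 1))}
    (hE : ∀ i, HasSmallCovers e (E i)) : HasSmallCovers e (⋃ i, E i) := by
  classical
  have := Fintype.ofFinite ι
  have h : ∀ t : Finset ι, HasSmallCovers e (⋃ i ∈ t, E i) := by
    intro t
    induction t using Finset.induction_on with
    | empty => simpa using HasSmallCovers.empty
    | insert i t _ ih =>
      rw [Finset.set_biUnion_insert]
      exact (hE i).union ih
  simpa using h Finset.univ

/-- A `C^1` image of a compact null set has small covers. -/
lemma HasSmallCovers.image {f : Pt e → Pt (e + 1)} (hf : ContDiff ℝ 1 f) {A : Set (Pt e)}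
    (hA : IsCompact A) (hA0 : volume A = 0) : HasSmallCovers e (f '' A) := by
  intro ε hε
  obtain ⟨L, hL⟩ := (hf.locallyLipschitz.locallyLipschitzOn
    (s := A)).exists_lipschitzOnWith_of_compact hA
  -- One more than the Lipschitz constant, so that images of closed balls fit into open balls and
  -- compactness yields a finite cover.
  set M : ℝ := L + 1 with hM
  have hM1 : 1 ≤ M := by rw [hM]; linarith [L.coe_nonneg]
  have hM0 : 0 < M := by linarith
  obtain ⟨t, r, htc, htA, htr, hcov, hsum⟩ :=
    Besicovitch.exists_closedBall_covering_tsum_measure_le (volume : Measure (Pt e))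
      (ε := ENNReal.ofReal (ε / (2 * M ^ e))) (by simp; positivity)
      (fun _ => Ioo 0 (ε / M)) A (fun x _ δ hδ => by
        refine ⟨min (ε / M) δ / 2, ⟨?_, ?_⟩, ?_, ?_⟩
        · have : 0 < min (ε / M) δ := lt_min (by positivity) hδ
          linarith
        · have : 0 < ε / M := by positivity
          linarith [min_le_left (ε / M) δ]
        · have : 0 < min (ε / M) δ := lt_min (by positivity) hδ
          linarith
        · linarith [min_le_right (ε / M) δ])
  rw [hA0, zero_add] at hsum
  have hfA : IsCompact (f '' A) := hA.image hf.continuous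
  obtain ⟨u, hu⟩ := hfA.elim_finite_subcover (fun x : t => Metric.ball (f x) (M * r x))
    (fun _ => Metric.isOpen_ball) (by
      rintro _ ⟨a, ha, rfl⟩
      obtain ⟨x, hx, hax⟩ := mem_iUnion₂.1 (hcov ha)
      refine mem_iUnion.2 ⟨⟨x, hx⟩, ?_⟩
      rw [Metric.mem_ball]
      have h1 := hL.dist_le_mul a ha x (htA hx)
      have h2 : (L : ℝ) * dist a x ≤ L * r x :=
        mul_le_mul_of_nonneg_left (Metric.mem_closedBall.1 hax) L.coe_nonneg
      have h3 := (htr x hx).1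
      rw [hM, add_mul, one_mul]
      linarith)
  classical
  refine ⟨u.image fun x : t => (f x, M * r x), ?_, ?_, ?_⟩
  · intro q hq
    obtain ⟨x, -, rfl⟩ := Finset.mem_image.1 hq
    have h3 := htr x x.2
    refine ⟨mem_image_of_mem f (htA x.2), mul_pos hM0 h3.1, ?_⟩
    have := mul_lt_mul_of_pos_left h3.2 hM0
    rwa [mul_div_cancel₀ _ hM0.ne'] at this
  · intro y hy
    obtain ⟨x, hx, hyx⟩ := mem_iUnion₂.1 (hu hy)
    exact mem_iUnion₂.2 ⟨(f x, M * r x), Finset.mem_image.2 ⟨x, hx, rfl⟩, hyx⟩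
  · have hr0 : ∀ x : t, 0 < r x := fun x => (htr x x.2).1
    have h1 : ∑ q ∈ u.image (fun x : t => (f x, M * r x)), q.2 ^ e ≤
        ∑ x ∈ u, (M * r x) ^ e := by
      refine Finset.sum_image_le_of_nonneg (g := fun x : t => (f x, M * r x))
        (f := fun q : Pt (e + 1) × ℝ => q.2 ^ e) ?_
      intro q hq
      obtain ⟨x, -, rfl⟩ := Finset.mem_image.1 hq
      exact pow_nonneg (mul_pos hM0 (hr0 x)).le _
    have h2 : ENNReal.ofReal (∑ x ∈ u, (r x) ^ e) ≤ ENNReal.ofReal (ε / (2 * M ^ e)) := by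
      rw [ENNReal.ofReal_sum_of_nonneg fun x _ => pow_nonneg (hr0 x).le _]
      refine le_trans ?_ hsum
      refine le_trans (Finset.sum_le_sum fun x _ => ?_) (ENNReal.sum_le_tsum u)
      -- Sup-norm balls have volume `(2 r)^e ≥ r^e`, so the volume bound controls the sum of `r^e`.
      rw [Real.volume_pi_closedBall _ (hr0 x).le, Fintype.card_fin]
      refine ENNReal.ofReal_le_ofReal (pow_le_pow_left₀ (hr0 x).le ?_ _)
      linarith [hr0 x]
    rw [ENNReal.ofReal_le_ofReal_iff (by positivity)] at h2
    have h3 : ∑ x ∈ u, (M * r x) ^ e = M ^ e * ∑ x ∈ u, (r x) ^ e := by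
      rw [Finset.mul_sum]
      exact Finset.sum_congr rfl fun x _ => mul_pow _ _ _
    have h4 : M ^ e * ∑ x ∈ u, (r x) ^ e ≤ M ^ e * (ε / (2 * M ^ e)) :=
      mul_le_mul_of_nonneg_left h2 (by positivity)
    have h5 : M ^ e * (ε / (2 * M ^ e)) = ε / 2 := by
      have : M ^ e ≠ 0 := by positivity
      field_simp
    linarith

/-- A smooth function with values in `[0, 1]` with small directional derivative in `L^1`. -/
structure IsCutoff (c : Pt (e + 1)) (δ : ℝ) (η : Pt (e + 1) → ℝ) : Prop where
  contDiff : ContDiff ℝ 1 η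
  nonneg : ∀ x, 0 ≤ η x
  le_one : ∀ x, η x ≤ 1
  integrable : Integrable fun x => fderiv ℝ η x c
  integral_le : ∫ x, |fderiv ℝ η x c| ≤ δ

lemma IsCutoff.mul {c : Pt (e + 1)} {δ δ' : ℝ} {η η' : Pt (e + 1) → ℝ} (h : IsCutoff c δ η)
    (h' : IsCutoff c δ' η') : IsCutoff c (δ + δ') (fun x => η x * η' x) := by
  have hd : ∀ x, fderiv ℝ (fun x => η x * η' x) x c =
      η x * fderiv ℝ η' x c + η' x * fderiv ℝ η x c := by
    intro x
    rw [fderiv_fun_mul (h.contDiff.differentiable (by simp) x)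
      (h'.contDiff.differentiable (by simp) x)]
    simp
  have i1 : Integrable fun x => η x * fderiv ℝ η' x c :=
    h'.integrable.bdd_mul (c := 1) h.contDiff.continuous.aestronglyMeasurable
      (Eventually.of_forall fun x => by
        rw [Real.norm_eq_abs, abs_of_nonneg (h.nonneg x)]; exact h.le_one x)
  have i2 : Integrable fun x => η' x * fderiv ℝ η x c :=
    h.integrable.bdd_mul (c := 1) h'.contDiff.continuous.aestronglyMeasurable
      (Eventually.of_forall fun x => by
        rw [Real.norm_eq_abs, abs_of_nonneg (h'.nonneg x)]; exact h'.le_one x)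
  refine ⟨h.contDiff.mul h'.contDiff, fun x => mul_nonneg (h.nonneg x) (h'.nonneg x),
    fun x => mul_le_one₀ (h.le_one x) (h'.nonneg x) (h'.le_one x), ?_, ?_⟩
  · simp only [hd]
    exact i1.add i2
  · have hle : ∀ x, |fderiv ℝ (fun x => η x * η' x) x c| ≤
        |fderiv ℝ η x c| + |fderiv ℝ η' x c| := by
      intro x
      rw [hd]
      refine (abs_add_le _ _).trans ?_
      rw [abs_mul, abs_mul, abs_of_nonneg (h.nonneg x), abs_of_nonneg (h'.nonneg x)]
      have a1 := mul_le_mul_of_nonneg_right (h.le_one x) (abs_nonneg (fderiv ℝ η' x c))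
      have a2 := mul_le_mul_of_nonneg_right (h'.le_one x) (abs_nonneg (fderiv ℝ η x c))
      linarith
    calc ∫ x, |fderiv ℝ (fun x => η x * η' x) x c|
        ≤ ∫ x, (|fderiv ℝ η x c| + |fderiv ℝ η' x c|) := by
          refine integral_mono_of_nonneg (Eventually.of_forall fun x => abs_nonneg _)
            (h.integrable.abs.add h'.integrable.abs) (Eventually.of_forall hle)
      _ = (∫ x, |fderiv ℝ η x c|) + ∫ x, |fderiv ℝ η' x c| :=
          integral_add h.integrable.abs h'.integrable.abs
      _ ≤ δ + δ' := add_le_add h.integral_le h'.integral_le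

/-- A cutoff function that vanishes on a ball of radius `r` costs `O(r^e)`. -/
lemma exists_isCutoff_ball (c : Pt (e + 1)) : ∃ M : ℝ, 0 ≤ M ∧ ∀ (a : Pt (e + 1)) (r : ℝ), 0 < r →
    ∃ η, IsCutoff c (M * r ^ e) η ∧ (∀ x ∈ Metric.ball a r, η x = 0) ∧
      ∀ x ∉ Metric.ball a (2 * r), η x = 1 := by
  let b : ContDiffBump (0 : Pt (e + 1)) := ⟨1, 2, one_pos, one_lt_two⟩
  have hb : ContDiff ℝ 1 (b : Pt (e + 1) → ℝ) := b.contDiff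
  have hbi : Integrable fun x => fderiv ℝ b x c :=
    ((hb.continuous_fderiv (by simp)).clm_apply continuous_const).integrable_of_hasCompactSupport
      (b.hasCompactSupport.fderiv_apply (𝕜 := ℝ) c)
  refine ⟨∫ x, |fderiv ℝ b x c|, integral_nonneg fun x => abs_nonneg _, fun a r hr => ?_⟩
  have hd : ∀ x, fderiv ℝ (fun x => 1 - b (r⁻¹ • (x - a))) x c =
      -(r⁻¹ * fderiv ℝ b (r⁻¹ • (x - a)) c) := by
    intro x
    have h1 : HasFDerivAt (fun x : Pt (e + 1) => r⁻¹ • (x - a))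
        (r⁻¹ • ContinuousLinearMap.id ℝ (Pt (e + 1))) x :=
      ((hasFDerivAt_id x).sub_const a).const_smul r⁻¹
    have h2 := ((hb.differentiable (by simp) (r⁻¹ • (x - a))).hasFDerivAt).comp x h1
    have h3 : HasFDerivAt (fun x => 1 - b (r⁻¹ • (x - a))) _ x := h2.const_sub 1
    rw [h3.fderiv]
    simp
  have hint : Integrable fun x => fderiv ℝ b (r⁻¹ • (x - a)) c :=
    (hbi.comp_smul (inv_ne_zero hr.ne')).comp_sub_right a
  refine ⟨fun x => 1 - b (r⁻¹ • (x - a)), ⟨?_, ?_, ?_, ?_, ?_⟩, ?_, ?_⟩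
  · exact contDiff_const.sub (hb.comp ((contDiff_id.sub contDiff_const).const_smul r⁻¹))
  · intro x; linarith [b.le_one (x := r⁻¹ • (x - a))]
  · intro x; linarith [b.nonneg (x := r⁻¹ • (x - a))]
  · simp only [hd]
    exact (hint.const_mul r⁻¹).neg
  · simp only [hd, abs_neg, abs_mul, abs_of_pos (inv_pos.2 hr)]
    -- Scaling: the derivative contributes `r⁻¹` and the volume `r^(e+1)`, leaving `r^e`.
    rw [integral_const_mul, integral_sub_right_eq_self
      (fun x => |fderiv ℝ b (r⁻¹ • x) c|) a,
      Measure.integral_comp_inv_smul_of_nonneg volume (fun x => |fderiv ℝ b x c|) hr.le]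
    rw [Module.finrank_fintype_fun_eq_card, Fintype.card_fin, smul_eq_mul, pow_succ]
    field_simp
    exact le_rfl
  · intro x hx
    simp only
    rw [b.one_of_mem_closedBall, sub_self]
    rw [mem_closedBall_zero_iff, norm_smul, norm_inv, Real.norm_of_nonneg hr.le]
    rw [Metric.mem_ball, dist_eq_norm] at hx
    change r⁻¹ * ‖x - a‖ ≤ 1
    rw [inv_mul_le_one₀ hr]
    exact hx.le
  · intro x hx
    simp only
    rw [b.zero_of_le_dist, sub_zero]
    rw [dist_zero_right, norm_smul, norm_inv, Real.norm_of_nonneg hr.le]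
    rw [Metric.mem_ball, dist_eq_norm, not_lt] at hx
    change 2 ≤ r⁻¹ * ‖x - a‖
    rw [le_inv_mul_iff₀ hr]
    linarith

/-- Multiply the ball cutoffs of a fine cover: their `L^1` derivative costs add up to at most `M ∑
r^e`. -/
lemma HasSmallCovers.exists_cutoff {E : Set (Pt (e + 1))} (hE : HasSmallCovers e E)
    (c : Pt (e + 1)) {δ : ℝ} (hδ : 0 < δ) :
    ∃ η, IsCutoff c δ η ∧ (∃ U, IsOpen U ∧ E ⊆ U ∧ ∀ x ∈ U, η x = 0) ∧
      ∀ x, (∀ y ∈ E, δ ≤ dist x y) → η x = 1 := by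
  obtain ⟨M, hM, hball⟩ := exists_isCutoff_ball c
  choose! β hβ1 hβ2 hβ3 using hball
  -- The first bound keeps the doubled balls within distance `δ` of `E`, the second keeps the total
  -- cost below `δ`.
  set ε : ℝ := min (δ / 2) (δ / (M + 1)) with hε
  have hε0 : 0 < ε := lt_min (by linarith) (by positivity)
  obtain ⟨t, h1, h2, h3⟩ := hE ε hε0
  have hprod : ∀ u : Finset (Pt (e + 1) × ℝ), u ⊆ t →
      IsCutoff c (∑ q ∈ u, M * q.2 ^ e) (fun x => ∏ q ∈ u, β q.1 q.2 x) := by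
    classical
    intro u
    induction u using Finset.induction_on with
    | empty =>
      intro _
      simp only [Finset.sum_empty, Finset.prod_empty]
      exact ⟨contDiff_const, fun _ => zero_le_one, fun _ => le_rfl, by simp, by simp⟩
    | insert q u hq ih =>
      intro hu
      simp only [Finset.sum_insert hq, Finset.prod_insert hq]
      exact (hβ1 q.1 q.2 (h1 q (hu (Finset.mem_insert_self _ _))).2.1).mul
        (ih fun q hq => hu (Finset.mem_insert_of_mem hq))
  have hη := hprod t (Finset.Subset.refl t)
  refine ⟨fun x => ∏ q ∈ t, β q.1 q.2 x,
    ⟨hη.contDiff, hη.nonneg, hη.le_one, hη.integrable, hη.integral_le.trans ?_⟩,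
    ⟨⋃ q ∈ t, Metric.ball q.1 q.2, isOpen_biUnion fun _ _ => Metric.isOpen_ball, h2, ?_⟩, ?_⟩
  · rw [← Finset.mul_sum]
    have a1 : M * ∑ q ∈ t, q.2 ^ e ≤ M * (δ / (M + 1)) :=
      mul_le_mul_of_nonneg_left (h3.le.trans (min_le_right _ _)) hM
    have a2 : M * (δ / (M + 1)) ≤ δ := by
      rw [← mul_div_assoc, div_le_iff₀ (by linarith)]
      linarith
    linarith
  · intro x hx
    obtain ⟨q, hq, hxq⟩ := mem_iUnion₂.1 hx
    exact Finset.prod_eq_zero hq (hβ2 q.1 q.2 (h1 q hq).2.1 x hxq)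
  · intro x hx
    refine Finset.prod_eq_one fun q hq => hβ3 q.1 q.2 (h1 q hq).2.1 x ?_
    rw [Metric.mem_ball, not_lt]
    have a1 := (h1 q hq).2.2
    have a2 : ε ≤ δ / 2 := min_le_left _ _
    linarith [hx q.1 (h1 q hq).1]

/-! ### The divergence theorem on an element -/

namespace Mesh

variable {p : ℕ} {Λ : Submodule ℤ (Pt (e + 1))} {Ω : Set (Pt (e + 1))} (T : Mesh e p Λ Ω)

lemma hasSmallCovers_edgeSet (K : Fin T.numElem) : HasSmallCovers e (T.edgeSet K) := by
  refine HasSmallCovers.iUnion fun F => HasSmallCovers.iUnion fun s => ?_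
  by_cases h : T.adj F s = K
  swap
  · simpa [h] using HasSmallCovers.empty
  simp only [h, iUnion_true]
  exact HasSmallCovers.image (T.contDiff_sideMap F s) T.isCompact_frontier_Fref
    (T.Fref_polytope.convex.addHaar_frontier _)

/-- The divergence theorem on a curved element for the vector field `g c`. -/
theorem integral_fderiv_elem (K : Fin T.numElem) (c : Pt (e + 1)) {g : Pt (e + 1) → ℝ}
    (hg : ContDiff ℝ 1 g) (hcs : HasCompactSupport g) :
    ∫ x in T.elem K, fderiv ℝ g x c = T.bdryFlux K c g := by
  have hpos : ∀ m : ℕ, (0 : ℝ) < 1 / ((m : ℝ) + 1) := fun m => Nat.one_div_pos_of_nat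
  choose η hη hη0 hη1 using fun m : ℕ =>
    (T.hasSmallCovers_edgeSet K).exists_cutoff c (hpos m)
  have hlim : ∀ x ∉ T.edgeSet K, Tendsto (fun m => η m x) atTop (𝓝 1) := by
    intro x hx
    obtain ⟨δ, hδ, hball⟩ := Metric.isOpen_iff.1 (T.isCompact_edgeSet K).isClosed.isOpen_compl x hx
    refine tendsto_const_nhds.congr' ?_
    filter_upwards [(tendsto_one_div_add_atTop_nhds_zero_nat (𝕜 := ℝ)).eventually
      (gt_mem_nhds hδ)] with m hm
    refine (hη1 m x fun y hy => ?_).symm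
    by_contra hcon
    have : y ∈ Metric.ball x δ := by
      rw [Metric.mem_ball, dist_comm]
      linarith
    exact hball this hy
  -- The cutoff vanishes on a neighbourhood of the edges, so the product is supported away from
  -- them.
  have hzero : ∀ m, T.divDefect K c (fun x => η m x * g x) = 0 := by
    intro m
    obtain ⟨U, hUo, hEU, hU⟩ := hη0 m
    refine T.divDefect_eq_zero_of_disjoint c ((hη m).contDiff.mul hg) (hcs.mul_left) ?_
    refine disjoint_left.2 fun x hx hxE => ?_
    refine (notMem_tsupport_iff_eventuallyEq.2 ?_) hx
    filter_upwards [hUo.mem_nhds (hEU hxE)] with y hy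
    rw [hU y hy, zero_mul]; rfl
  obtain ⟨C, hC⟩ : ∃ C, ∀ x, |g x| ≤ C := hcs.exists_bound_of_continuous hg.continuous
  have hdg := T.integrableOn_fderiv hg K c
  have hKE : ∀ x ∈ T.elem K, x ∉ T.edgeSet K := by
    intro x hx hxE
    have := T.edgeSet_subset_frontier K hxE
    rw [(T.isOpen_elem K).frontier_eq] at this
    exact this.2 hx
  have hKm : MeasurableSet (T.elem K) := (T.isOpen_elem K).measurableSet
  have hFm : MeasurableSet T.Fref := T.Fref_polytope.isOpen.measurableSet
  have hηb : ∀ m x, ‖η m x‖ ≤ 1 := fun m x => by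
    rw [Real.norm_eq_abs, abs_of_nonneg ((hη m).nonneg x)]; exact (hη m).le_one x
  have i1 : ∀ m, IntegrableOn (fun x => η m x * fderiv ℝ g x c) (T.elem K) := fun m =>
    hdg.bdd_mul (c := 1) (hη m).contDiff.continuous.aestronglyMeasurable
      (Eventually.of_forall (hηb m))
  have i2 : ∀ m, IntegrableOn (fun x => g x * fderiv ℝ (η m) x c) (T.elem K) := fun m =>
    ((hη m).integrable.bdd_mul (c := C) hg.continuous.aestronglyMeasurable
      (Eventually.of_forall hC)).integrableOn
  have hvol : ∀ m, ∫ x in T.elem K, fderiv ℝ (fun x => η m x * g x) x c =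
      (∫ x in T.elem K, η m x * fderiv ℝ g x c) +
        ∫ x in T.elem K, g x * fderiv ℝ (η m) x c := by
    intro m
    rw [← integral_add (i1 m) (i2 m)]
    refine integral_congr_ae (Eventually.of_forall fun x => ?_)
    simp only
    rw [fderiv_fun_mul ((hη m).contDiff.differentiable (by simp) x)
      (hg.differentiable (by simp) x)]
    simp
  have l1 : Tendsto (fun m => ∫ x in T.elem K, η m x * fderiv ℝ g x c) atTop
      (𝓝 (∫ x in T.elem K, fderiv ℝ g x c)) := by
    refine tendsto_integral_of_dominated_convergence (fun x => |fderiv ℝ g x c|)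
      (fun m => (i1 m).aestronglyMeasurable) hdg.abs (fun m => Eventually.of_forall fun x => ?_) ?_
    · rw [norm_mul]
      exact mul_le_of_le_one_left (norm_nonneg _) (hηb m x)
    · filter_upwards [ae_restrict_mem hKm] with x hx
      simpa using (hlim x (hKE x hx)).mul_const (fderiv ℝ g x c)
  -- The derivative of the cutoff blows up pointwise in general; only its `L^1` smallness is used.
  have l2 : Tendsto (fun m => ∫ x in T.elem K, g x * fderiv ℝ (η m) x c) atTop (𝓝 0) := by
    have hb : ∀ m, ‖∫ x in T.elem K, g x * fderiv ℝ (η m) x c‖ ≤ C * (1 / ((m : ℝ) + 1)) := by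
      intro m
      have hC0 : 0 ≤ C := (abs_nonneg _).trans (hC 0)
      calc ‖∫ x in T.elem K, g x * fderiv ℝ (η m) x c‖
          ≤ ∫ x in T.elem K, C * |fderiv ℝ (η m) x c| := by
            refine norm_integral_le_of_norm_le ((hη m).integrable.abs.const_mul C).integrableOn
              (Eventually.of_forall fun x => ?_)
            rw [norm_mul]
            exact mul_le_mul_of_nonneg_right (hC x) (abs_nonneg _)
        _ ≤ ∫ x, C * |fderiv ℝ (η m) x c| :=
            setIntegral_le_integral ((hη m).integrable.abs.const_mul C)
              (Eventually.of_forall fun x => mul_nonneg hC0 (abs_nonneg _))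
        _ ≤ C * (1 / ((m : ℝ) + 1)) := by
            rw [integral_const_mul]
            exact mul_le_mul_of_nonneg_left (hη m).integral_le hC0
    refine squeeze_zero_norm hb ?_
    simpa using (tendsto_one_div_add_atTop_nhds_zero_nat (𝕜 := ℝ)).const_mul C
  have l3 : Tendsto (fun m => T.bdryFlux K c (fun x => η m x * g x)) atTop
      (𝓝 (T.bdryFlux K c g)) := by
    refine tendsto_finsetSum _ fun F _ => tendsto_finsetSum _ fun s _ => ?_
    split_ifs with hadj
    · have hgi := T.integrableOn_bdryFlux hg.continuous F s c
      refine tendsto_integral_of_dominated_convergence _ (fun m => ?_) hgi.norm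
        (fun m => Eventually.of_forall fun y => ?_) ?_
      · exact (T.integrableOn_bdryFlux ((hη m).contDiff.continuous.mul hg.continuous)
          F s c).aestronglyMeasurable
      · rw [mul_assoc, norm_mul]
        exact mul_le_of_le_one_left (norm_nonneg _) (hηb m _)
      · have hnull : ∀ᵐ y ∂(volume.restrict T.Fref), T.sideMap F s y ∉ T.edgeSet K := by
          rw [ae_restrict_iff' hFm, ae_iff]
          refine measure_mono_null (fun y hy => ?_) (T.volume_edge_preimage F s)
          simp only [mem_ofPred_eq, Classical.not_imp, not_not] at hy
          exact ⟨hy.1, by rw [mem_preimage, hadj]; exact hy.2⟩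
        filter_upwards [hnull] with y hy
        have := (hlim _ hy).mul_const
          (g (T.sideMap F s y) * ((T.normal F s y ⬝ᵥ c) * T.surfElt F y))
        simpa only [one_mul, mul_assoc] using this
    · exact tendsto_const_nhds
  have l4 := (l1.add l2).sub l3
  have l5 : (fun m => (∫ x in T.elem K, η m x * fderiv ℝ g x c) +
      (∫ x in T.elem K, g x * fderiv ℝ (η m) x c) - T.bdryFlux K c (fun x => η m x * g x)) =
      fun _ => (0 : ℝ) := by
    funext m
    rw [← hvol m]
    exact hzero m
  rw [l5] at l4
  have := tendsto_nhds_unique l4 tendsto_const_nhds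
  linarith

end Mesh
end EulerHDG

/-! ### Interpolation nodes and time derivatives -/

namespace EulerHDG

/-- Polynomials of bounded degree are determined on a set by their values at finitely many nodes. -/
lemma exists_interpolation {a : ℕ} (S : Set (Pt a)) (k : ℕ) :
    ∃ (ι : Type) (_ : Fintype ι) (ξ : ι → Pt a) (L : ι → MvPolynomial (Fin a) ℝ),
      (∀ j, ξ j ∈ S) ∧ ∀ P : MvPolynomial (Fin a) ℝ, P.totalDegree ≤ k → ∀ x ∈ S,
        MvPolynomial.eval x P = ∑ j, MvPolynomial.eval (ξ j) P * MvPolynomial.eval x (L j) := by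
  classical
  let M := MvPolynomial.restrictTotalDegree (Fin a) ℝ k
  let ev : Pt a → Module.Dual ℝ M := fun x =>
    (MvPolynomial.aeval (R := ℝ) x).toLinearMap.comp M.subtype
  have hev : ∀ x (P : M), ev x P = MvPolynomial.eval x (P : MvPolynomial (Fin a) ℝ) := by
    intro x P
    simp [ev, MvPolynomial.aeval_eq_eval]
  -- Point evaluations live in a finite-dimensional dual space, so finitely many points of `S` span
  -- all of them.
  obtain ⟨s, hs, hspan⟩ := (Submodule.fg_span_iff_fg_span_finset_subset (R := ℝ) (ev '' S)).1
    (IsNoetherian.noetherian _)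
  choose! ξ hξS hξ using fun (f : Module.Dual ℝ M) (hf : f ∈ s) => hs hf
  let R : M →ₗ[ℝ] (s → ℝ) := LinearMap.pi fun f => ev (ξ f)
  have hker : ∀ P : M, R P = 0 → ∀ x ∈ S, ev x P = 0 := by
    intro P hP x hx
    have h1 : ev x ∈ Submodule.span ℝ (s : Set (Module.Dual ℝ M)) := by
      rw [← hspan]; exact Submodule.subset_span ⟨x, hx, rfl⟩
    have h2 : Submodule.span ℝ (s : Set (Module.Dual ℝ M)) ≤
        LinearMap.ker (Module.Dual.eval ℝ M P) := by
      rw [Submodule.span_le]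
      intro f hf
      have := congrFun hP ⟨f, hf⟩
      simp only [R, LinearMap.pi_apply, hξ f hf] at this
      simpa using this
    simpa using h2 h1
  -- A section of the nodal evaluation on its range, extended linearly. Applied to unit vectors it
  -- gives the `L`; surjectivity of `R` is not needed.
  obtain ⟨h, hh⟩ := R.rangeRestrict.exists_rightInverse_of_surjective R.range_rangeRestrict
  obtain ⟨g, hg⟩ := LinearMap.exists_extend h
  have hRg : ∀ P, R (g (R P)) = R P := by
    intro P
    have h1 : g (R P) = h (R.rangeRestrict P) := by
      rw [← hg]; rfl
    have h2 : R.rangeRestrict (h (R.rangeRestrict P)) = R.rangeRestrict P :=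
      congrArg (fun φ => φ (R.rangeRestrict P)) hh
    rw [h1]
    exact congrArg Subtype.val h2
  refine ⟨s, inferInstance, fun f => ξ f, fun f => (g (Pi.single f 1) : M),
    fun f => hξS f f.2, fun P hP x hx => ?_⟩
  let P' : M := ⟨P, (MvPolynomial.mem_restrictTotalDegree _ _ _).2 hP⟩
  have h1 : ev x (P' - g (R P')) = 0 := hker _ (by rw [map_sub, hRg, sub_self]) x hx
  rw [map_sub, sub_eq_zero, hev] at h1
  rw [show MvPolynomial.eval x P = MvPolynomial.eval x (P' : MvPolynomial (Fin a) ℝ) from rfl, h1]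
  have h2 : ev x (g (R P')) = ∑ f, R P' f * ev x (g (Pi.single f 1)) := by
    conv_lhs => rw [pi_eq_sum_univ' (R P')]
    rw [map_sum, map_sum]
    exact Finset.sum_congr rfl fun f _ => by rw [map_smul, map_smul, smul_eq_mul]
  rw [h2]
  refine Finset.sum_congr rfl fun f _ => ?_
  rw [hev]
  congr 1

/-- Parametric integrals of `G (∑ j, a j L j)` are differentiable in the coefficients `a`. -/
lemma hasFDerivAt_integral_combination {n : ℕ} {ι κ : Type*} [Fintype ι] [Fintype κ]
    {X : Set (κ → ℝ)} (hX : IsOpen X) {G : (κ → ℝ) → ℝ} (hG : ContDiffOn ℝ 1 G X)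
    {S : Set (Pt n)} (hSo : IsOpen S) (hSc : IsCompact (closure S)) {L : ι → Pt n → ℝ}
    (hL : ∀ j, Continuous (L j)) {D : Pt n → ℝ} (hD : Continuous D) {a : ι → κ → ℝ}
    (ha : ∀ x ∈ closure S, ∑ j, L j x • a j ∈ X) :
    HasFDerivAt (fun a : ι → κ → ℝ => ∫ x in S, D x * G (∑ j, L j x • a j))
      (∫ x in S, D x • (fderiv ℝ G (∑ j, L j x • a j)).comp
        (∑ j, L j x • (ContinuousLinearMap.proj j : (ι → κ → ℝ) →L[ℝ] (κ → ℝ)))) a := by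
  let V : Pt n → (ι → κ → ℝ) →L[ℝ] (κ → ℝ) := fun x =>
    ∑ j, L j x • (ContinuousLinearMap.proj j : (ι → κ → ℝ) →L[ℝ] (κ → ℝ))
  have hV : ∀ (b : ι → κ → ℝ) x, V x b = ∑ j, L j x • b j := by
    intro b x
    simp [V]
  have hVc : Continuous V := continuous_finsetSum _ fun j _ => (hL j).smul continuous_const
  have hVc2 : Continuous (fun q : (ι → κ → ℝ) × Pt n => V q.2 q.1) :=
    (hVc.comp continuous_snd).clm_apply continuous_fst
  have hSm : MeasurableSet S := hSo.measurableSet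
  simp only [← hV] at ha ⊢
  -- Compactness in `x` gives one neighbourhood of coefficients whose combinations stay in `X` for
  -- all `x`, hence a uniform dominating constant.
  obtain ⟨u, w, hu, -, hau, hSw, huw⟩ := generalized_tube_lemma (isCompact_singleton (x := a)) hSc
    (hX.preimage hVc2) (by
      rintro ⟨b, x⟩ ⟨hb, hx⟩
      obtain rfl : b = a := hb
      exact ha x hx)
  obtain ⟨ε, hε, hεu⟩ := Metric.nhds_basis_closedBall.mem_iff.1
    (hu.mem_nhds (singleton_subset_iff.1 hau))
  have hmem : ∀ b ∈ Metric.closedBall a ε, ∀ x ∈ closure S, V x b ∈ X := fun b hb x hx =>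
    huw (mk_mem_prod (hεu hb) (hSw hx))
  have hfc : ContinuousOn (fderiv ℝ G) X := hG.continuousOn_fderiv_of_isOpen hX le_rfl
  have hF'c : ContinuousOn (fun q : (ι → κ → ℝ) × Pt n =>
      D q.2 • (fderiv ℝ G (V q.2 q.1)).comp (V q.2)) (Metric.closedBall a ε ×ˢ closure S) := by
    refine (hD.comp continuous_snd).continuousOn.smul (ContinuousOn.clm_comp ?_
      (hVc.comp continuous_snd).continuousOn)
    exact hfc.comp hVc2.continuousOn fun q hq => hmem q.1 hq.1 q.2 hq.2
  obtain ⟨C, hC⟩ := ((isCompact_closedBall a ε).prod hSc).exists_bound_of_continuousOn hF'c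
  have hFc : ∀ b ∈ Metric.closedBall a ε,
      ContinuousOn (fun x => D x * G (V x b)) (closure S) := fun b hb =>
    hD.continuousOn.mul (hG.continuousOn.comp
      (hVc.clm_apply continuous_const).continuousOn fun x hx => hmem b hb x hx)
  have haball : a ∈ Metric.closedBall a ε := Metric.mem_closedBall_self hε.le
  refine hasFDerivAt_integral_of_dominated_of_fderiv_le (s := Metric.closedBall a ε)
    (bound := fun _ => C)
    (F' := fun b x => D x • (fderiv ℝ G (V x b)).comp (V x))
    (Metric.closedBall_mem_nhds a hε) ?_ ?_ ?_ ?_ ?_ ?_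
  · filter_upwards [Metric.closedBall_mem_nhds a hε] with b hb
    exact ((hFc b hb).mono subset_closure).aestronglyMeasurable hSm
  · exact ((hFc a haball).integrableOn_compact hSc).mono_set subset_closure
  · refine ContinuousOn.aestronglyMeasurable ?_ hSm
    exact hF'c.comp (f := fun x => (a, x)) (by fun_prop)
      fun x hx => ⟨haball, subset_closure hx⟩
  · filter_upwards [ae_restrict_mem hSm] with x hx b hb
    exact hC (b, x) ⟨hb, subset_closure hx⟩
  · exact (continuousOn_const.integrableOn_compact hSc).mono_set subset_closure
  · filter_upwards [ae_restrict_mem hSm] with x hx b hb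
    have h1 : HasFDerivAt G (fderiv ℝ G (V x b)) (V x b) :=
      ((hG.contDiffAt (hX.mem_nhds (hmem b hb x (subset_closure hx)))).differentiableAt
        (by simp)).hasFDerivAt
    exact (h1.comp b (V x).hasFDerivAt).const_mul (D x)

namespace Mesh

variable {e p : ℕ} {Λ : Submodule ℤ (Pt (e + 1))} {Ω : Set (Pt (e + 1))} (T : Mesh e p Λ Ω)

lemma setIntegral_elem (K : Fin T.numElem) (f : Pt (e + 1) → ℝ) :
    ∫ x in T.elem K, f x = ∫ ξ in T.Kref, |(polyJac (T.elemMap K) ξ).det| *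
      f (polyMap (T.elemMap K) ξ) := by
  rw [elem, integral_image_eq_integral_abs_det_fderiv_smul volume
    T.Kref_polytope.isOpen.measurableSet
    (fun ξ _ => (hasFDerivAt_polyMap (T.elemMap K) ξ).hasFDerivWithinAt)
    ((T.elemMap_injOn K).mono subset_closure)]
  simp only [det_mulVecLin, smul_eq_mul]

lemma polyMap_mem_closedElem {K : Fin T.numElem} {ξ : Pt (e + 1)} (hξ : ξ ∈ closure T.Kref) :
    polyMap (T.elemMap K) ξ ∈ T.closedElem K := ⟨ξ, hξ, rfl⟩

section Time

variable {X : Set (State (e + 1))} {G : State (e + 1) → ℝ} {k : ℕ} {tf : ℝ}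
  {v : ℝ → Fin T.numElem → Pt (e + 1) → State (e + 1)}

/-- Time regularity of integrals of a function of a discrete solution. -/
lemma integral_elem_time (hX : IsOpen X) (hG : ContDiffOn ℝ 1 G X)
    (hmem : ∀ t ∈ Ico 0 tf, v t ∈ T.VSpace k)
    (hcont : ∀ K, ∀ x ∈ T.closedElem K, ContinuousOn (fun t => v t K x) (Ico 0 tf))
    (hdiff : ∀ t ∈ Ioo 0 tf, ∀ K, ∀ x ∈ T.closedElem K,
      DifferentiableAt ℝ (fun τ => v τ K x) t)
    (hvX : ∀ t ∈ Ico 0 tf, ∀ K, ∀ x ∈ T.closedElem K, v t K x ∈ X) (K : Fin T.numElem) :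
    ContinuousOn (fun τ => ∫ x in T.elem K, G (v τ K x)) (Ico 0 tf) ∧
    ∀ t ∈ Ioo 0 tf, HasDerivAt (fun τ => ∫ x in T.elem K, G (v τ K x))
      (∫ x in T.elem K, deriv (fun τ => G (v τ K x)) t) t := by
  -- Reduces the discrete solution to its finitely many nodal values, whose time regularity is
  -- assumed.
  obtain ⟨ι, _, ξ, L, hξ, hL⟩ := exists_interpolation (closure T.Kref) k
  let ψ := polyMap (T.elemMap K)
  let D : Pt (e + 1) → ℝ := fun x => |(polyJac (T.elemMap K) x).det|
  have hD : Continuous D := (continuous_polyJac (T.elemMap K)).matrix_det.abs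
  let ℓ : ι → Pt (e + 1) → ℝ := fun j x => MvPolynomial.eval x (L j)
  have hℓ : ∀ j, Continuous (ℓ j) := fun j => (contDiff_eval (n := 0) (L j)).continuous
  let a : ℝ → ι → State (e + 1) := fun τ j => v τ K (ψ (ξ j))
  have hv : ∀ τ ∈ Ico 0 tf, ∀ x ∈ closure T.Kref, v τ K (ψ x) = ∑ j, ℓ j x • a τ j := by
    intro τ hτ x hx
    funext i
    obtain ⟨P, hP, hPv⟩ := hmem τ hτ K i
    rw [hPv x hx, hL P hP x hx, Finset.sum_apply]
    refine Finset.sum_congr rfl fun j _ => ?_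
    rw [Pi.smul_apply, smul_eq_mul, ← hPv (ξ j) (hξ j), mul_comm]
  have hKm : MeasurableSet T.Kref := T.Kref_polytope.isOpen.measurableSet
  have hfun : ∀ τ ∈ Ico 0 tf, ∫ x in T.elem K, G (v τ K x) =
      ∫ x in T.Kref, D x * G (∑ j, ℓ j x • a τ j) := by
    intro τ hτ
    rw [T.setIntegral_elem]
    refine setIntegral_congr_fun hKm fun x hx => ?_
    simp only [D]
    rw [← hv τ hτ x (subset_closure hx)]
  have haX : ∀ τ ∈ Ico 0 tf, ∀ x ∈ closure T.Kref, ∑ j, ℓ j x • a τ j ∈ X := by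
    intro τ hτ x hx
    rw [← hv τ hτ x hx]
    exact hvX τ hτ K _ (T.polyMap_mem_closedElem hx)
  have hF := fun τ hτ => hasFDerivAt_integral_combination hX hG T.Kref_polytope.isOpen
    T.Kref_polytope.isCompact_closure hℓ hD (haX τ hτ)
  have hac : ContinuousOn a (Ico 0 tf) :=
    continuousOn_pi.2 fun j => hcont K _ (T.polyMap_mem_closedElem (hξ j))
  constructor
  · intro τ hτ
    refine ContinuousWithinAt.congr ?_ (fun t ht => hfun t ht) (hfun τ hτ)
    exact (hF τ hτ).continuousAt.comp_continuousWithinAt (hac τ hτ)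
  · intro t ht
    have htI : t ∈ Ico 0 tf := Ioo_subset_Ico_self ht
    have hnhds : Ico 0 tf ∈ 𝓝 t := Ico_mem_nhds ht.1 ht.2
    have had : HasDerivAt a (deriv a t) t := by
      refine DifferentiableAt.hasDerivAt (differentiableAt_pi.2 fun j => ?_)
      exact hdiff t ht K _ (T.polyMap_mem_closedElem (hξ j))
    have h1 := (hF t htI).comp_hasDerivAt t had
    refine (h1.congr_of_eventuallyEq ?_).congr_deriv ?_
    · filter_upwards [hnhds] with τ hτ using hfun τ hτ
    · rw [ContinuousLinearMap.integral_apply, T.setIntegral_elem]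
      · refine setIntegral_congr_fun hKm fun x hx => ?_
        have hx' : x ∈ closure T.Kref := subset_closure hx
        have hlin : HasDerivAt (fun τ => ∑ j, ℓ j x • a τ j) (∑ j, ℓ j x • deriv a t j) t :=
          HasDerivAt.fun_sum fun j _ => (hasDerivAt_pi.1 had j).const_smul (ℓ j x)
        have hGd : HasFDerivAt G (fderiv ℝ G (∑ j, ℓ j x • a t j)) (∑ j, ℓ j x • a t j) :=
          ((hG.contDiffAt (hX.mem_nhds (haX t htI x hx'))).differentiableAt
            (by simp)).hasFDerivAt
        have hcomp : HasDerivAt (fun τ => G (v τ K (ψ x)))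
            (fderiv ℝ G (∑ j, ℓ j x • a t j) (∑ j, ℓ j x • deriv a t j)) t := by
          refine (hGd.comp_hasDerivAt t hlin).congr_of_eventuallyEq ?_
          filter_upwards [hnhds] with τ hτ
          rw [Function.comp_apply, hv τ hτ x hx']
        change _ = D x * deriv (fun τ => G (v τ K (ψ x))) t
        rw [hcomp.deriv]
        simp
      · have hfc : ContinuousOn (fderiv ℝ G) X := hG.continuousOn_fderiv_of_isOpen hX le_rfl
        refine (ContinuousOn.integrableOn_compact T.Kref_polytope.isCompact_closure
          (hD.continuousOn.smul (ContinuousOn.clm_comp ?_ ?_))).mono_set subset_closure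
        · refine hfc.comp (Continuous.continuousOn ?_) fun x hx => haX t htI x hx
          exact continuous_finsetSum _ fun j _ => (hℓ j).smul continuous_const
        · exact (continuous_finsetSum _ fun j _ => (hℓ j).smul continuous_const).continuousOn

end Time

end Mesh

end EulerHDG

/-! ### The entropy flux through the boundary of an element -/

namespace EulerHDG
namespace Mesh

variable {e p : ℕ} {Λ : Submodule ℤ (Pt (e + 1))} {Ω : Set (Pt (e + 1))} (T : Mesh e p Λ Ω)

/-- The restriction of a member of `V_h^k` to a closed element extends smoothly. -/
lemma exists_extension {k : ℕ} {w : Fin T.numElem → Pt (e + 1) → State (e + 1)}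
    (hw : w ∈ T.VSpace k) (K : Fin T.numElem) :
    ∃ (U : Set (Pt (e + 1))) (W : Pt (e + 1) → State (e + 1)), IsOpen U ∧ T.closedElem K ⊆ U ∧
      ContDiffOn ℝ 1 W U ∧ ∀ x ∈ T.closedElem K, w K x = W x := by
  obtain ⟨Ψ, h1, h2, h3⟩ := T.exists_elemHomeomorph K
  choose P hP hPw using hw K
  refine ⟨Ψ.target, fun x i => MvPolynomial.eval (Ψ.symm x) (P i), Ψ.open_target, ?_, ?_, ?_⟩
  · rintro _ ⟨ξ, hξ, rfl⟩
    rw [← h1]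
    exact Ψ.map_source (h2 hξ)
  · exact contDiffOn_pi.2 fun i => (contDiff_eval (P i)).comp_contDiffOn h3
  · rintro _ ⟨ξ, hξ, rfl⟩
    funext i
    rw [hPw i ξ hξ, ← h1]
    simp only [Ψ.left_inv (h2 hξ)]

/-- The divergence theorem for functions that are `C^1` near the closed element. -/
theorem integral_fderiv_elem_of_contDiffOn (K : Fin T.numElem) (c : Pt (e + 1))
    {U : Set (Pt (e + 1))} (hU : IsOpen U) (hKU : T.closedElem K ⊆ U) {f : Pt (e + 1) → ℝ}
    (hf : ContDiffOn ℝ 1 f U) :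
    ∫ x in T.elem K, fderiv ℝ f x c = T.bdryFlux K c f := by
  obtain ⟨A, hA, hKA, hAU⟩ := exists_compact_between (T.isCompact_closedElem K) hU hKU
  -- Multiplying by `χ` makes `f` globally `C^1` with compact support without changing it on the
  -- closed element.
  obtain ⟨χ, hχ1, hχ0, -⟩ := exists_contMDiffMap_one_nhds_of_subset_interior (n := 1)
    𝓘(ℝ, Pt (e + 1)) (T.isCompact_closedElem K).isClosed hKA
  have hχ : ContDiff ℝ 1 χ := χ.contMDiff.contDiff
  have hsupp : tsupport (fun x => χ x * f x) ⊆ A := by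
    refine closure_minimal (fun x hx => ?_) hA.isClosed
    by_contra hcon
    exact hx (by simp only [hχ0 x hcon, zero_mul])
  have hg : ContDiff ℝ 1 (fun x => χ x * f x) := by
    refine contDiff_iff_contDiffAt.2 fun x => ?_
    by_cases hx : x ∈ tsupport (fun x => χ x * f x)
    · exact hχ.contDiffAt.mul (hf.contDiffAt (hU.mem_nhds (hAU (hsupp hx))))
    · exact contDiffAt_const.congr_of_eventuallyEq (notMem_tsupport_iff_eventuallyEq.1 hx)
  have h1 : ∀ x ∈ T.closedElem K, χ x = 1 := fun x hx => hχ1.self_of_nhdsSet x hx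
  have key := T.integral_fderiv_elem K c hg
    (hA.of_isClosed_subset (isClosed_tsupport _) hsupp)
  have e1 : ∫ x in T.elem K, fderiv ℝ (fun x => χ x * f x) x c =
      ∫ x in T.elem K, fderiv ℝ f x c := by
    refine setIntegral_congr_fun (T.isOpen_elem K).measurableSet fun x hx => ?_
    have : (fun x => χ x * f x) =ᶠ[𝓝 x] f := by
      filter_upwards [(T.isOpen_elem K).mem_nhds hx] with y hy
      rw [h1 y (T.elem_subset_closedElem K hy), one_mul]
    simp only [this.fderiv_eq]
  have e2 : T.bdryFlux K c (fun x => χ x * f x) = T.bdryFlux K c f := by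
    refine Finset.sum_congr rfl fun F _ => Finset.sum_congr rfl fun s _ => ?_
    split_ifs with hadj
    · refine setIntegral_congr_fun T.Fref_polytope.isOpen.measurableSet fun y hy => ?_
      have := T.sideMap_mem_closedElem (F := F) (s := s) (subset_closure hy)
      rw [hadj] at this
      simp only [h1 _ this, one_mul]
    · rfl
  rw [← e1, ← e2, key]

lemma sum_elem_faces (f : Fin T.numFace → Bool → Fin T.numElem → ℝ) :
    ∑ K, ∑ F, ∑ s, (if T.adj F s = K then f F s K else 0) = ∑ F, ∑ s, f F s (T.adj F s) := by
  rw [Finset.sum_comm]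
  refine Finset.sum_congr rfl fun F _ => ?_
  rw [Finset.sum_comm]
  refine Finset.sum_congr rfl fun s _ => ?_
  rw [Finset.sum_ite_eq, if_pos (Finset.mem_univ _)]

lemma dotProduct_single_one (n : Pt (e + 1)) (j : Fin (e + 1)) :
    n ⬝ᵥ (Pi.single j 1 : Pt (e + 1)) = n j := by simp

section Flux

variable {γ s₀ : ℝ} {k : ℕ} {w : Fin T.numElem → Pt (e + 1) → State (e + 1)}

lemma continuousOn_trace (hw : w ∈ T.VSpace k) (F : Fin T.numFace) (s : Bool) :
    ContinuousOn (fun y => w (T.adj F s) (T.sideMap F s y)) (closure T.Fref) := by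
  obtain ⟨U, W, -, hKU, hW, hwW⟩ := T.exists_extension hw (T.adj F s)
  refine ContinuousOn.congr (f := fun y => W (T.sideMap F s y)) ?_
    fun y hy => hwW _ (T.sideMap_mem_closedElem hy)
  exact hW.continuousOn.comp (T.continuous_sideMap F s).continuousOn
    fun y hy => hKU (T.sideMap_mem_closedElem hy)

lemma continuousOn_elem (hw : w ∈ T.VSpace k) (K : Fin T.numElem) :
    ContinuousOn (w K) (T.closedElem K) := by
  obtain ⟨U, W, -, hKU, hW, hwW⟩ := T.exists_extension hw K
  exact (hW.continuousOn.mono hKU).congr hwW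

lemma integrableOn_normalPotential (hγ : 1 < γ) (F : Fin T.numFace) (s : Bool)
    {b : Pt e → State (e + 1)} (hb : ContinuousOn b (closure T.Fref))
    (hbX : ∀ y ∈ closure T.Fref, b y ∈ physicalV (e + 1) γ s₀) :
    IntegrableOn (fun y => normalPotential γ s₀ (T.normal F s y) (b y) * T.surfElt F y)
      T.Fref := by
  have h : ∀ j, IntegrableOn (fun y => (γ - 1) * momentum (consVar γ s₀ (b y)) j *
      ((T.normal F s y ⬝ᵥ (Pi.single j 1 : Pt (e + 1))) * T.surfElt F y)) T.Fref := fun j =>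
    T.integrableOn_mul_of_continuousOn (continuousOn_const.mul
      ((continuous_apply _).comp_continuousOn
        ((contDiffOn_consVar hγ).continuousOn.comp hb hbX)))
      (T.integrableOn_normal_mul_surfElt F s _)
  refine (integrable_finsetSum Finset.univ fun j _ => h j).congr (Eventually.of_forall fun y => ?_)
  simp only [normalPotential, Finset.sum_mul, dotProduct_single_one, mul_assoc]

/-- The volume integral `∑_K ∫_K F(v) : ∇v` is the flux of the entropy flux potential. -/
lemma volInt_flux (hγ : 1 < γ) (hw : w ∈ T.VSpace k)
    (hwX : ∀ K, ∀ x ∈ T.closedElem K, w K x ∈ physicalV (e + 1) γ s₀) :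
    T.volInt (fun K x => ∑ i, ∑ j, flux γ (consVar γ s₀ (w K x)) i j *
        fderiv ℝ (fun z => w K z i) x (Pi.single j 1)) =
      T.bdryInt (fun F s y => normalPotential γ s₀ (T.normal F s y)
        (w (T.adj F s) (polyMap (T.faceMap F) y + T.shift F s))) := by
  have helem : ∀ K, ∫ x in T.elem K, ∑ i, ∑ j, flux γ (consVar γ s₀ (w K x)) i j *
        fderiv ℝ (fun z => w K z i) x (Pi.single j 1) =
      ∑ F, ∑ s, if T.adj F s = K then ∫ y in T.Fref, normalPotential γ s₀ (T.normal F s y)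
        (w K (T.sideMap F s y)) * T.surfElt F y else 0 := by
    intro K
    obtain ⟨U₀, W, hU₀, hKU₀, hW₀, hwW⟩ := T.exists_extension hw K
    -- The extension may leave `X_v` off the element; openness of `X_v` leaves a neighbourhood where
    -- it does not.
    set U := U₀ ∩ W ⁻¹' physicalV (e + 1) γ s₀ with hUdef
    have hU : IsOpen U := hW₀.continuousOn.isOpen_inter_preimage hU₀ (isOpen_physicalV hγ)
    have hKU : T.closedElem K ⊆ U := fun x hx =>
      ⟨hKU₀ hx, by rw [mem_preimage, ← hwW x hx]; exact hwX K x hx⟩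
    have hW : ContDiffOn ℝ 1 W U := hW₀.mono inter_subset_left
    have hf : ∀ j, ContDiffOn ℝ 1 (fun x => (γ - 1) * momentum (consVar γ s₀ (W x)) j) U := by
      intro j
      refine contDiffOn_const.mul ?_
      exact contDiffOn_pi.1 (((contDiffOn_consVar hγ).of_le le_top).comp hW fun x hx => hx.2) _
    have hWd : ∀ x ∈ U, DifferentiableAt ℝ W x := fun x hx =>
      (hW.contDiffAt (hU.mem_nhds hx)).differentiableAt (by simp)
    have hder : ∀ x ∈ U, ∀ j, fderiv ℝ (fun x => (γ - 1) * momentum (consVar γ s₀ (W x)) j) x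
        (Pi.single j 1) = ∑ i, flux γ (consVar γ s₀ (W x)) i j *
          fderiv ℝ W x (Pi.single j 1) i := by
      intro x hx j
      -- Restricting to a line turns the partial derivative into the curve derivative of
      -- `hasDerivAt_fluxPotential`.
      have hl : HasDerivAt (fun τ : ℝ => x + τ • (Pi.single j 1 : Pt (e + 1)))
          (Pi.single j 1) 0 := by
        simpa using ((hasDerivAt_id (0 : ℝ)).smul_const
          (Pi.single j 1 : Pt (e + 1))).const_add x
      have hx0 : x + (0 : ℝ) • (Pi.single j 1 : Pt (e + 1)) = x := by simp
      have h1 : HasDerivAt (fun τ : ℝ => W (x + τ • (Pi.single j 1 : Pt (e + 1))))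
          (fderiv ℝ W x (Pi.single j 1)) 0 := by
        have := (hWd x hx).hasFDerivAt
        rw [← hx0] at this
        have h := this.comp_hasDerivAt (0 : ℝ) hl
        rwa [hx0] at h
      have h2 := hasDerivAt_fluxPotential (s₀ := s₀) hγ h1 (by rw [hx0]; exact hx.2) j
      rw [hx0] at h2
      have h3 : DifferentiableAt ℝ (fun x => (γ - 1) * momentum (consVar γ s₀ (W x)) j) x :=
        ((hf j).contDiffAt (hU.mem_nhds hx)).differentiableAt (by simp)
      have h4 : HasDerivAt (fun τ : ℝ => (γ - 1) * momentum (consVar γ s₀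
          (W (x + τ • (Pi.single j 1 : Pt (e + 1))))) j)
          (fderiv ℝ (fun x => (γ - 1) * momentum (consVar γ s₀ (W x)) j) x
            (Pi.single j 1)) 0 := by
        have := h3.hasFDerivAt
        rw [← hx0] at this
        have h := this.comp_hasDerivAt (0 : ℝ) hl
        rwa [hx0] at h
      exact h4.unique h2
    have h1 : ∫ x in T.elem K, ∑ i, ∑ j, flux γ (consVar γ s₀ (w K x)) i j *
        fderiv ℝ (fun z => w K z i) x (Pi.single j 1) =
        ∫ x in T.elem K, ∑ j, fderiv ℝ (fun x => (γ - 1) * momentum (consVar γ s₀ (W x)) j) x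
          (Pi.single j 1) := by
      refine setIntegral_congr_fun (T.isOpen_elem K).measurableSet fun x hx => ?_
      have hxc := T.elem_subset_closedElem K hx
      have hxU := hKU hxc
      rw [Finset.sum_comm]
      refine Finset.sum_congr rfl fun j _ => ?_
      rw [hder x hxU j]
      refine Finset.sum_congr rfl fun i _ => ?_
      have hloc : (fun z => w K z i) =ᶠ[𝓝 x] fun z => W z i := by
        filter_upwards [(T.isOpen_elem K).mem_nhds hx] with z hz
        rw [hwW z (T.elem_subset_closedElem K hz)]
      rw [hloc.fderiv_eq, hwW x hxc, fderiv_apply (hWd x hxU) i]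
      rfl
    have hint : ∀ j, IntegrableOn (fun x => fderiv ℝ (fun x => (γ - 1) *
        momentum (consVar γ s₀ (W x)) j) x (Pi.single j 1)) (T.elem K) := fun j =>
      T.integrableOn_elem K ((((hf j).continuousOn_fderiv_of_isOpen hU le_rfl).clm_apply
        continuousOn_const).mono hKU)
    rw [h1, integral_finsetSum _ fun j _ => hint j]
    simp only [T.integral_fderiv_elem_of_contDiffOn K _ hU hKU (hf _), bdryFlux]
    rw [Finset.sum_comm]
    refine Finset.sum_congr rfl fun F _ => ?_
    rw [Finset.sum_comm]
    refine Finset.sum_congr rfl fun s _ => ?_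
    split_ifs with hadj
    · have hmem : ∀ y ∈ closure T.Fref, T.sideMap F s y ∈ T.closedElem K := fun y hy => by
        have := T.sideMap_mem_closedElem (F := F) (s := s) hy
        rwa [hadj] at this
      rw [← integral_finsetSum]
      · refine setIntegral_congr_fun T.Fref_polytope.isOpen.measurableSet fun y hy => ?_
        simp only [normalPotential, Finset.sum_mul, dotProduct_single_one, mul_assoc]
        rw [hwW _ (hmem y (subset_closure hy))]
      · intro j _
        refine T.integrableOn_mul_of_continuousOn ?_ (T.integrableOn_normal_mul_surfElt F s _)
        exact ((hf j).continuousOn.mono hKU).comp (T.continuous_sideMap F s).continuousOn hmem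
    · exact Finset.sum_const_zero
  rw [volInt, Finset.sum_congr rfl fun K _ => helem K,
    T.sum_elem_faces fun F s K => ∫ y in T.Fref, normalPotential γ s₀ (T.normal F s y)
        (w K (T.sideMap F s y)) * T.surfElt F y]
  rfl

end Flux

end Mesh
end EulerHDG

/-! ### Entropy balance of the semi-discretization -/

namespace EulerHDG

lemma contDiffOn_genEntropy_consVar {d : ℕ} {γ s₀ : ℝ} (hγ : 1 < γ) :
    ContDiffOn ℝ 1 (fun v : State d => genEntropy γ s₀ (consVar γ s₀ v))
      (physicalV d γ s₀) := by
  have h1 : ContDiffOn ℝ 1 (consVar (d := d) γ s₀) (physicalV d γ s₀) :=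
    (contDiffOn_consVar hγ).of_le le_top
  have h2 : ContDiffOn ℝ 1 (densityOfEntropyVar (d := d) γ s₀) (physicalV d γ s₀) := by
    rw [physicalV_eq hγ]
    exact contDiffOn_densityOfEntropyVar.of_le le_top
  have h3 : ContDiffOn ℝ 1 (fun v : State d => consVar γ s₀ v ⬝ᵥ v) (physicalV d γ s₀) :=
    ContDiffOn.sum fun i _ => (contDiffOn_pi.1 h1 i).mul (contDiff_apply ℝ ℝ i).contDiffOn
  exact (h3.sub (contDiffOn_const.mul h2)).congr fun v hv => genEntropy_consVar hγ hv

lemma normalPotential_neg {d : ℕ} (γ s₀ : ℝ) (n : Pt d) (v : State d) :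
    normalPotential γ s₀ (-n) v = -normalPotential γ s₀ n v := by
  simp [normalPotential]

/-- A hypersurface has only two unit normals. -/
lemma eq_or_eq_neg_of_orthogonal {e : ℕ} {n n' : Pt (e + 1)}
    {J : Matrix (Fin (e + 1)) (Fin e) ℝ} (hn : n ⬝ᵥ n = 1) (hn' : n' ⬝ᵥ n' = 1)
    (hJ : n ᵥ* J = 0) (hJ' : n' ᵥ* J = 0) (hdet : (Jᵀ * J).det ≠ 0) : n' = n ∨ n' = -n := by
  have h1 := det_consCol_mul n n J hJ
  rw [hn, one_mul] at h1
  have hM : IsUnit (consCol n J) := by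
    rw [Matrix.isUnit_iff_isUnit_det, isUnit_iff_ne_zero]
    intro h0
    rw [h0, zero_mul] at h1
    exact hdet h1.symm
  -- As `(n | J)` is invertible, a vector orthogonal to `J` is determined by its component along
  -- `n`.
  have key : ∀ w : Pt (e + 1), w ᵥ* J = 0 → w ᵥ* consCol n J = Pi.single 0 (w ⬝ᵥ n) := by
    intro w hw
    funext i
    refine Fin.cases ?_ (fun j => ?_) i
    · simp [Matrix.vecMul, consCol_zero, dotProduct]
    · have := congrFun hw j
      simpa [Matrix.vecMul, consCol_succ, dotProduct] using this
  have h2 : n' = (n' ⬝ᵥ n) • n := by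
    refine Matrix.vecMul_injective_of_isUnit hM ?_
    simp only [Matrix.smul_vecMul, key n hJ, key n' hJ', hn]
    rw [← Pi.single_smul, smul_eq_mul, mul_one]
  have h3 : (n' ⬝ᵥ n) * (n' ⬝ᵥ n) = 1 := by
    have := hn'
    rw [h2, smul_dotProduct, dotProduct_smul, hn] at this
    simp only [smul_eq_mul, mul_one] at this
    exact this
  rcases mul_self_eq_one_iff.1 h3 with h | h
  · left; rw [h2, h, one_smul]
  · right; rw [h2, h, neg_one_smul]

namespace Mesh

variable {e p : ℕ} {Λ : Submodule ℤ (Pt (e + 1))} {Ω : Set (Pt (e + 1))} (T : Mesh e p Λ Ω)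

/-- The normals on the two sides of a face are opposite. -/
lemma normal_true_eq_neg (hΩ : IsPeriodCell Λ Ω) {F : Fin T.numFace} {y : Pt e}
    (hy : y ∈ T.Fref) : T.normal F true y = -T.normal F false y := by
  rcases eq_or_eq_neg_of_orthogonal (T.normal_unit F false y hy) (T.normal_unit F true y hy)
    (T.normal_orthogonal F false y hy) (T.normal_orthogonal F true y hy)
    (T.faceMap_nonsingular F y (subset_closure hy)) with h | h
  swap
  · exact h
  exfalso
  -- Equal normals would put one inward step, up to a period, in both adjacent elements. Equal
  -- shifts then contradict disjointness of the elements, different shifts that of the translates of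
  -- `Ω`.
  obtain ⟨r, h1, h2⟩ := ((T.normal_outward F true y hy).and
    (T.normal_outward F false y hy)).exists
  rw [h] at h1
  have hz : polyMap (T.faceMap F) y + T.shift F true - r • T.normal F false y =
      (polyMap (T.faceMap F) y + T.shift F false - r • T.normal F false y) +
        (T.shift F true - T.shift F false) := by abel
  by_cases hl : T.shift F true - T.shift F false = 0
  · have hadj : T.adj F true ≠ T.adj F false := fun h =>
      T.sides_ne F (Prod.ext h (sub_eq_zero.1 hl))
    rw [sub_eq_zero.1 hl] at h1
    exact disjoint_left.1 (T.elem_disjoint _ _ hadj) h1 h2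
  · refine disjoint_left.1 (hΩ.disjoint _ (Λ.sub_mem (T.shift_mem F true)
      (T.shift_mem F false)) hl) (T.elem_subset _ h1) ⟨_, T.elem_subset _ h2, hz.symm⟩

lemma const_mem_VSpace (k : ℕ) (a : State (e + 1)) : (fun _ _ => a) ∈ T.VSpace k :=
  fun _ i => ⟨MvPolynomial.C (a i), by simp, fun x _ => by simp⟩

lemma const_mem_MSpace (k : ℕ) (EE : Set (Fin T.numFace)) (a : State (e + 1)) :
    (fun _ _ => a) ∈ T.MSpace k EE :=
  ⟨fun _ i => ⟨MvPolynomial.C (a i), by simp, fun x _ => by simp⟩,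
    fun _ _ _ _ _ _ _ _ _ => rfl⟩

lemma bdryInt_sub {f g : Fin T.numFace → Bool → Pt e → ℝ}
    (hf : ∀ F s, IntegrableOn (fun y => f F s y * T.surfElt F y) T.Fref)
    (hg : ∀ F s, IntegrableOn (fun y => g F s y * T.surfElt F y) T.Fref) :
    T.bdryInt (fun F s y => f F s y - g F s y) = T.bdryInt f - T.bdryInt g := by
  simp only [bdryInt, ← Finset.sum_sub_distrib]
  refine Finset.sum_congr rfl fun F _ => Finset.sum_congr rfl fun s _ => ?_
  rw [← integral_sub (hf F s) (hg F s)]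
  simp only [sub_mul]

lemma bdryInt_nonpos {f : Fin T.numFace → Bool → Pt e → ℝ}
    (hf : ∀ F s, ∀ y ∈ T.Fref, f F s y ≤ 0) : T.bdryInt f ≤ 0 := by
  refine Finset.sum_nonpos fun F _ => Finset.sum_nonpos fun s _ => ?_
  refine setIntegral_nonpos T.Fref_polytope.isOpen.measurableSet fun y hy => ?_
  exact mul_nonpos_of_nonpos_of_nonneg (hf F s y hy) (Real.sqrt_nonneg _)

lemma integrableOn_dotProduct {f b : Pt e → State (e + 1)} {F : Fin T.numFace}
    (hf : ∀ i, IntegrableOn (fun y => f y i * T.surfElt F y) T.Fref)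
    (hb : ContinuousOn b (closure T.Fref)) :
    IntegrableOn (fun y => (f y ⬝ᵥ b y) * T.surfElt F y) T.Fref := by
  have h : ∀ i, IntegrableOn (fun y => b y i * (f y i * T.surfElt F y)) T.Fref := fun i =>
    T.integrableOn_mul_of_continuousOn ((continuous_apply i).comp_continuousOn hb) (hf i)
  refine (integrable_finsetSum Finset.univ fun i _ => h i).congr
    (Eventually.of_forall fun y => ?_)
  simp only [dotProduct, Finset.sum_mul]
  exact Finset.sum_congr rfl fun i _ => by ring

lemma continuousOn_faceTrace {k : ℕ} {EE : Set (Fin T.numFace)}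
    {μ : Fin T.numFace → Pt (e + 1) → State (e + 1)} (hμ : μ ∈ T.MSpace k EE)
    (F : Fin T.numFace) :
    ContinuousOn (fun y => μ F (polyMap (T.faceMap F) y)) (closure T.Fref) := by
  refine continuousOn_pi.2 fun i => ?_
  obtain ⟨P, -, hP⟩ := hμ.1 F i
  exact (contDiff_eval (n := 0) P).continuous.continuousOn.congr hP

/-- Contributions of single-valued traces cancel. -/
lemma bdryInt_normalPotential_eq_zero (hΩ : IsPeriodCell Λ Ω) (γ s₀ : ℝ)
    (a : Fin T.numFace → Pt e → State (e + 1)) :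
    T.bdryInt (fun F s y => normalPotential γ s₀ (T.normal F s y) (a F y)) = 0 := by
  refine Finset.sum_eq_zero fun F _ => ?_
  rw [Fintype.sum_bool, ← eq_neg_iff_add_eq_zero, ← integral_neg]
  refine setIntegral_congr_fun T.Fref_polytope.isOpen.measurableSet fun y hy => ?_
  simp only
  rw [T.normal_true_eq_neg hΩ hy, normalPotential_neg, neg_mul]

section Solution

variable {k : ℕ} {EE : Set (Fin T.numFace)} {γ s₀ tf : ℝ}
  {σ : State (e + 1) → State (e + 1) → Pt (e + 1) → Matrix (Comp (e + 1)) (Comp (e + 1)) ℝ}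
  {u₀ : Pt (e + 1) → State (e + 1)} {v : ℝ → Fin T.numElem → Pt (e + 1) → State (e + 1)}
  {vhat : ℝ → Fin T.numFace → Pt (e + 1) → State (e + 1)}

/-- The semi-discretization dissipates entropy. -/
lemma IsSolution.volInt_entropy_rate_nonpos {T : Mesh e p Λ Ω} (hγ : 1 < γ)
    (hΩ : IsPeriodCell Λ Ω) (hσ : IsEntropyStable γ s₀ σ)
    {v : ℝ → Fin T.numElem → Pt (e + 1) → State (e + 1)}
    {vhat : ℝ → Fin T.numFace → Pt (e + 1) → State (e + 1)} {EE : Set (Fin T.numFace)}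
    (hsol : T.IsSolution k EE γ s₀ tf σ u₀ v vhat) (hphys : T.IsPhysical γ s₀ tf v vhat)
    {t : ℝ} (ht : t ∈ Ioo 0 tf) :
    T.volInt (fun K x => deriv (fun τ => consVar γ s₀ (v τ K x)) t ⬝ᵥ v t K x) ≤ 0 := by
  have htI : t ∈ Ico 0 tf := Ioo_subset_Ico_self ht
  have hV := hsol.mem_V t htI
  have hM := hsol.mem_M t ht
  -- The solution is its own test function, here and in the face equation; this is where the entropy
  -- variables as unknowns matter.
  have e1 := hsol.eq_elem t ht _ hV
  rw [T.volInt_flux hγ hV (hphys.1 t htI)] at e1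
  have e2 := hsol.eq_face t ht _ hM
  have e3 := T.bdryInt_normalPotential_eq_zero hΩ γ s₀
    (fun F y => vhat t F (polyMap (T.faceMap F) y))
  have hbX : ∀ F s, ∀ y ∈ closure T.Fref,
      v t (T.adj F s) (polyMap (T.faceMap F) y + T.shift F s) ∈ physicalV (e + 1) γ s₀ :=
    fun F s y hy => hphys.1 t htI _ _ (T.sideMap_mem_closedElem hy)
  have haX : ∀ F, ∀ y ∈ closure T.Fref,
      vhat t F (polyMap (T.faceMap F) y) ∈ physicalV (e + 1) γ s₀ :=
    fun F y hy => hphys.2 t ht F _ ⟨y, hy, rfl⟩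
  have i1 := fun F s => T.integrableOn_normalPotential hγ F s (T.continuousOn_trace hV F s)
    (hbX F s)
  have i2 := fun F (s : Bool) => T.integrableOn_normalPotential hγ F s
    (T.continuousOn_faceTrace hM F) (haX F)
  have i3 := fun F s => T.integrableOn_dotProduct (hsol.flux_integrable t ht F s)
    (T.continuousOn_trace hV F s)
  have i4 := fun F s => T.integrableOn_dotProduct (hsol.flux_integrable t ht F s)
    (T.continuousOn_faceTrace hM F)
  have i12 := fun F s => ((i1 F s).sub (i2 F s)).congr (Eventually.of_forall fun y =>
    (sub_mul _ _ (T.surfElt F y)).symm)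
  have i34 := fun F s => ((i3 F s).sub (i4 F s)).congr (Eventually.of_forall fun y =>
    (sub_mul _ _ (T.surfElt F y)).symm)
  -- Collects both tested equations and the vanishing `v̂_h` potentials into one integrand with a
  -- sign on each side of each face.
  have hle := T.bdryInt_nonpos (f := fun F s y =>
    (normalPotential γ s₀ (T.normal F s y) (v t (T.adj F s) (T.sideMap F s y)) -
      normalPotential γ s₀ (T.normal F s y) (vhat t F (polyMap (T.faceMap F) y))) -
    (T.numFlux γ s₀ σ (v t) (vhat t) F s y ⬝ᵥ v t (T.adj F s) (T.sideMap F s y) -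
      T.numFlux γ s₀ σ (v t) (vhat t) F s y ⬝ᵥ vhat t F (polyMap (T.faceMap F) y)))
    (fun F s y hy => by
      rw [← dotProduct_sub, sub_nonpos]
      exact hσ.potential_jump_le hγ (T.normal_unit F s y hy) (haX F y (subset_closure hy))
        (hbX F s y (subset_closure hy)))
  rw [T.bdryInt_sub i12 i34, T.bdryInt_sub i1 i2, T.bdryInt_sub i3 i4, e3, e2] at hle
  simp only [sideMap] at hle
  linarith

/-- The semi-discretization conserves mass, momentum and energy. -/
lemma IsSolution.volInt_rate_eq_zero {T : Mesh e p Λ Ω}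
    {v : ℝ → Fin T.numElem → Pt (e + 1) → State (e + 1)}
    {vhat : ℝ → Fin T.numFace → Pt (e + 1) → State (e + 1)} {EE : Set (Fin T.numFace)}
    (hsol : T.IsSolution k EE γ s₀ tf σ u₀ v vhat) {t : ℝ} (ht : t ∈ Ioo 0 tf)
    (a : State (e + 1)) :
    T.volInt (fun K x => deriv (fun τ => consVar γ s₀ (v τ K x)) t ⬝ᵥ a) = 0 := by
  have e1 := hsol.eq_elem t ht _ (T.const_mem_VSpace k a)
  have e2 := hsol.eq_face t ht _ (T.const_mem_MSpace k EE a)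
  rw [e2] at e1
  simpa [volInt] using e1

lemma volInt_time {X : Set (State (e + 1))} {G : State (e + 1) → ℝ} (hX : IsOpen X)
    (hG : ContDiffOn ℝ 1 G X) (hsol : T.IsSolution k EE γ s₀ tf σ u₀ v vhat)
    (hvX : ∀ t ∈ Ico 0 tf, ∀ K, ∀ x ∈ T.closedElem K, v t K x ∈ X) :
    ContinuousOn (fun τ => T.volInt (fun K x => G (v τ K x))) (Ico 0 tf) ∧
    ∀ t ∈ Ioo 0 tf, HasDerivAt (fun τ => T.volInt (fun K x => G (v τ K x)))
      (T.volInt (fun K x => deriv (fun τ => G (v τ K x)) t)) t := by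
  have h := fun K => T.integral_elem_time hX hG hsol.mem_V hsol.continuousOn
    hsol.differentiableAt hvX K
  exact ⟨continuousOn_finsetSum _ fun K _ => (h K).1,
    fun t ht => HasDerivAt.fun_sum fun K _ => (h K).2 t ht⟩

lemma volInt_congr {f g : Fin T.numElem → Pt (e + 1) → ℝ}
    (h : ∀ K, ∀ x ∈ T.closedElem K, f K x = g K x) : T.volInt f = T.volInt g :=
  Finset.sum_congr rfl fun K _ => setIntegral_congr_fun (T.isOpen_elem K).measurableSet
    fun x hx => h K x (T.elem_subset_closedElem K hx)

lemma hasDerivAt_totalEntropy (hγ : 1 < γ) (hsol : T.IsSolution k EE γ s₀ tf σ u₀ v vhat)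
    (hphys : T.IsPhysical γ s₀ tf v vhat) {t : ℝ} (ht : t ∈ Ioo 0 tf) :
    HasDerivAt (fun τ => T.totalEntropy γ s₀ (v τ))
      (T.volInt (fun K x => deriv (fun τ => consVar γ s₀ (v τ K x)) t ⬝ᵥ v t K x)) t := by
  have h := (T.volInt_time (isOpen_physicalV hγ) (contDiffOn_genEntropy_consVar hγ) hsol
    hphys.1).2 t ht
  refine h.congr_deriv (T.volInt_congr fun K x hx => ?_)
  exact (hasDerivAt_genEntropy hγ (hsol.differentiableAt t ht K x hx).hasDerivAt
    (hphys.1 t (Ioo_subset_Ico_self ht) K x hx)).deriv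

/-- The integrals of the conservation variables do not depend on time. -/
lemma volInt_consVar_eq (hγ : 1 < γ) (hsol : T.IsSolution k EE γ s₀ tf σ u₀ v vhat)
    (hphys : T.IsPhysical γ s₀ tf v vhat) {t : ℝ} (ht : t ∈ Ico 0 tf) (i : Comp (e + 1)) :
    T.volInt (fun K x => consVar γ s₀ (v t K x) i) =
      T.volInt (fun K x => consVar γ s₀ (v 0 K x) i) := by
  have hG : ContDiffOn ℝ 1 (fun w : State (e + 1) => consVar γ s₀ w i)
      (physicalV (e + 1) γ s₀) :=
    contDiffOn_pi.1 ((contDiffOn_consVar hγ).of_le le_top) i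
  obtain ⟨hc, hd⟩ := T.volInt_time (isOpen_physicalV hγ) hG hsol hphys.1
  have hd0 : ∀ t ∈ Ioo 0 tf, HasDerivAt
      (fun τ => T.volInt (fun K x => consVar γ s₀ (v τ K x) i)) 0 t := by
    intro t ht
    refine (hd t ht).congr_deriv ?_
    rw [← hsol.volInt_rate_eq_zero ht (Pi.single i 1)]
    refine T.volInt_congr fun K x hx => ?_
    have h1 : DifferentiableAt ℝ (consVar γ s₀) (v t K x) :=
      (contDiffAt_consVar hγ (hphys.1 t (Ioo_subset_Ico_self ht) K x hx)).differentiableAt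
        (by simp)
    have h2 : HasDerivAt (fun τ => consVar γ s₀ (v τ K x))
        (deriv (fun τ => consVar γ s₀ (v τ K x)) t) t :=
      (h1.comp t (hsol.differentiableAt t ht K x hx)).hasDerivAt
    rw [(hasDerivAt_pi.1 h2 i).deriv]
    simp
  have hint : interior (Ico 0 tf) = Ioo 0 tf := interior_Ico
  have h0 : (0 : ℝ) ∈ Ico 0 tf := ⟨le_rfl, ht.1.trans_lt ht.2⟩
  have hdiff : DifferentiableOn ℝ (fun τ => T.volInt (fun K x => consVar γ s₀ (v τ K x) i))
      (interior (Ico 0 tf)) := by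
    rw [hint]
    exact fun t ht => (hd0 t ht).differentiableAt.differentiableWithinAt
  -- The derivative vanishes in the open interval and continuity reaches `t = 0`, so the integral is
  -- both antitone and monotone.
  refine le_antisymm ?_ ?_
  · refine antitoneOn_of_deriv_nonpos (convex_Ico 0 tf) hc hdiff ?_ h0 ht ht.1
    rw [hint]
    exact fun t ht => (hd0 t ht).deriv.le
  · refine monotoneOn_of_deriv_nonneg (convex_Ico 0 tf) hc hdiff ?_ h0 ht ht.1
    rw [hint]
    exact fun t ht => (hd0 t ht).deriv.ge

end Solution

/-! ### The mean state and Jensen's inequality -/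

lemma isPeriodCell_nonempty (hΩ : IsPeriodCell Λ Ω) : Ω.Nonempty := by
  obtain ⟨l, -, h⟩ := hΩ.cover 0
  exact closure_nonempty_iff.1 ⟨_, h⟩

/-- The closed elements cover `Ω`, and their boundaries are null. -/
lemma sum_volume_elem :
    ∑ K, volume.real (T.elem K) = volume.real Ω := by
  have h1 : volume.real (⋃ K, T.elem K) = ∑ K, volume.real (T.elem K) :=
    measureReal_iUnion_fintype (fun K K' h => T.elem_disjoint K K' h)
      (fun K => (T.isOpen_elem K).measurableSet)
      (fun K => ne_top_of_le_ne_top (T.isCompact_closedElem K).measure_lt_top.ne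
        (measure_mono (T.elem_subset_closedElem K)))
  rw [← h1]
  refine measureReal_congr (LE.le.eventuallyLE (iUnion_subset T.elem_subset)
    |>.antisymm ?_)
  rw [ae_le_set]
  refine measure_mono_null (t := ⋃ K, (T.closedElem K \ T.elem K)) ?_
    (measure_iUnion_null fun K => T.volume_closedElem_diff K)
  rintro x ⟨hx, hx'⟩
  obtain ⟨K, hK⟩ := mem_iUnion.1 (T.elem_cover hx)
  exact mem_iUnion.2 ⟨K, hK, fun h => hx' (mem_iUnion.2 ⟨K, h⟩)⟩

lemma volInt_const (hΩ : IsPeriodCell Λ Ω) (a : ℝ) :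
    T.volInt (fun _ _ => a) = volume.real Ω * a := by
  simp only [volInt, setIntegral_const, smul_eq_mul]
  rw [← Finset.sum_mul, T.sum_volume_elem]

lemma volume_pos (hΩ : IsPeriodCell Λ Ω) : 0 < volume.real Ω :=
  ENNReal.toReal_pos (hΩ.isOpen.measure_pos volume (isPeriodCell_nonempty hΩ)).ne'
    hΩ.isBounded.measure_lt_top.ne

section Mean

variable {γ s₀ : ℝ} {k : ℕ} {w : Fin T.numElem → Pt (e + 1) → State (e + 1)}

lemma continuousOn_consVar_elem (hγ : 1 < γ) (hw : w ∈ T.VSpace k)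
    (hwX : ∀ K, ∀ x ∈ T.closedElem K, w K x ∈ physicalV (e + 1) γ s₀) (K : Fin T.numElem) :
    ContinuousOn (fun x => consVar γ s₀ (w K x)) (T.closedElem K) :=
  (contDiffOn_consVar hγ).continuousOn.comp (T.continuousOn_elem hw K) (hwX K)

lemma volInt_dotProduct (hγ : 1 < γ) (hw : w ∈ T.VSpace k)
    (hwX : ∀ K, ∀ x ∈ T.closedElem K, w K x ∈ physicalV (e + 1) γ s₀) (q : State (e + 1)) :
    T.volInt (fun K x => consVar γ s₀ (w K x) ⬝ᵥ q) =
      ∑ i, T.volInt (fun K x => consVar γ s₀ (w K x) i) * q i := by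
  simp only [volInt, Finset.sum_mul]
  rw [Finset.sum_comm]
  refine Finset.sum_congr rfl fun K _ => ?_
  have h : ∀ i, IntegrableOn (fun x => consVar γ s₀ (w K x) i * q i) (T.elem K) := fun i =>
    T.integrableOn_elem K (((continuous_apply i).comp_continuousOn
      (T.continuousOn_consVar_elem hγ hw hwX K)).mul continuousOn_const)
  simp only [dotProduct]
  rw [integral_finsetSum _ fun i _ => h i]
  simp only [integral_mul_const]

lemma meanState_dotProduct (hγ : 1 < γ) (hw : w ∈ T.VSpace k)
    (hwX : ∀ K, ∀ x ∈ T.closedElem K, w K x ∈ physicalV (e + 1) γ s₀) (q : State (e + 1)) :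
    T.meanState γ s₀ w ⬝ᵥ q =
      (1 / volume.real Ω) * T.volInt (fun K x => consVar γ s₀ (w K x) ⬝ᵥ q) := by
  rw [T.volInt_dotProduct hγ hw hwX, Finset.mul_sum]
  exact Finset.sum_congr rfl fun i _ => mul_assoc _ _ _

/-- Averaging preserves strict linear inequalities; density and pressure positivity of the mean are
both obtained from this. -/
lemma meanState_dotProduct_pos (hΩ : IsPeriodCell Λ Ω) (hγ : 1 < γ) (hw : w ∈ T.VSpace k)
    (hwX : ∀ K, ∀ x ∈ T.closedElem K, w K x ∈ physicalV (e + 1) γ s₀) {q : State (e + 1)}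
    (hq : ∀ u ∈ physicalU (e + 1) γ, 0 < u ⬝ᵥ q) : 0 < T.meanState γ s₀ w ⬝ᵥ q := by
  rw [T.meanState_dotProduct hγ hw hwX]
  refine mul_pos (one_div_pos.2 (volume_pos hΩ)) ?_
  have hne : Nonempty (Fin T.numElem) := by
    obtain ⟨x, hx⟩ := isPeriodCell_nonempty hΩ
    obtain ⟨K, -⟩ := mem_iUnion.1 (T.elem_cover hx)
    exact ⟨K⟩
  refine Finset.sum_pos (fun K _ => ?_) Finset.univ_nonempty
  have hpos : ∀ x ∈ T.elem K, 0 < consVar γ s₀ (w K x) ⬝ᵥ q := fun x hx =>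
    hq _ (consVar_mem (hwX K x (T.elem_subset_closedElem K hx)))
  have hm := (T.isOpen_elem K).measurableSet
  rw [setIntegral_pos_iff_support_of_nonneg_ae
    ((ae_restrict_mem hm).mono fun x hx => (hpos x hx).le)]
  · have : Function.support (fun x => consVar γ s₀ (w K x) ⬝ᵥ q) ∩ T.elem K = T.elem K :=
      inter_eq_right.2 fun x hx => (hpos x hx).ne'
    rw [this]
    exact (T.isOpen_elem K).measure_pos volume (T.Kref_polytope.1.image _)
  · refine T.integrableOn_elem K ?_
    exact continuousOn_finsetSum _ fun i _ => ((continuous_apply i).comp_continuousOn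
      (T.continuousOn_consVar_elem hγ hw hwX K)).mul continuousOn_const

/-- The mean state is physical. -/
lemma meanState_mem (hΩ : IsPeriodCell Λ Ω) (hγ : 1 < γ) (hw : w ∈ T.VSpace k)
    (hwX : ∀ K, ∀ x ∈ T.closedElem K, w K x ∈ physicalV (e + 1) γ s₀) :
    T.meanState γ s₀ w ∈ physicalU (e + 1) γ := by
  set m := T.meanState γ s₀ w with hm
  have hγ' : 0 < γ - 1 := by linarith
  have hρ : 0 < density m := by
    have := T.meanState_dotProduct_pos hΩ hγ hw hwX (q := Pi.single (Sum.inl ()) 1)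
      (fun u hu => by
        rw [dotProduct_single, mul_one]; exact hu.1)
    rw [dotProduct_single, mul_one] at this
    exact this
  refine ⟨hρ, ?_⟩
  -- The energy functional in the frame of the mean velocity. It is positive on physical states, and
  -- at the mean state it equals the internal energy.
  let q : State (e + 1) := fun i => match i with
    | Sum.inl _ => (∑ j, velocity m j ^ 2) / 2
    | Sum.inr (Sum.inl j) => -velocity m j
    | Sum.inr (Sum.inr _) => 1
  have hq : ∀ u : State (e + 1), u ⬝ᵥ q = energy u - ∑ j, velocity m j * momentum u j +
      (∑ j, velocity m j ^ 2) / 2 * density u := by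
    intro u
    rw [dotProduct_state]
    change density u * ((∑ j, velocity m j ^ 2) / 2) + (∑ j, momentum u j * -velocity m j +
      energy u * 1) = _
    have : ∑ j, momentum u j * -velocity m j = -∑ j, velocity m j * momentum u j := by
      rw [← Finset.sum_neg_distrib]
      exact Finset.sum_congr rfl fun j _ => by ring
    rw [this]; ring
  have h := T.meanState_dotProduct_pos hΩ hγ hw hwX (q := q) (fun u hu => by
    rw [hq, energy_sub_eq hu.1]
    have h1 : 0 ≤ ∑ j, (velocity u j - velocity m j) ^ 2 :=
      Finset.sum_nonneg fun j _ => sq_nonneg _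
    have h2 : 0 < energy u - density u * (∑ j, velocity u j ^ 2) / 2 :=
      (mul_pos_iff_of_pos_left hγ').1 hu.2
    have h3 := mul_nonneg hu.1.le h1
    linarith)
  rw [← hm, hq, energy_sub_eq hρ] at h
  simp only [sub_self, ne_eq, OfNat.ofNat_ne_zero, not_false_eq_true, zero_pow,
    Finset.sum_const_zero, mul_zero, zero_div, add_zero] at h
  exact mul_pos hγ' h

/-- Jensen's inequality for the entropy. -/
lemma volInt_genEntropy_le (hΩ : IsPeriodCell Λ Ω) (hγ : 1 < γ) (hw : w ∈ T.VSpace k)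
    (hwX : ∀ K, ∀ x ∈ T.closedElem K, w K x ∈ physicalV (e + 1) γ s₀) :
    T.volInt (fun _ _ => genEntropy γ s₀ (T.meanState γ s₀ w)) ≤ T.totalEntropy γ s₀ w := by
  set m := T.meanState γ s₀ w with hm
  have hmem := T.meanState_mem hΩ hγ hw hwX
  set q := entropyVar γ s₀ m with hq
  have hvol := volume_pos hΩ
  have hu : T.volInt (fun K x => consVar γ s₀ (w K x) ⬝ᵥ q) = volume.real Ω * (m ⬝ᵥ q) := by
    rw [hm, T.meanState_dotProduct hγ hw hwX]
    field_simp
  have hci : ∀ K, IntegrableOn (fun x => consVar γ s₀ (w K x) ⬝ᵥ q) (T.elem K) := fun K =>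
    T.integrableOn_elem K (continuousOn_finsetSum _ fun i _ =>
      ((continuous_apply i).comp_continuousOn
        (T.continuousOn_consVar_elem hγ hw hwX K)).mul continuousOn_const)
  have hconst : ∀ K (a : ℝ), IntegrableOn (fun _ => a) (T.elem K) := fun K a =>
    T.integrableOn_elem K continuousOn_const
  have hHi : ∀ K, IntegrableOn (fun x => genEntropy γ s₀ (consVar γ s₀ (w K x))) (T.elem K) :=
    fun K => T.integrableOn_elem K ((contDiffOn_genEntropy_consVar hγ).continuousOn.comp
      (T.continuousOn_elem hw K) (hwX K))
  -- Integrates the tangent plane inequality at the mean state; its linear part integrates to zero.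
  have hle : T.volInt (fun K x => (genEntropy γ s₀ m - m ⬝ᵥ q) + consVar γ s₀ (w K x) ⬝ᵥ q) ≤
      T.totalEntropy γ s₀ w := by
    refine Finset.sum_le_sum fun K _ => ?_
    refine setIntegral_mono_on ((hconst K _).add (hci K)) (hHi K)
      (T.isOpen_elem K).measurableSet fun x hx => ?_
    have := genEntropy_tangent (s₀ := s₀) hγ
      (consVar_mem (hwX K x (T.elem_subset_closedElem K hx))) hmem
    rw [sub_dotProduct] at this
    linarith
  have hsplit : T.volInt (fun K x => (genEntropy γ s₀ m - m ⬝ᵥ q) +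
      consVar γ s₀ (w K x) ⬝ᵥ q) = T.volInt (fun _ _ => genEntropy γ s₀ m - m ⬝ᵥ q) +
        T.volInt (fun K x => consVar γ s₀ (w K x) ⬝ᵥ q) := by
    simp only [volInt, ← Finset.sum_add_distrib]
    exact Finset.sum_congr rfl fun K _ => integral_add (hconst K _) (hci K)
  rw [hsplit, T.volInt_const hΩ, hu] at hle
  rw [T.volInt_const hΩ]
  linarith

end Mean

end Mesh
end EulerHDG

/-! ### Entropy stability -/

open EulerHDG
theorem theorem1 (e p k : ℕ) (γ s₀ tf : ℝ) (hγ : 1 < γ) (htf : 0 < tf)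
    (Λ : Submodule ℤ (Pt (e + 1))) [DiscreteTopology Λ] [IsZLattice ℝ Λ]
    (Ω : Set (Pt (e + 1))) (hΩ : IsPeriodCell Λ Ω)
    (T : Mesh e p Λ Ω) (EE : Set (Fin T.numFace))
    (σ : State (e + 1) → State (e + 1) → Pt (e + 1) → Matrix (Comp (e + 1)) (Comp (e + 1)) ℝ)
    (hσ : IsEntropyStable γ s₀ σ)
    (u₀ : Pt (e + 1) → State (e + 1)) (hu₀ : ∀ x ∈ Ω, u₀ x ∈ physicalU (e + 1) γ)
    (hu₀_int : ∀ i, IntegrableOn (fun x => entropyVar γ s₀ (u₀ x) i) Ω)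
    (v : ℝ → Fin T.numElem → Pt (e + 1) → State (e + 1))
    (vhat : ℝ → Fin T.numFace → Pt (e + 1) → State (e + 1))
    (hsol : T.IsSolution k EE γ s₀ tf σ u₀ v vhat)
    (hphys : T.IsPhysical γ s₀ tf v vhat) :
    (∀ t ∈ Set.Ioo 0 tf,
      DifferentiableAt ℝ (fun τ => T.totalEntropy γ s₀ (v τ)) t ∧
        deriv (fun τ => T.totalEntropy γ s₀ (v τ)) t ≤ 0) ∧
    AntitoneOn (fun τ => T.totalEntropy γ s₀ (v τ)) (Set.Ico 0 tf) ∧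
    (∀ t ∈ Set.Ico 0 tf,
      T.volInt (fun _ _ => genEntropy γ s₀ (T.meanState γ s₀ (v 0))) ≤
          T.totalEntropy γ s₀ (v t) ∧
        T.totalEntropy γ s₀ (v t) ≤ T.totalEntropy γ s₀ (v 0)) := by
  have hd := fun t ht => T.hasDerivAt_totalEntropy hγ hsol hphys (t := t) ht
  have hneg : ∀ t ∈ Set.Ioo 0 tf, deriv (fun τ => T.totalEntropy γ s₀ (v τ)) t ≤ 0 := by
    intro t ht
    rw [(hd t ht).deriv]
    exact hsol.volInt_entropy_rate_nonpos hγ hΩ hσ hphys ht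
  have hanti : AntitoneOn (fun τ => T.totalEntropy γ s₀ (v τ)) (Set.Ico 0 tf) := by
    refine antitoneOn_of_deriv_nonpos (convex_Ico 0 tf)
      (T.volInt_time (isOpen_physicalV hγ) (contDiffOn_genEntropy_consVar hγ) hsol hphys.1).1 ?_ ?_
    · rw [interior_Ico]
      exact fun t ht => (hd t ht).differentiableAt.differentiableWithinAt
    · rw [interior_Ico]
      exact hneg
  refine ⟨fun t ht => ⟨(hd t ht).differentiableAt, hneg t ht⟩, hanti, fun t ht => ⟨?_, ?_⟩⟩
  -- By conservation the initial mean is also the mean at time `t`, where Jensen's inequality is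
  -- applied.
  · have hmean : T.meanState γ s₀ (v 0) = T.meanState γ s₀ (v t) := by
      funext i
      rw [Mesh.meanState, Mesh.meanState, T.volInt_consVar_eq hγ hsol hphys ht i]
    rw [hmean]
    exact T.volInt_genEntropy_le hΩ hγ (hsol.mem_V t ht) (hphys.1 t ht)
  · exact hanti ⟨le_rfl, htf⟩ ht ht.1
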